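/- Let $(W,\mathcal S)$ be a finite Coxeter system with Coxeter length $\ell$, let $B^+$ be its positive Artin monoid (the monoid generated by $\mathcal S$ subject to the braid relations only), and view $W$ inside $B^+$ by sending each element of $W$ to the class of any of its reduced words. Let $w_\circ$ be the longest element of $W$. For $m\ge 0$ let $W^{(m)}=\{w\in B^+ : w \text{ left-divides } w_\circ^m\}$ be the set of elements of the $m$-weak order. The Garside factors $w^{(1)},w^{(2)},\dots\in W$ of $w\in B^+$ are defined by $w_1=w$, $w^{(i)}=\gcd(w_i,w_\circ)$ (greatest common left divisor) and $w_i=w^{(i)}w_{i+1}$; thus $w^{(i)}=1$ once $w_i=1$. For a subset $J\subseteq\mathcal S$, let $W_J$ be the parabolic subgroup generated by $J$, and let $c=s_1s_2\cdots s_n$ be a Coxeter element of $W_J$, given by a word $\mathbf c$ in which each element of $J$ occurs exactly once. For $w\in W_J$ (or, when $J=\mathcal S$, for $w\in B^+$), the $c$-sorting word of $w$ is the lexicographically first subword (in terms of positions) of $\mathbf c^\infty=\mathbf c\,\mathbf c\,\mathbf c\cdots$ that is a reduced expression for $w$. The element $w$ is $c$-sortable if this subword uses, in the successive copies of $\mathbf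 c$, a decreasing sequence of subsets of the positions in $\mathbf c$. The root order $\leq_c$ on the reflections of $W_J$ is the order $t_1<t_1t_2t_1<t_1t_2t_3t_2t_1<\cdots$, where $t_1t_2t_3\cdots$ is the $c$-sorting word of the longest element of $W_J$. For $w\in W_J$ with right descent set $\mathrm{des}_R(w)=\{s\in \mathcal S:\ell(ws)<\ell(w)\}=\{s_{i_1},\dots,s_{i_k}\}\subseteq J$, numbered so that $ws_{i_1}w^{-1}<_c\cdots<_c ws_{i_k}w^{-1}$, the restriction of $c$ with respect to $w$ is the Coxeter element $c|_w=s_{i_1}\cdots s_{i_k}$ of $W_{\mathrm{des}_R(w)}$, given by this word. Let $c$ be a Coxeter element of $W$, given by a word as above. An element $w\in W^{(m)}$ with Garside factors $w^{(1)},\dots,w^{(m)}$ is called factorwise $c$-sortable if $w^{(i)}$ lies in $W_{\mathrm{des}_R(w^{(i-1)})}$ and is $c^{(i)}$-sortable there for all $1\le i\le m$, where $w^{(0)}=w_\circ$ (so that $W_{\mathrm{des}_R(w^{(0)})}=W$), $c^{(1)}=c$, and $c^{(i)}=c^{(i-1)}|_{w^{(i-1)}}$ for $2\le i\le m$. Then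 an element $w\in W^{(m)}$ is $c$-sortable if and only if it is factorwise $c$-sortable. -/

import Mathlib

/-- The braid relations of a Coxeter matrix: for all indices `i`, `j`, the alternating word
`⋯ i j` of length `M i j` is identified with the alternating word `⋯ j i` of the same length.
(For `i = j`, and for an entry `M i j = 0`, which encodes `∞`, the relation is void.) -/
def CoxeterMatrix.BraidRel {B : Type*} (M : CoxeterMatrix B) (a b : FreeMonoid B) : Prop :=
  ∃ i j : B, a = FreeMonoid.ofList (CoxeterSystem.braidWord M i j) ∧
    b = FreeMonoid.ofList (CoxeterSystem.braidWord M j i)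

/-- The positive Artin monoid `B⁺` : words in the simple generators modulo the braid relations. -/
abbrev CoxeterMatrix.ArtinMonoid {B : Type*} (M : CoxeterMatrix B) : Type _ :=
  PresentedMonoid M.BraidRel

/-- The element of the positive Artin monoid represented by a word. -/
def CoxeterMatrix.artinProd {B : Type*} (M : CoxeterMatrix B) (ω : List B) : M.ArtinMonoid :=
  (ω.map (PresentedMonoid.of M.BraidRel)).prod

namespace CoxeterSystem

/-- The copy in the positive Artin monoid of an element `w` of the Coxeter group: the element
represented by a reduced word for `w`. (All reduced words for `w` are related by braid moves, so
the choice of the reduced word does not matter.) -/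
noncomputable def toArtin {B : Type*} {M : CoxeterMatrix B} {W : Type*} [Group W]
    (cs : CoxeterSystem M W) (w : W) : M.ArtinMonoid :=
  M.artinProd (Classical.choose (cs.exists_isReduced w))

/-- The standard parabolic subgroup `W_J`. -/
def parabolic {B : Type*} {M : CoxeterMatrix B} {W : Type*} [Group W]
    (cs : CoxeterSystem M W) (J : Set B) : Subgroup W :=
  Subgroup.closure (cs.simple '' J)

theorem exists_longest {B : Type*} {M : CoxeterMatrix B} {W : Type*} [Group W] [Finite W]
    (cs : CoxeterSystem M W) (J : Set B) :
    ∃ w ∈ cs.parabolic J, ∀ u ∈ cs.parabolic J, cs.length u ≤ cs.length w :=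
  Set.exists_max_image (cs.parabolic J : Set W) cs.length (Set.toFinite _)
    ⟨1, (cs.parabolic J).one_mem⟩

/-- The longest element of the standard parabolic subgroup `W_J` of a finite Coxeter group.
(The length function of `W_J` is the restriction of the length function of `W`.) -/
noncomputable def longest {B : Type*} {M : CoxeterMatrix B} {W : Type*} [Group W] [Finite W]
    (cs : CoxeterSystem M W) (J : Set B) : W :=
  Classical.choose (cs.exists_longest J)

/-- The fundamental element `w₀` of the positive Artin monoid. -/
noncomputable def fundamental {B : Type*} {M : CoxeterMatrix B} {W : Type*} [Group W] [Finite W]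
    (cs : CoxeterSystem M W) : M.ArtinMonoid :=
  cs.toArtin (cs.longest Set.univ)

/-- The elements of the (right) `m`-weak order: the interval `[1, w₀ ^ m]` for left divisibility
in the positive Artin monoid. (`a ∣ b` means that `b = a * x` for some `x`; lengths add up
automatically, because the braid relations preserve the length of words.) -/
def mWeak {B : Type*} {M : CoxeterMatrix B} {W : Type*} [Group W] [Finite W]
    (cs : CoxeterSystem M W) (m : ℕ) : Set M.ArtinMonoid :=
  {w | w ∣ cs.fundamental ^ m}

/-- `v 0, v 1, v 2, …` are the Garside factors of `w`, continued by `1` after the last factor: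
starting from `r 0 = w`, the factor `v k` is the greatest common left divisor of `r k` and `w₀`,
and `r (k + 1)` is what remains of `r k` after removing `v k` on the left. -/
def IsGarsideFactorization {B : Type*} {M : CoxeterMatrix B} {W : Type*} [Group W] [Finite W]
    (cs : CoxeterSystem M W) (w : M.ArtinMonoid) (v : ℕ → W) : Prop :=
  ∃ r : ℕ → M.ArtinMonoid, r 0 = w ∧ ∀ k,
    r k = cs.toArtin (v k) * r (k + 1) ∧
    cs.toArtin (v k) ∣ cs.fundamental ∧
    ∀ d : M.ArtinMonoid, d ∣ r k → d ∣ cs.fundamental → d ∣ cs.toArtin (v k)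

/-- `c` is a reduced word for a (standard) Coxeter element: each simple reflection occurs
exactly once. -/
def IsCoxeterWord {B : Type*} (c : List B) : Prop :=
  c.Nodup ∧ ∀ i : B, i ∈ c

/-- The positions in the infinite word `c c c ⋯`, from left to right: `(k, j)` is the position `j`
in the `k`-th copy of `c` (copies are counted from `0`). -/
abbrev Position {B : Type*} (c : List B) : Type :=
  ℕ ×ₗ Fin c.length

/-- The subword of `c c c ⋯` on a list of positions. -/
def subword {B : Type*} (c : List B) (p : List (Position c)) : List B :=
  p.map fun x => c.get (ofLex x).2

/-- `p` is the list of positions of the lexicographically first subword of `c c c ⋯` that belongs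
to the set `E` of words. -/
def IsFirstSubword {B : Type*} (c : List B) (E : Set (List B)) (p : List (Position c)) : Prop :=
  p.Pairwise (· < ·) ∧ subword c p ∈ E ∧
    ∀ q : List (Position c), q.Pairwise (· < ·) → subword c q ∈ E → p ≤ q

/-- The positions used in each copy of `c` are also used in the copy before it. -/
def IsDecreasing {B : Type*} (c : List B) (p : List (Position c)) : Prop :=
  ∀ (k : ℕ) (j : Fin c.length), toLex (k + 1, j) ∈ p → toLex (k, j) ∈ p

/-- The reduced words for an element `w` of the Coxeter group. -/
def reducedWords {B : Type*} {M : CoxeterMatrix B} {W : Type*} [Group W]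
    (cs : CoxeterSystem M W) (w : W) : Set (List B) :=
  {ω | cs.IsReduced ω ∧ cs.wordProd ω = w}

/-- The words for an element `w` of the positive Artin monoid. They all have the same length, so
each of them is reduced. -/
def artinWords {B : Type*} (M : CoxeterMatrix B) (w : M.ArtinMonoid) : Set (List B) :=
  {ω | M.artinProd ω = w}

/-- An element `w` of the positive Artin monoid is `c`-sortable: its `c`-sorting word defines a
decreasing sequence of sets of positions in `c`. -/
def IsSortable {B : Type*} {M : CoxeterMatrix B} (c : List B) (w : M.ArtinMonoid) : Prop :=
  ∃ p : List (Position c), IsFirstSubword c (artinWords M w) p ∧ IsDecreasing c p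

/-- For a word `c` without repetitions in the set `J` of its letters, `w` is an element of the
standard parabolic subgroup `W_J`, and it is `c`-sortable there. (The reduced words for `w` in
`W_J` are the reduced words for `w` in `W`.) -/
def IsParabolicSortable {B : Type*} {M : CoxeterMatrix B} {W : Type*} [Group W]
    (cs : CoxeterSystem M W) (c : List B) (w : W) : Prop :=
  w ∈ cs.parabolic {i | i ∈ c} ∧
    ∃ p : List (Position c), IsFirstSubword c (cs.reducedWords w) p ∧ IsDecreasing c p

/-- For a word `c` without repetitions in the set `J` of its letters, and `w ∈ W_J`, the word `c'`
is the restriction of `c` with respect to `w`: it lists each right descent `s` of `w` once, in the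
order in which the reflections `w s w⁻¹` occur in the root order, i.e. in the reflection sequence
`s₁, s₁ s₂ s₁, …` of the `c`-sorting word `s₁ s₂ ⋯` of the longest element of `W_J`. -/
def IsRestriction {B : Type*} {M : CoxeterMatrix B} {W : Type*} [Group W] [Finite W]
    (cs : CoxeterSystem M W) (c : List B) (w : W) (c' : List B) : Prop :=
  c'.Nodup ∧ (∀ i : B, i ∈ c' ↔ cs.IsRightDescent w i) ∧
    ∃ p : List (Position c),
      IsFirstSubword c (cs.reducedWords (cs.longest {i | i ∈ c})) p ∧
      (c'.map fun i => w * cs.simple i * w⁻¹).Sublist (cs.leftInvSeq (subword c p))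

/-- An element `w` of the `m`-weak order is factorwise `c`-sortable. Here `v i` is the
`(i + 1)`-st Garside factor of `w` and `C i` is the Coxeter word for which it has to be sortable;
the letters of `C 0` are all simple reflections, and those of `C (i + 1)` are the right descents
of `v i`. -/
def IsFactorwiseSortable {B : Type*} {M : CoxeterMatrix B} {W : Type*} [Group W] [Finite W]
    (cs : CoxeterSystem M W) (m : ℕ) (c : List B) (w : M.ArtinMonoid) : Prop :=
  ∃ (v : ℕ → W) (C : ℕ → List B), cs.IsGarsideFactorization w v ∧
    C 0 = c ∧ (∀ i, i + 1 < m → cs.IsRestriction (C i) (v i) (C (i + 1))) ∧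
    ∀ i, i < m → cs.IsParabolicSortable (C i) (v i)

end CoxeterSystem

/-!
Both sides of the equivalence obey one recursion along the initial letter `s` of `c = s c'`. If `s`
left-divides `w`, then `w` is `c`-sortable if and only if `s⁻¹ w` is `c' s`-sortable; otherwise `w`
must avoid `s` altogether and be `c'`-sortable. The point is that "the first Garside factor `v` of
`w` is `c`-sortable, and the rest of `w` is sortable for the restriction of `c` with respect to `v`"
satisfies the same recursion. The only delicate case is that in which removing `s` from `w` changes
the right descents of `v`, so that letters move from the second Garside factor to the first one.

Restrictions are computed without reference to sorting words. For two inversions of a `c`-sortable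
element, listed as roots in the order of its sorting word, the skew form attached to `c` and to the
invariant form of the geometric representation is positive unless the roots are orthogonal. Hence
the restriction of `c` orders the cover reflections of `v` by the sign of this form, and it behaves
well when `c` is rotated. That the recursion describes the lexicographically first subword of
`c c c ⋯` is a greedy argument.
-/

open CoxeterMatrix CoxeterSystem

noncomputable section

namespace CoxeterSortable

/-! ### The geometric representation -/

section Reflection

open Polynomial.Chebyshev

theorem eval_S_two_mul_cos_mul_sin (φ : ℝ) (n : ℤ) :
    (S ℝ n).eval (2 * Real.cos φ) * Real.sin φ = Real.sin ((n + 1) * φ) := by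
  rw [← U_real_cos, ← S_comp_two_mul_X]; simp

theorem eval_S_sub_one_eq_zero {φ : ℝ} (hφ : Real.sin φ ≠ 0) {k : ℤ} (hk : k * φ = Real.pi) :
    (S ℝ (k - 1)).eval (2 * Real.cos φ) = 0 := by
  have h := eval_S_two_mul_cos_mul_sin φ (k - 1)
  push_cast at h
  rw [sub_add_cancel, hk, Real.sin_pi] at h
  exact (mul_eq_zero.1 h).resolve_right hφ

theorem eval_S_add_eval_S_sub_one_eq_zero {φ : ℝ} (hφ : Real.sin φ ≠ 0) {k : ℤ}
    (hk : (2 * k + 1) * φ = 2 * Real.pi) :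
    (S ℝ k).eval (2 * Real.cos φ) + (S ℝ (k - 1)).eval (2 * Real.cos φ) = 0 := by
  have hsin : Real.sin ((k + 1) * φ) + Real.sin (k * φ) = 0 := by
    rw [show ((k : ℝ) + 1) * φ = 2 * Real.pi - k * φ by linear_combination hk,
      Real.sin_two_pi_sub, neg_add_cancel]
  have h := eval_S_two_mul_cos_mul_sin φ (k - 1)
  push_cast at h
  rw [sub_add_cancel] at h
  rw [← eval_S_two_mul_cos_mul_sin, ← h, ← add_mul] at hsin
  exact (mul_eq_zero.1 hsin).resolve_right hφ

theorem reflection_mul_reflection_pow_eq_one {V : Type*} [AddCommGroup V] [Module ℝ V] {x y : V}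
    {f g : Module.Dual ℝ V} (hf : f x = 2) (hg : g y = 2) {m : ℕ} (hm : 3 ≤ m)
    (h : f y * g x = 4 * Real.cos (Real.pi / m) ^ 2) :
    (Module.reflection hf * Module.reflection hg) ^ m = 1 := by
  have hm' : (3 : ℝ) ≤ m := by exact_mod_cast hm
  have hmφ : m * (2 * (Real.pi / m)) = 2 * Real.pi := by field_simp
  have hsin : Real.sin (2 * (Real.pi / m)) ≠ 0 := by
    refine (Real.sin_pos_of_pos_of_lt_pi (by positivity) ?_).ne'
    nlinarith [Real.pi_pos, show 0 < Real.pi / m by positivity]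
  have ht : 2 * Real.cos (2 * (Real.pi / m)) = f y * g x - 2 := by rw [h, Real.cos_two_mul]; ring
  ext1 z
  rw [Module.reflection_mul_reflection_pow_apply hf hg m z _ ht]
  rcases Nat.even_or_odd' m with ⟨k, hk | hk⟩
  · have hS := eval_S_sub_one_eq_zero (k := k) hsin (by push_cast [hk] at hmφ ⊢; linarith)
    simp [show ((m : ℤ) - 2) / 2 = k - 1 by omega, show ((m : ℤ) - 1) / 2 = k - 1 by omega, hS]
  · have hS := eval_S_add_eval_S_sub_one_eq_zero (k := k) hsin
      (by push_cast [hk] at hmφ ⊢; linarith)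
    simp [show ((m : ℤ) - 2) / 2 = k - 1 by omega, show ((m : ℤ) - 1) / 2 = k by omega,
      show ((m : ℤ) - 3) / 2 = k - 1 by omega, show (m : ℤ) / 2 = k by omega, hS]

end Reflection

section Gram

variable {B : Type*} (M : CoxeterMatrix B)

/-- The entries of the Gram matrix of the simple roots in the geometric representation, scaled so
that simple roots have square length `2`. The entry `M i j = 0`, which encodes `∞`, gives `-2`,
because of `π / 0 = 0`. -/
def gram (i j : B) : ℝ := -2 * Real.cos (Real.pi / M i j)

theorem gram_self (i : B) : gram M i i = 2 := by simp [gram]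

theorem gram_comm (i j : B) : gram M i j = gram M j i := by simp [gram, M.symmetric i j]

theorem gram_nonpos {i j : B} (h : i ≠ j) : gram M i j ≤ 0 := by
  have hcos : 0 ≤ Real.cos (Real.pi / M i j) := by
    rcases Nat.eq_zero_or_pos (M i j) with h0 | h0
    · simp [h0]
    · have hM : (2 : ℝ) ≤ M i j := by have := M.off_diagonal i j h; exact_mod_cast (by omega)
      refine Real.cos_nonneg_of_neg_pi_div_two_le_of_le ?_ ?_
      · linarith [Real.pi_pos, show 0 ≤ Real.pi / M i j by positivity]
      · exact div_le_div_of_nonneg_left Real.pi_pos.le two_pos hM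
  rw [gram]; linarith

theorem eq_two_of_gram_eq_zero {i j : B} (h : gram M i j = 0) : M i j = 2 := by
  have hcos : Real.cos (Real.pi / M i j) = 0 := by simpa [gram] using h
  have h0 : M i j ≠ 0 := by
    intro h0
    simp [h0] at hcos
  have hpos : (0 : ℝ) < M i j := by exact_mod_cast Nat.pos_of_ne_zero h0
  have hle : Real.pi / M i j ≤ Real.pi :=
    div_le_self Real.pi_pos.le (by exact_mod_cast Nat.pos_of_ne_zero h0)
  have harg : Real.pi / M i j = Real.pi / 2 := Real.injOn_cos ⟨by positivity, hle⟩
    ⟨by positivity, by linarith [Real.pi_pos]⟩ (by rw [hcos, Real.cos_pi_div_two])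
  rw [div_eq_div_iff hpos.ne' two_ne_zero] at harg
  exact_mod_cast (mul_left_cancel₀ Real.pi_ne_zero harg).symm

/-- The bilinear form of the geometric representation, on the space of finitely supported
combinations of simple roots. -/
def form : (B →₀ ℝ) →ₗ[ℝ] (B →₀ ℝ) →ₗ[ℝ] ℝ :=
  Finsupp.linearCombination ℝ fun i => Finsupp.linearCombination ℝ (gram M i)

/-- The simple roots, i.e. the standard basis. -/
def root (i : B) : B →₀ ℝ := Finsupp.single i 1

theorem root_apply_self (i : B) : root i i = 1 := by simp [root]

theorem root_apply_ne {i j : B} (h : i ≠ j) : root i j = 0 := by simp [root, h]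

theorem root_nonneg (i : B) : 0 ≤ root i := Finsupp.single_nonneg.2 zero_le_one

theorem sum_smul_root (x : B →₀ ℝ) : (x.sum fun i a => a • root i) = x := by
  simp [root]

theorem form_root_root (i j : B) : form M (root i) (root j) = gram M i j := by
  simp [form, root]

theorem form_root_self (i : B) : form M (root i) (root i) = 2 := by
  rw [form_root_root, gram_self]

theorem form_comm (x y : B →₀ ℝ) : form M x y = form M y x := by
  have hflip : form M = (form M).flip := by
    ext i j
    simpa [form] using gram_comm M i j
  exact LinearMap.congr_fun₂ hflip x y

/-- The simple reflections of the geometric representation. -/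
def geomReflection (i : B) : (B →₀ ℝ) ≃ₗ[ℝ] (B →₀ ℝ) :=
  Module.reflection (form_root_self M i)

theorem geomReflection_apply (i : B) (x : B →₀ ℝ) :
    geomReflection M i x = x - form M (root i) x • root i := Module.reflection_apply _ _

theorem isLiftable_geomReflection : M.IsLiftable (geomReflection M) := by
  intro i j
  rcases eq_or_ne i j with rfl | hij
  · ext1 z
    simpa [diagonal, geomReflection] using Module.involutive_reflection (form_root_self M i) z
  rcases eq_or_ne (M i j) 2 with h2 | h2
  · have hgram : gram M i j = 0 := by simp [gram, h2]
    ext1 z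
    simp only [h2, pow_two, geomReflection_apply, map_sub, map_smul, form_root_root, gram_self,
      hgram, gram_comm M j i, LinearEquiv.mul_apply, LinearEquiv.coe_one, id_eq]
    module
  rcases eq_or_ne (M i j) 0 with h0 | h0
  · simp [h0]
  · have := M.off_diagonal i j hij
    refine reflection_mul_reflection_pow_eq_one _ _ (by omega) ?_
    rw [form_root_root, form_root_root, gram_comm M j i, gram]
    ring

end Gram

section Geom

variable {B : Type*} {M : CoxeterMatrix B} {W : Type*} [Group W] (cs : CoxeterSystem M W)

/-- The geometric representation. -/
def geom : W →* ((B →₀ ℝ) ≃ₗ[ℝ] (B →₀ ℝ)) := cs.lift ⟨_, isLiftable_geomReflection M⟩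

theorem geom_simple (i : B) (x : B →₀ ℝ) :
    geom cs (cs.simple i) x = x - form M (root i) x • root i := by
  rw [geom, cs.lift_apply_simple (isLiftable_geomReflection M), geomReflection_apply]

theorem geom_mul (u v : W) (x : B →₀ ℝ) : geom cs (u * v) x = geom cs u (geom cs v x) := by
  rw [map_mul]; rfl

theorem geom_one (x : B →₀ ℝ) : geom cs 1 x = x := by rw [map_one]; rfl

theorem geom_inv_geom (u : W) (x : B →₀ ℝ) : geom cs u⁻¹ (geom cs u x) = x := by
  rw [← geom_mul, inv_mul_cancel, geom_one]

theorem geom_geom_inv (u : W) (x : B →₀ ℝ) : geom cs u (geom cs u⁻¹ x) = x := by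
  rw [← geom_mul, mul_inv_cancel, geom_one]

theorem geom_simple_geom_simple (i : B) (x : B →₀ ℝ) :
    geom cs (cs.simple i) (geom cs (cs.simple i) x) = x := by
  rw [← geom_mul, simple_mul_simple_self, geom_one]

theorem geom_simple_root (i : B) : geom cs (cs.simple i) (root i) = -root i := by
  rw [geom_simple, form_root_self, two_smul]; abel

theorem geom_simple_apply_ne {i j : B} (h : i ≠ j) (x : B →₀ ℝ) :
    geom cs (cs.simple i) x j = x j := by
  simp [geom_simple, root_apply_ne h]

theorem form_geom (w : W) (x y : B →₀ ℝ) :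
    form M (geom cs w x) (geom cs w y) = form M x y := by
  induction w using cs.simple_induction_left generalizing x y with
  | one => simp
  | mul_simple_left w i ih =>
    rw [geom_mul, geom_mul, ← ih x y]
    simp only [geom_simple, map_sub, LinearMap.sub_apply, map_smul, LinearMap.smul_apply,
      smul_eq_mul, form_root_self, form_comm M (geom cs w x) (root i)]
    ring

theorem form_geom_root (w : W) (i : B) :
    form M (geom cs w (root i)) (geom cs w (root i)) = 2 := by
  rw [form_geom, form_root_self]

theorem geom_root_ne_zero (w : W) (s : B) : geom cs w (root s) ≠ 0 := by
  intro h
  simpa [h] using form_geom_root cs w s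

end Geom

/-! ### Descents and the positivity of roots -/

section Descents

variable {B : Type*} {M : CoxeterMatrix B} {W : Type*} [Group W] (cs : CoxeterSystem M W)

theorem length_alternatingWord_mul_le (i j : B) (k : ℕ) (v : W) :
    cs.length (cs.wordProd (alternatingWord i j k) * v) ≤ k + cs.length v := by
  have h := cs.length_mul_le (cs.wordProd (alternatingWord i j k)) v
  have h' := cs.length_wordProd_le (alternatingWord i j k)
  rw [length_alternatingWord] at h'
  omega

theorem le_of_length_alternatingWord_mul {i j : B} {k : ℕ} {v : W}
    (h : cs.length (cs.wordProd (alternatingWord i j k) * v) = k + cs.length v) :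
    k ≤ M i j ∨ M i j = 0 := by
  by_contra! hk
  refine cs.not_isReduced_alternatingWord i j hk.2 hk.1 ?_
  have h1 := cs.length_mul_le (cs.wordProd (alternatingWord i j k)) v
  have h2 := cs.length_wordProd_le (alternatingWord i j k)
  rw [length_alternatingWord] at h2
  rw [CoxeterSystem.IsReduced, length_alternatingWord]
  omega

theorem exists_dihedral_decomposition (w : W) (i j : B) : ∃ a b k v,
    ((a = i ∧ b = j) ∨ (a = j ∧ b = i)) ∧ w = cs.wordProd (alternatingWord a b k) * v ∧
    cs.length w = k + cs.length v ∧ ¬ cs.IsLeftDescent v a ∧ ¬ cs.IsLeftDescent v b := by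
  suffices ∀ n a b k v, cs.length v = n → ((a = i ∧ b = j) ∨ (a = j ∧ b = i)) →
      w = cs.wordProd (alternatingWord a b k) * v → cs.length w = k + cs.length v →
      ∃ a b k v, ((a = i ∧ b = j) ∨ (a = j ∧ b = i)) ∧
        w = cs.wordProd (alternatingWord a b k) * v ∧
        cs.length w = k + cs.length v ∧ ¬ cs.IsLeftDescent v a ∧ ¬ cs.IsLeftDescent v b from
    this _ i j 0 w rfl (.inl ⟨rfl, rfl⟩) (by simp [alternatingWord]) (by simp)
  intro n
  induction n using Nat.strong_induction_on with
  | _ n ih =>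
  rintro a b k v rfl hab hw hl
  by_cases ha : cs.IsLeftDescent v a
  · rw [isLeftDescent_iff] at ha
    refine ih _ (by omega) b a (k + 1) (cs.simple a * v) rfl (by tauto) ?_ (by omega)
    rw [alternatingWord_succ, wordProd_concat, mul_assoc, simple_mul_simple_cancel_left, hw]
  by_cases hb : cs.IsLeftDescent v b
  · rw [isLeftDescent_iff] at hb
    cases k with
    | zero =>
      refine ih _ (by omega) a b 1 (cs.simple b * v) rfl hab ?_ (by omega)
      simpa [alternatingWord] using hw
    | succ k =>
      rw [alternatingWord_succ, wordProd_concat, mul_assoc] at hw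
      have := length_alternatingWord_mul_le cs b a k (cs.simple b * v)
      rw [← hw] at this
      omega
  exact ⟨a, b, k, v, hab, hw, hl, ha, hb⟩

/-- The numbers `u n = sin (n θ) / sin θ` with `θ = π / M i j`, or `u n = n` if `M i j = 0`,
are the coordinates of the roots of the dihedral subgroup generated by `i` and `j`. -/
theorem exists_dihedral_seq {i j : B} (h : i ≠ j) : ∃ u : ℕ → ℝ, u 0 = 0 ∧ u 1 = 1 ∧
    (∀ n, u (n + 2) = -gram M i j * u (n + 1) - u n) ∧ ∀ n, n ≤ M i j ∨ M i j = 0 → 0 ≤ u n := by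
  rcases Nat.eq_zero_or_pos (M i j) with h0 | h0
  · refine ⟨fun n => n, by simp, by simp, fun n => ?_, fun n _ => by positivity⟩
    simp only [gram, h0, Nat.cast_zero, div_zero, Real.cos_zero]
    push_cast
    ring
  set θ := Real.pi / M i j with hθ
  have hm : (2 : ℝ) ≤ M i j := by have := M.off_diagonal i j h; exact_mod_cast (by omega)
  have hθm : M i j * θ = Real.pi := by rw [hθ]; field_simp
  have hθ0 : 0 < θ := by positivity
  have hsin : 0 < Real.sin θ := Real.sin_pos_of_pos_of_lt_pi hθ0 (by nlinarith)
  refine ⟨fun n => Real.sin (n * θ) / Real.sin θ, by simp, by simp [hsin.ne'], fun n => ?_,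
    fun n hn => ?_⟩
  · rw [gram, ← hθ]
    push_cast
    rw [show ((n : ℝ) + 2) * θ = (n + 1) * θ + θ by ring, show n * θ = (n + 1) * θ - θ by ring,
      Real.sin_add, Real.sin_sub]
    field_simp
    ring
  · refine div_nonneg (Real.sin_nonneg_of_nonneg_of_le_pi (by positivity) ?_) hsin.le
    have : (n : ℝ) ≤ M i j := by exact_mod_cast hn.resolve_right h0.ne'
    rw [← hθm]
    gcongr

theorem geom_alternatingWord_inv {i j : B} {u : ℕ → ℝ} (h0 : u 0 = 0) (h1 : u 1 = 1)
    (hu : ∀ n, u (n + 2) = -gram M i j * u (n + 1) - u n) (k : ℕ) :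
    geom cs (cs.wordProd (alternatingWord i j k))⁻¹ (root (if Even k then j else i)) =
      u (k + 1) • root j + u k • root i := by
  induction k generalizing i j with
  | zero => simp [alternatingWord, h0, h1]
  | succ k ih =>
    have hlast : (if Even (k + 1) then j else i) = (if Even k then i else j) := by
      simp only [Nat.even_add_one]; split_ifs <;> rfl
    rw [alternatingWord_succ, wordProd_concat, mul_inv_rev, inv_simple, geom_mul, hlast,
      ih (by simpa [gram_comm M j i] using hu), hu]
    simp only [geom_simple, map_add, map_smul, form_root_root, gram_self, gram_comm M j i]
    module

theorem geom_alternatingWord_inv_nonneg {i j : B} (h : i ≠ j) {v : W}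
    (hi : 0 ≤ geom cs v⁻¹ (root i)) (hj : 0 ≤ geom cs v⁻¹ (root j)) {k : ℕ}
    (hk : k < M i j ∨ M i j = 0) :
    0 ≤ geom cs (cs.wordProd (alternatingWord i j k) * v)⁻¹ (root (if Even k then j else i)) := by
  obtain ⟨u, h0, h1, hu, hpos⟩ := exists_dihedral_seq (M := M) h
  rw [mul_inv_rev, geom_mul, geom_alternatingWord_inv cs h0 h1 hu, map_add, map_smul, map_smul]
  exact add_nonneg (smul_nonneg (hpos _ (hk.imp_left (by omega))) hj)
    (smul_nonneg (hpos _ (hk.imp_left (by omega))) hi)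

/-- Of the two letters `i`, `j`, one is the first letter of the alternating word, hence a left
descent, and the other one extends the word. -/
theorem eq_ite_of_not_isLeftDescent {i j s : B} {k : ℕ} {v : W} (hs : s = i ∨ s = j) (hk : k ≠ 0)
    (hl : cs.length (cs.wordProd (alternatingWord i j k) * v) = k + cs.length v)
    (h : ¬ cs.IsLeftDescent (cs.wordProd (alternatingWord i j k) * v) s) :
    s = if Even k then j else i := by
  obtain ⟨k, rfl⟩ := Nat.exists_eq_succ_of_ne_zero hk
  by_contra hne
  have hfirst : s = if Even k then j else i := by
    simp only [Nat.succ_eq_add_one, Nat.even_add_one] at hne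
    rcases hs with rfl | rfl <;> split_ifs at hne ⊢ <;> simp_all
  apply h
  have := length_alternatingWord_mul_le cs i j k v
  rw [IsLeftDescent, hl, Nat.succ_eq_add_one, alternatingWord_succ', wordProd_cons, ← hfirst,
    mul_assoc, simple_mul_simple_cancel_left]
  omega

theorem geom_inv_root_nonneg {w : W} {s : B} (h : ¬ cs.IsLeftDescent w s) :
    0 ≤ geom cs w⁻¹ (root s) := by
  induction hn : cs.length w using Nat.strong_induction_on generalizing w s with
  | _ n ih =>
  rcases eq_or_ne w 1 with rfl | hw1
  · simpa using root_nonneg s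
  obtain ⟨t, ht⟩ := cs.exists_leftDescent_of_ne_one hw1
  have hst : s ≠ t := by rintro rfl; exact h ht
  obtain ⟨a, b, k, v, hab, rfl, hl, hva, hvb⟩ := exists_dihedral_decomposition cs w s t
  have hk : k ≠ 0 := by
    rintro rfl
    rcases hab with ⟨-, rfl⟩ | ⟨rfl, -⟩
    · exact hvb (by simpa [alternatingWord] using ht)
    · exact hva (by simpa [alternatingWord] using ht)
  have hs : s = if Even k then b else a :=
    eq_ite_of_not_isLeftDescent cs (hab.imp (·.1.symm) (·.2.symm)) hk hl h
  have hlt : k < M a b ∨ M a b = 0 := by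
    refine le_of_length_alternatingWord_mul cs (k := k + 1) (v := v) ?_
    rw [alternatingWord_succ', wordProd_cons, ← hs, mul_assoc, cs.not_isLeftDescent_iff.1 h]
    omega
  rw [hs]
  refine geom_alternatingWord_inv_nonneg cs ?_ (ih _ (by omega) hva rfl) (ih _ (by omega) hvb rfl)
    hlt
  rcases hab with ⟨rfl, rfl⟩ | ⟨rfl, rfl⟩
  exacts [hst, hst.symm]

theorem geom_inv_root_nonpos {w : W} {s : B} (h : cs.IsLeftDescent w s) :
    geom cs w⁻¹ (root s) ≤ 0 := by
  have := geom_inv_root_nonneg cs (cs.isLeftDescent_iff_not_isLeftDescent_mul.1 h)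
  rw [mul_inv_rev, inv_simple, geom_mul, geom_simple_root, map_neg] at this
  exact neg_nonneg.1 this

theorem isLeftDescent_iff_geom {w : W} {s : B} :
    cs.IsLeftDescent w s ↔ geom cs w⁻¹ (root s) ≤ 0 := by
  refine ⟨geom_inv_root_nonpos cs, fun h => by_contra fun h' => ?_⟩
  exact geom_root_ne_zero cs _ _ (le_antisymm h (geom_inv_root_nonneg cs h'))

theorem not_isLeftDescent_iff_geom {w : W} {s : B} :
    ¬ cs.IsLeftDescent w s ↔ 0 ≤ geom cs w⁻¹ (root s) := by
  refine ⟨geom_inv_root_nonneg cs, fun h h' => ?_⟩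
  exact geom_root_ne_zero cs _ _ (le_antisymm (geom_inv_root_nonpos cs h') h)

theorem isRightDescent_iff_geom {w : W} {s : B} :
    cs.IsRightDescent w s ↔ geom cs w (root s) ≤ 0 := by
  rw [← isLeftDescent_inv_iff, isLeftDescent_iff_geom, inv_inv]

theorem not_isRightDescent_iff_geom {w : W} {s : B} :
    ¬ cs.IsRightDescent w s ↔ 0 ≤ geom cs w (root s) := by
  rw [← isLeftDescent_inv_iff, not_isLeftDescent_iff_geom, inv_inv]

theorem geom_root_nonneg_or_nonpos (w : W) (s : B) :
    0 ≤ geom cs w (root s) ∨ geom cs w (root s) ≤ 0 := by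
  rw [← isRightDescent_iff_geom, ← not_isRightDescent_iff_geom]; tauto

theorem eq_of_geom_root_eq {u v : W} (h : ∀ s, geom cs u (root s) = geom cs v (root s)) :
    u = v := by
  rw [← inv_mul_eq_one]
  by_contra hne
  obtain ⟨s, hs⟩ := cs.exists_rightDescent_of_ne_one hne
  rw [isRightDescent_iff_geom, geom_mul, ← h, geom_inv_geom] at hs
  have := hs s
  rw [root_apply_self] at this
  norm_num at this

theorem length_alternatingWord_mul {v : W} {i j : B} (h : i ≠ j) (hi : ¬ cs.IsLeftDescent v i)
    (hj : ¬ cs.IsLeftDescent v j) {k : ℕ} (hk : k ≤ M i j ∨ M i j = 0) :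
    cs.length (cs.wordProd (alternatingWord i j k) * v) = k + cs.length v := by
  induction k with
  | zero => simp [alternatingWord]
  | succ k ih =>
    have := geom_alternatingWord_inv_nonneg cs h (geom_inv_root_nonneg cs hi)
      (geom_inv_root_nonneg cs hj) (k := k) (hk.imp_left (by omega))
    rw [← not_isLeftDescent_iff_geom, not_isLeftDescent_iff] at this
    rw [alternatingWord_succ', wordProd_cons, mul_assoc, this, ih (hk.imp_left (by omega))]
    omega

theorem exists_eq_braidWord_mul {w : W} {i j : B} (h : i ≠ j) (hi : cs.IsLeftDescent w i)
    (hj : cs.IsLeftDescent w j) : ∃ v, w = cs.wordProd (braidWord M i j) * v ∧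
      cs.length w = M i j + cs.length v ∧ M i j ≠ 0 := by
  obtain ⟨a, b, k, v, hab, rfl, hl, hva, hvb⟩ := exists_dihedral_decomposition cs w i j
  have hdesc : ∀ s, s = a ∨ s = b →
      cs.IsLeftDescent (cs.wordProd (alternatingWord a b k) * v) s := by
    rcases hab with ⟨rfl, rfl⟩ | ⟨rfl, rfl⟩ <;> rintro s (rfl | rfl) <;> assumption
  have hne : a ≠ b := by rcases hab with ⟨rfl, rfl⟩ | ⟨rfl, rfl⟩; exacts [h, h.symm]
  have hM : M a b = M i j := by
    rcases hab with ⟨rfl, rfl⟩ | ⟨rfl, rfl⟩; exacts [rfl, M.symmetric _ _]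
  have hprod : cs.wordProd (braidWord M a b) = cs.wordProd (braidWord M i j) := by
    rcases hab with ⟨rfl, rfl⟩ | ⟨rfl, rfl⟩; exacts [rfl, cs.wordProd_braidWord_eq _ _]
  have hge : ¬ (k < M a b ∨ M a b = 0) := fun hk =>
    (not_isLeftDescent_iff_geom cs).2 (geom_alternatingWord_inv_nonneg cs hne
      (geom_inv_root_nonneg cs hva) (geom_inv_root_nonneg cs hvb) hk)
      (hdesc _ (by split_ifs <;> simp))
  push Not at hge
  obtain rfl : k = M a b :=
    le_antisymm ((le_of_length_alternatingWord_mul cs hl).resolve_right hge.2) hge.1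
  exact ⟨v, by rw [← hprod, braidWord], by omega, by omega⟩

theorem reverse_alternatingWord (i j : B) (m : ℕ) : (alternatingWord i j m).reverse =
    if Even m then alternatingWord j i m else alternatingWord i j m := by
  induction m generalizing i j with
  | zero => simp [alternatingWord]
  | succ m ih =>
    rw [alternatingWord_succ, List.concat_eq_append, List.reverse_append, ih]
    simp only [Nat.even_add_one, List.reverse_singleton, List.singleton_append]
    by_cases h : Even m
    · have := alternatingWord_succ' i j m
      rw [alternatingWord_succ, if_pos h] at this
      simpa [h] using this.symm
    · simp [h, alternatingWord_succ' j i m]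

theorem wordProd_braidWord_inv (i j : B) :
    (cs.wordProd (braidWord M i j))⁻¹ = cs.wordProd (braidWord M i j) := by
  rw [← wordProd_reverse, braidWord, reverse_alternatingWord]
  split_ifs
  · have := cs.wordProd_braidWord_eq j i
    unfold braidWord at this
    rwa [M.symmetric j i] at this
  · rfl

theorem isReduced_braidWord {i j : B} (h : i ≠ j) : cs.IsReduced (braidWord M i j) := by
  have := length_alternatingWord_mul cs (v := 1) h (cs.not_isLeftDescent_one i)
    (cs.not_isLeftDescent_one j) (k := M i j) (by simp)
  rw [CoxeterSystem.IsReduced, length_alternatingWord]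
  simpa using this

theorem length_mul_braidWord {v : W} {i j : B} (h : i ≠ j) (hi : ¬ cs.IsRightDescent v i)
    (hj : ¬ cs.IsRightDescent v j) :
    cs.length (v * cs.wordProd (braidWord M i j)) = cs.length v + M i j := by
  rw [← isLeftDescent_inv_iff] at hi hj
  have := length_alternatingWord_mul cs h hi hj (k := M i j) (by simp)
  rw [← wordProd_braidWord_inv, ← mul_inv_rev, length_inv, length_inv] at this
  omega

theorem isReduced_cons {i : B} {ω : List B} : cs.IsReduced (i :: ω) ↔
    cs.IsReduced ω ∧ ¬ cs.IsLeftDescent (cs.wordProd ω) i := by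
  rw [not_isLeftDescent_iff, CoxeterSystem.IsReduced, CoxeterSystem.IsReduced, wordProd_cons,
    List.length_cons]
  have h1 := cs.length_simple_mul (cs.wordProd ω) i
  have h2 := cs.length_wordProd_le ω
  omega

end Descents

/-! ### The positive Artin monoid -/

section ArtinMonoid

variable {B : Type*} (M : CoxeterMatrix B)

theorem artinProd_nil : M.artinProd [] = 1 := rfl

theorem artinProd_cons (i : B) (ω : List B) :
    M.artinProd (i :: ω) = PresentedMonoid.of M.BraidRel i * M.artinProd ω := by
  simp [artinProd]

theorem artinProd_append (ω ω' : List B) :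
    M.artinProd (ω ++ ω') = M.artinProd ω * M.artinProd ω' := by
  simp [artinProd]

theorem mk_ofList (ω : List B) :
    PresentedMonoid.mk M.BraidRel (FreeMonoid.ofList ω) = M.artinProd ω := by
  induction ω with
  | nil => rfl
  | cons i ω ih => rw [artinProd_cons, ← ih]; rfl

theorem artinProd_surjective (b : M.ArtinMonoid) : ∃ ω, M.artinProd ω = b := by
  obtain ⟨a, rfl⟩ := PresentedMonoid.surjective_mk b
  exact ⟨FreeMonoid.toList a, (mk_ofList M _).symm⟩

theorem artinProd_braidWord (i j : B) :
    M.artinProd (CoxeterSystem.braidWord M i j) = M.artinProd (CoxeterSystem.braidWord M j i) := by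
  rw [← mk_ofList, ← mk_ofList]
  exact PresentedMonoid.mk_eq_mk_of_rel ⟨i, j, rfl, rfl⟩

/-- The universal property of the positive Artin monoid, in terms of words. -/
def artinLift {G : Type*} [Monoid G] (f : B → G)
    (h : ∀ i j, ((CoxeterSystem.braidWord M i j).map f).prod =
      ((CoxeterSystem.braidWord M j i).map f).prod) : M.ArtinMonoid →* G :=
  PresentedMonoid.lift f <| by
    rintro _ _ ⟨i, j, rfl, rfl⟩
    simpa [FreeMonoid.lift_apply] using h i j

theorem artinLift_artinProd {G : Type*} [Monoid G] (f : B → G)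
    (h : ∀ i j, ((CoxeterSystem.braidWord M i j).map f).prod =
      ((CoxeterSystem.braidWord M j i).map f).prod) (ω : List B) :
    artinLift M f h (M.artinProd ω) = (ω.map f).prod := by
  induction ω with
  | nil => simp [artinProd_nil]
  | cons i ω ih =>
    rw [artinProd_cons, map_mul, ih, List.map_cons, List.prod_cons]; rfl

/-- The length of an element of the positive Artin monoid. -/
def artinLength : M.ArtinMonoid →* Multiplicative ℕ :=
  artinLift M (fun _ => Multiplicative.ofAdd 1) fun i j => by simp [M.symmetric i j]

theorem artinLength_artinProd (ω : List B) :
    artinLength M (M.artinProd ω) = Multiplicative.ofAdd ω.length := by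
  rw [artinLength, artinLift_artinProd]
  simp [← ofAdd_nsmul]

theorem length_eq_of_artinProd_eq {ω ω' : List B} (h : M.artinProd ω = M.artinProd ω') :
    ω.length = ω'.length := by
  have := congrArg (artinLength M) h
  simpa [artinLength_artinProd] using this

end ArtinMonoid

section Matsumoto

variable {B : Type*} {M : CoxeterMatrix B} {W : Type*} [Group W] (cs : CoxeterSystem M W)

theorem exists_artinProd_cons_eq {w : W} {i j : B} (h : i ≠ j) (hi : cs.IsLeftDescent w i)
    (hj : cs.IsLeftDescent w j) : ∃ ω₁ ω₂ : List B,
      i :: ω₁ ∈ cs.reducedWords w ∧ j :: ω₂ ∈ cs.reducedWords w ∧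
        M.artinProd (i :: ω₁) = M.artinProd (j :: ω₂) := by
  obtain ⟨v, rfl, hlv, hM⟩ := exists_eq_braidWord_mul cs h hi hj
  obtain ⟨τ, hτ, rfl⟩ := cs.exists_isReduced v
  have hred : braidWord M i j ++ τ ∈
      cs.reducedWords (cs.wordProd (braidWord M i j) * cs.wordProd τ) := by
    refine ⟨?_, wordProd_append ..⟩
    rw [CoxeterSystem.IsReduced, wordProd_append, hlv, List.length_append, length_alternatingWord,
      hτ.eq]
  have hred' : braidWord M j i ++ τ ∈
      cs.reducedWords (cs.wordProd (braidWord M i j) * cs.wordProd τ) := by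
    have hprod : cs.wordProd (braidWord M j i ++ τ) =
        cs.wordProd (braidWord M i j) * cs.wordProd τ := by
      rw [wordProd_append, cs.wordProd_braidWord_eq]
    refine ⟨?_, hprod⟩
    rw [CoxeterSystem.IsReduced, hprod, hlv, List.length_append, length_alternatingWord,
      M.symmetric j i, hτ.eq]
  have hprod : M.artinProd (braidWord M i j ++ τ) = M.artinProd (braidWord M j i ++ τ) := by
    rw [artinProd_append, artinProd_append, artinProd_braidWord]
  obtain ⟨m, hm⟩ := Nat.exists_eq_succ_of_ne_zero hM
  have hcons : braidWord M i j = (if Even m then j else i) :: alternatingWord i j m := by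
    rw [braidWord, hm, Nat.succ_eq_add_one, alternatingWord_succ']
  have hcons' : braidWord M j i = (if Even m then i else j) :: alternatingWord j i m := by
    rw [braidWord, M.symmetric j i, hm, Nat.succ_eq_add_one, alternatingWord_succ']
  generalize cs.wordProd (braidWord M i j) * cs.wordProd τ = w at *
  rw [hcons, List.cons_append] at hred hprod
  rw [hcons', List.cons_append] at hred' hprod
  split_ifs at hred hred' hprod
  · exact ⟨_, _, hred', hred, hprod.symm⟩
  · exact ⟨_, _, hred, hred', hprod⟩

theorem isLeftDescent_wordProd_cons {i : B} {ω : List B} (h : cs.IsReduced (i :: ω)) :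
    cs.IsLeftDescent (cs.wordProd (i :: ω)) i := by
  rw [isLeftDescent_iff_not_isLeftDescent_mul, wordProd_cons, simple_mul_simple_cancel_left]
  exact ((isReduced_cons cs).1 h).2

/-- Matsumoto's theorem. -/
theorem artinProd_eq_of_isReduced {ω ω' : List B} (h : cs.IsReduced ω) (h' : cs.IsReduced ω')
    (he : cs.wordProd ω = cs.wordProd ω') : M.artinProd ω = M.artinProd ω' := by
  have hl : ω'.length = ω.length := by rw [← h'.eq, ← he, h.eq]
  induction hn : ω.length generalizing ω ω' with
  | zero => rw [List.length_eq_zero_iff.1 hn, List.length_eq_zero_iff.1 (hl.trans hn)]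
  | succ n ih =>
    have same_head : ∀ (i : B) (ω₁ ω₂ : List B), cs.wordProd (i :: ω₁) = cs.wordProd ω →
        cs.IsReduced (i :: ω₁) → cs.wordProd (i :: ω₂) = cs.wordProd ω →
        cs.IsReduced (i :: ω₂) → M.artinProd (i :: ω₁) = M.artinProd (i :: ω₂) := by
      intro i ω₁ ω₂ he₁ h₁ he₂ h₂
      have hl₁ : ω₁.length = n := by simpa [he₁, h.eq, hn] using h₁.eq.symm
      have hl₂ : ω₂.length = n := by simpa [he₂, h.eq, hn] using h₂.eq.symm
      rw [artinProd_cons, artinProd_cons, ih ((isReduced_cons cs).1 h₁).1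
        ((isReduced_cons cs).1 h₂).1 ?_ (hl₂.trans hl₁.symm) hl₁]
      exact mul_left_cancel ((wordProd_cons ..).symm.trans ((he₁.trans he₂.symm).trans
        (wordProd_cons ..)))
    obtain _ | ⟨i, ω⟩ := ω
    · simp at hn
    obtain _ | ⟨j, ω'⟩ := ω'
    · simp at hl
    rcases eq_or_ne i j with rfl | hij
    · exact same_head i ω ω' rfl h he.symm h'
    obtain ⟨ω₁, ω₂, ⟨h₁, he₁⟩, ⟨h₂, he₂⟩, heq⟩ := exists_artinProd_cons_eq cs hij
      (isLeftDescent_wordProd_cons cs h) (he ▸ isLeftDescent_wordProd_cons cs h')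
    exact (same_head i ω ω₁ rfl h he₁ h₁).trans
      (heq.trans (same_head j ω₂ ω' he₂ h₂ he.symm h'))

theorem toArtin_wordProd {ω : List B} (h : cs.IsReduced ω) :
    cs.toArtin (cs.wordProd ω) = M.artinProd ω := by
  obtain ⟨h1, h2⟩ := Classical.choose_spec (cs.exists_isReduced (cs.wordProd ω))
  exact artinProd_eq_of_isReduced cs h1 h h2.symm

theorem toArtin_mul {u v : W} (h : cs.length (u * v) = cs.length u + cs.length v) :
    cs.toArtin (u * v) = cs.toArtin u * cs.toArtin v := by
  obtain ⟨ω, h1, rfl⟩ := cs.exists_isReduced u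
  obtain ⟨ω', h2, rfl⟩ := cs.exists_isReduced v
  rw [← wordProd_append] at h ⊢
  rw [toArtin_wordProd, artinProd_append, toArtin_wordProd cs h1, toArtin_wordProd cs h2]
  rw [CoxeterSystem.IsReduced, h, h1.eq, h2.eq, List.length_append]

theorem toArtin_one : cs.toArtin 1 = 1 := by
  rw [← cs.wordProd_nil, toArtin_wordProd _ (by simp [CoxeterSystem.IsReduced]), artinProd_nil]

theorem toArtin_simple (i : B) : cs.toArtin (cs.simple i) = PresentedMonoid.of M.BraidRel i := by
  rw [← cs.wordProd_singleton, toArtin_wordProd _ (by simp [CoxeterSystem.IsReduced]),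
    artinProd_cons, artinProd_nil, mul_one]

theorem toArtin_simple_mul {w : W} {i : B} (h : ¬ cs.IsLeftDescent w i) :
    cs.toArtin (cs.simple i * w) = PresentedMonoid.of M.BraidRel i * cs.toArtin w := by
  rw [not_isLeftDescent_iff] at h
  rw [toArtin_mul, toArtin_simple]
  rw [h, length_simple, add_comm]

/-- The projection of the positive Artin monoid to the Coxeter group. -/
def artinProj : M.ArtinMonoid →* W :=
  artinLift M cs.simple fun i j => cs.wordProd_braidWord_eq i j

theorem artinProj_artinProd (ω : List B) : artinProj cs (M.artinProd ω) = cs.wordProd ω :=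
  artinLift_artinProd M _ _ _

theorem artinProj_toArtin (w : W) : artinProj cs (cs.toArtin w) = w := by
  obtain ⟨ω, h1, rfl⟩ := cs.exists_isReduced w
  rw [toArtin_wordProd cs h1, artinProj_artinProd]

theorem artinLength_toArtin (w : W) :
    artinLength M (cs.toArtin w) = Multiplicative.ofAdd (cs.length w) := by
  obtain ⟨ω, h1, rfl⟩ := cs.exists_isReduced w
  rw [toArtin_wordProd cs h1, artinLength_artinProd, h1.eq]

theorem toArtin_injective {u v : W} (h : cs.toArtin u = cs.toArtin v) : u = v := by
  rw [← artinProj_toArtin cs u, h, artinProj_toArtin]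

theorem artinWords_toArtin (w : W) : artinWords M (cs.toArtin w) = cs.reducedWords w := by
  ext ω
  constructor
  · intro (h : M.artinProd ω = _)
    have h1 : cs.wordProd ω = w := by rw [← artinProj_artinProd, h, artinProj_toArtin]
    refine ⟨?_, h1⟩
    have := congrArg (artinLength M) h
    rw [artinLength_artinProd, artinLength_toArtin] at this
    rw [CoxeterSystem.IsReduced, h1]
    exact (Multiplicative.ofAdd.injective this).symm
  · rintro ⟨h1, rfl⟩
    exact (toArtin_wordProd cs h1).symm

end Matsumoto

/-! ### The weak order -/

section WeakOrder

variable {B : Type*} {M : CoxeterMatrix B} {W : Type*} [Group W] (cs : CoxeterSystem M W)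

/-- The right weak order on the Coxeter group: lengths add up in `v = u (u⁻¹ v)`. -/
def WeakLE (u v : W) : Prop := cs.length v = cs.length u + cs.length (u⁻¹ * v)

theorem weakLE_mul {u v : W} (h : cs.length (u * v) = cs.length u + cs.length v) :
    WeakLE cs u (u * v) := by
  rw [WeakLE, inv_mul_cancel_left, h]

theorem length_inv_mul_le (u v w : W) :
    cs.length (u⁻¹ * w) ≤ cs.length (u⁻¹ * v) + cs.length (v⁻¹ * w) := by
  have := cs.length_mul_le (u⁻¹ * v) (v⁻¹ * w)
  rwa [mul_assoc, mul_inv_cancel_left] at this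

theorem length_le_add_length_inv_mul (u v : W) :
    cs.length v ≤ cs.length u + cs.length (u⁻¹ * v) := by
  have := cs.length_mul_le u (u⁻¹ * v)
  rwa [mul_inv_cancel_left] at this

theorem one_weakLE (v : W) : WeakLE cs 1 v := by simp [WeakLE]

theorem weakLE_refl (v : W) : WeakLE cs v v := by simp [WeakLE]

variable {cs}

theorem WeakLE.trans {u v w : W} (h : WeakLE cs u v) (h' : WeakLE cs v w) :
    WeakLE cs u w := by
  have h1 := length_inv_mul_le cs u v w
  have h2 := length_le_add_length_inv_mul cs u w
  unfold WeakLE at *; omega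

theorem WeakLE.length_inv_mul {u v w : W} (h : WeakLE cs u v) (h' : WeakLE cs v w) :
    cs.length (u⁻¹ * w) = cs.length (u⁻¹ * v) + cs.length (v⁻¹ * w) := by
  have h1 := h.trans h'
  unfold WeakLE at *; omega

theorem WeakLE.length_le {u v : W} (h : WeakLE cs u v) : cs.length u ≤ cs.length v := by
  unfold WeakLE at *; omega

theorem WeakLE.eq_of_length_le {u v : W} (h : WeakLE cs u v)
    (hl : cs.length v ≤ cs.length u) : u = v := by
  have : cs.length (u⁻¹ * v) = 0 := by unfold WeakLE at *; omega
  rw [length_eq_zero_iff, inv_mul_eq_one] at this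
  exact this

theorem WeakLE.antisymm {u v : W} (h : WeakLE cs u v) (h' : WeakLE cs v u) : u = v :=
  h.eq_of_length_le h'.length_le

theorem WeakLE.toArtin {u v : W} (h : WeakLE cs u v) :
    cs.toArtin v = cs.toArtin u * cs.toArtin (u⁻¹ * v) := by
  rw [← toArtin_mul, mul_inv_cancel_left]
  rwa [mul_inv_cancel_left]

theorem WeakLE.length_mul {u v w : W} (h : WeakLE cs v w)
    (hw : cs.length (u * w) = cs.length u + cs.length w) :
    cs.length (u * v) = cs.length u + cs.length v := by
  have h1 := cs.length_mul_le u v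
  have h2 := cs.length_mul_le (u * v) (v⁻¹ * w)
  rw [mul_assoc, mul_inv_cancel_left] at h2
  unfold WeakLE at h; omega

theorem WeakLE.mul_left {u v w : W} (h : WeakLE cs v w)
    (hw : cs.length (u * w) = cs.length u + cs.length w) : WeakLE cs (u * v) (u * w) := by
  have h1 := h.length_mul hw
  unfold WeakLE at *
  rw [mul_inv_rev, mul_assoc, inv_mul_cancel_left]; omega

theorem WeakLE.of_mul_left {u v w : W} (h : WeakLE cs (u * v) (u * w))
    (hv : cs.length (u * v) = cs.length u + cs.length v)
    (hw : cs.length (u * w) = cs.length u + cs.length w) : WeakLE cs v w := by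
  unfold WeakLE at *
  rw [mul_inv_rev, mul_assoc, inv_mul_cancel_left] at h; omega

variable (cs)

theorem weakLE_simple_iff {w : W} {i : B} :
    WeakLE cs (cs.simple i) w ↔ cs.IsLeftDescent w i := by
  rw [WeakLE, inv_simple, length_simple, isLeftDescent_iff]; omega

theorem weakLE_mul_simple {w : W} {i : B} (h : ¬ cs.IsRightDescent w i) :
    WeakLE cs w (w * cs.simple i) := by
  apply weakLE_mul
  rw [not_isRightDescent_iff] at h
  rw [h, length_simple]

theorem mul_simple_weakLE {w : W} {i : B} (h : cs.IsRightDescent w i) :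
    WeakLE cs (w * cs.simple i) w := by
  rw [isRightDescent_iff] at h
  rw [WeakLE, mul_inv_rev, inv_simple, inv_mul_cancel_right, length_simple, h]

theorem exists_mul_simple_weakLE {u v : W} (h : WeakLE cs u v) (hne : u ≠ v) :
    ∃ i, ¬ cs.IsRightDescent u i ∧ WeakLE cs (u * cs.simple i) v := by
  have hne' : u⁻¹ * v ≠ 1 := by rwa [Ne, inv_mul_eq_one]
  obtain ⟨i, hi⟩ := cs.exists_leftDescent_of_ne_one hne'
  have hp : WeakLE cs (cs.simple i) (u⁻¹ * v) := (weakLE_simple_iff cs).2 hi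
  have hv : cs.length (u * (u⁻¹ * v)) = cs.length u + cs.length (u⁻¹ * v) := by
    rw [mul_inv_cancel_left]; exact h
  refine ⟨i, ?_, ?_⟩
  · rw [not_isRightDescent_iff, hp.length_mul hv, length_simple]
  · simpa using hp.mul_left hv

theorem length_mul_of_length_mul_mul {u v w : W} (h : cs.length (u * v) = cs.length u + cs.length v)
    (h' : cs.length (u * v * w) = cs.length (u * v) + cs.length w) :
    cs.length (v * w) = cs.length v + cs.length w := by
  have h₁ := cs.length_mul_le v w
  have h₂ := cs.length_mul_le u (v * w)
  rw [← mul_assoc] at h₂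
  omega

theorem isRightDescent_braidWord {i j : B} (h : i ≠ j) (hM : M i j ≠ 0) :
    cs.IsRightDescent (cs.wordProd (braidWord M i j)) j := by
  obtain ⟨m, hm⟩ := Nat.exists_eq_succ_of_ne_zero hM
  have hle := cs.length_wordProd_le (alternatingWord j i m)
  rw [IsRightDescent, (isReduced_braidWord cs h).eq, length_alternatingWord, braidWord, hm,
    Nat.succ_eq_add_one, alternatingWord_succ, wordProd_concat, simple_mul_simple_cancel_right]
  rw [length_alternatingWord] at hle
  omega

theorem isLeftDescent_braidWord {i j : B} (h : i ≠ j) (hM : M i j ≠ 0) :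
    cs.IsLeftDescent (cs.wordProd (braidWord M i j)) j := by
  rw [← isRightDescent_inv_iff, wordProd_braidWord_inv]
  exact isRightDescent_braidWord cs h hM

theorem weakLE_mul_simple_mul_braidWord {v : W} {i j : B} (h : i ≠ j)
    (hi : ¬ cs.IsRightDescent v i) (hj : ¬ cs.IsRightDescent v j) (hM : M i j ≠ 0) :
    WeakLE cs (v * cs.simple j) (v * cs.wordProd (braidWord M i j)) := by
  refine ((weakLE_simple_iff cs).2 (isLeftDescent_braidWord cs h hM)).mul_left ?_
  rw [length_mul_braidWord cs h hi hj, (isReduced_braidWord cs h).eq, length_alternatingWord]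

/-- `m` satisfies `P`, and no upper cover of `m` in the weak order does. -/
def IsLocalMax (P : W → Prop) (m : W) : Prop :=
  P m ∧ ∀ i, P (m * cs.simple i) → cs.IsRightDescent m i

variable {cs} in
theorem IsLocalMax.eq_of_weakLE {P : W → Prop} {m v : W} (h : IsLocalMax cs P m)
    (hpre : ∀ u v, WeakLE cs u v → P v → P u) (hv : P v) (hmv : WeakLE cs m v) : m = v := by
  by_contra hne
  obtain ⟨i, hi, hle⟩ := exists_mul_simple_weakLE cs hmv hne
  exact hi (h.2 i (hpre _ _ hle hv))

theorem exists_isLocalMax {P : W → Prop} {N : ℕ} (hN : ∀ v, P v → cs.length v ≤ N) {v : W}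
    (hv : P v) : ∃ m, IsLocalMax cs P m ∧ WeakLE cs v m := by
  induction hn : N - cs.length v using Nat.strong_induction_on generalizing v with
  | _ n ih =>
  by_cases h : ∀ i, P (v * cs.simple i) → cs.IsRightDescent v i
  · exact ⟨v, ⟨hv, h⟩, weakLE_refl cs v⟩
  · push Not at h
    obtain ⟨i, hi, hd⟩ := h
    have hlt := hN _ hi
    rw [cs.not_isRightDescent_iff.1 hd] at hlt
    obtain ⟨m, hm, hle⟩ := ih _ (by rw [cs.not_isRightDescent_iff.1 hd]; omega) hi rfl
    exact ⟨m, hm, (weakLE_mul_simple cs hd).trans hle⟩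

/-- As in Newman's lemma, local confluence (here along braid words) implies confluence. -/
theorem isLocalMax_unique {P : W → Prop} {N : ℕ} (hN : ∀ v, P v → cs.length v ≤ N)
    (hpre : ∀ u v, WeakLE cs u v → P v → P u)
    (hbraid : ∀ v i j, i ≠ j → ¬ cs.IsRightDescent v i → ¬ cs.IsRightDescent v j →
      P (v * cs.simple i) → P (v * cs.simple j) →
      M i j ≠ 0 ∧ P (v * cs.wordProd (braidWord M i j)))
    {v m m' : W} (hm : IsLocalMax cs P m) (hm' : IsLocalMax cs P m') (hvm : WeakLE cs v m)
    (hvm' : WeakLE cs v m') : m = m' := by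
  induction hn : N - cs.length v using Nat.strong_induction_on generalizing v m m' with
  | _ n ih =>
  rcases eq_or_ne v m with rfl | hne
  · exact hm.eq_of_weakLE hpre hm'.1 hvm'
  rcases eq_or_ne v m' with rfl | hne'
  · exact (hm'.eq_of_weakLE hpre hm.1 hvm).symm
  obtain ⟨i, hi, hle⟩ := exists_mul_simple_weakLE cs hvm hne
  obtain ⟨j, hj, hle'⟩ := exists_mul_simple_weakLE cs hvm' hne'
  have hPi := hpre _ _ hle hm.1
  have hPj := hpre _ _ hle' hm'.1
  have hlt : ∀ k, ¬ cs.IsRightDescent v k → P (v * cs.simple k) →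
      N - cs.length (v * cs.simple k) < n := by
    intro k hk hP
    have := hN _ hP
    rw [cs.not_isRightDescent_iff.1 hk] at this ⊢
    omega
  rcases eq_or_ne i j with rfl | hij
  · exact ih _ (hlt i hi hPi) hm hm' hle hle' rfl
  obtain ⟨hM, hPb⟩ := hbraid v i j hij hi hj hPi hPj
  obtain ⟨x, hx, hbx⟩ := exists_isLocalMax cs hN hPb
  have hix : WeakLE cs (v * cs.simple i) x := by
    rw [← wordProd_braidWord_eq] at hbx
    exact (weakLE_mul_simple_mul_braidWord cs hij.symm hj hi (by rwa [M.symmetric])).trans hbx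
  have hjx := (weakLE_mul_simple_mul_braidWord cs hij hi hj hM).trans hbx
  exact (ih _ (hlt i hi hPi) hm hx hle hix rfl).trans
    (ih _ (hlt j hj hPj) hx hm' hjx hle' rfl)

theorem exists_max_of_braid_closed {P : W → Prop} {N : ℕ} (h1 : P 1)
    (hN : ∀ v, P v → cs.length v ≤ N) (hpre : ∀ u v, WeakLE cs u v → P v → P u)
    (hbraid : ∀ v i j, i ≠ j → ¬ cs.IsRightDescent v i → ¬ cs.IsRightDescent v j →
      P (v * cs.simple i) → P (v * cs.simple j) →
      M i j ≠ 0 ∧ P (v * cs.wordProd (braidWord M i j))) :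
    ∃ m, P m ∧ ∀ v, P v → WeakLE cs v m := by
  obtain ⟨m, hm, -⟩ := exists_isLocalMax cs hN h1
  refine ⟨m, hm.1, fun v hv => ?_⟩
  obtain ⟨m', hm', hvm'⟩ := exists_isLocalMax cs hN hv
  rwa [isLocalMax_unique cs hN hpre hbraid hm hm' (one_weakLE cs m) (one_weakLE cs m')]

theorem weakLE_mul_braidWord {v w : W} {i j : B} (h : i ≠ j) (hi : ¬ cs.IsRightDescent v i)
    (hj : ¬ cs.IsRightDescent v j) (hpi : WeakLE cs (v * cs.simple i) w)
    (hpj : WeakLE cs (v * cs.simple j) w) :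
    M i j ≠ 0 ∧ WeakLE cs (v * cs.wordProd (braidWord M i j)) w := by
  have hv : WeakLE cs v w := (weakLE_mul_simple cs hi).trans hpi
  have hd : ∀ k, ¬ cs.IsRightDescent v k → WeakLE cs (v * cs.simple k) w →
      cs.IsLeftDescent (v⁻¹ * w) k := by
    intro k hk hp
    rw [← weakLE_simple_iff]
    refine WeakLE.of_mul_left (u := v) ?_ ?_ ?_
    · rwa [mul_inv_cancel_left]
    · rw [cs.not_isRightDescent_iff.1 hk, length_simple]
    · rw [mul_inv_cancel_left]; exact hv
  obtain ⟨x, hx, hlx, hM⟩ := exists_eq_braidWord_mul cs h (hd i hi hpi) (hd j hj hpj)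
  refine ⟨hM, ?_⟩
  have hp : WeakLE cs (cs.wordProd (braidWord M i j)) (v⁻¹ * w) := by
    rw [hx]; apply weakLE_mul
    rw [← hx, hlx, (isReduced_braidWord cs h).eq, length_alternatingWord]
  have := hp.mul_left (u := v) (by rw [mul_inv_cancel_left]; exact hv)
  rwa [mul_inv_cancel_left] at this

theorem exists_max_prefix (u w : W) : ∃ x,
    (WeakLE cs x w ∧ cs.length (u * x) = cs.length u + cs.length x) ∧
    ∀ v, WeakLE cs v w ∧ cs.length (u * v) = cs.length u + cs.length v → WeakLE cs v x := by
  apply exists_max_of_braid_closed cs (N := cs.length w)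
  · exact ⟨one_weakLE cs w, by simp⟩
  · exact fun v hv => hv.1.length_le
  · exact fun v x h hx => ⟨h.trans hx.1, h.length_mul hx.2⟩
  · intro v i j hij hi hj hPi hPj
    obtain ⟨hM, hp⟩ := weakLE_mul_braidWord cs hij hi hj hPi.1 hPj.1
    refine ⟨hM, hp, ?_⟩
    have hv := (weakLE_mul_simple cs hi).length_mul hPi.2
    have hd : ∀ k, ¬ cs.IsRightDescent v k →
        cs.length (u * (v * cs.simple k)) = cs.length u + cs.length (v * cs.simple k) →
        ¬ cs.IsRightDescent (u * v) k := by
      intro k hk hl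
      rw [not_isRightDescent_iff] at hk ⊢
      rw [mul_assoc, hl, hk, hv, add_assoc]
    rw [← mul_assoc, length_mul_braidWord cs hij (hd i hi hPi.2) (hd j hj hPj.2), hv,
      length_mul_braidWord cs hij hi hj, add_assoc]

/-- The longest prefix `x` of `w`, in the weak order, for which lengths add up in `u x`. -/
def maxPrefix (u w : W) : W := Classical.choose (exists_max_prefix cs u w)

theorem maxPrefix_weakLE (u w : W) : WeakLE cs (maxPrefix cs u w) w :=
  (Classical.choose_spec (exists_max_prefix cs u w)).1.1

theorem length_mul_maxPrefix (u w : W) :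
    cs.length (u * maxPrefix cs u w) = cs.length u + cs.length (maxPrefix cs u w) :=
  (Classical.choose_spec (exists_max_prefix cs u w)).1.2

theorem weakLE_maxPrefix {u w v : W} (h : WeakLE cs v w)
    (hl : cs.length (u * v) = cs.length u + cs.length v) : WeakLE cs v (maxPrefix cs u w) :=
  (Classical.choose_spec (exists_max_prefix cs u w)).2 v ⟨h, hl⟩

theorem maxPrefix_one (w : W) : maxPrefix cs 1 w = w :=
  (maxPrefix_weakLE cs 1 w).antisymm (weakLE_maxPrefix cs (weakLE_refl cs w) (by simp))

theorem maxPrefix_mul {u v w : W} (h : cs.length (u * v) = cs.length u + cs.length v) :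
    maxPrefix cs u (v * maxPrefix cs v w) = v * maxPrefix cs (u * v) w := by
  have hx := maxPrefix_weakLE cs (u * v) w
  have hxl := length_mul_maxPrefix cs (u * v) w
  set x := maxPrefix cs (u * v) w
  have hvx := length_mul_of_length_mul_mul cs h hxl
  have huvx : cs.length (u * (v * x)) = cs.length u + cs.length (v * x) := by
    rw [← mul_assoc]; omega
  have hle : WeakLE cs (v * x) (maxPrefix cs u (v * maxPrefix cs v w)) :=
    weakLE_maxPrefix cs ((weakLE_maxPrefix cs hx hvx).mul_left (length_mul_maxPrefix cs v w)) huvx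
  refine (hle.antisymm ?_).symm
  have hy := maxPrefix_weakLE cs u (v * maxPrefix cs v w)
  have hyl := length_mul_maxPrefix cs u (v * maxPrefix cs v w)
  set y := maxPrefix cs u (v * maxPrefix cs v w)
  have hvy : WeakLE cs v y := (weakLE_mul cs hvx).trans hle
  clear_value y
  obtain ⟨z, rfl⟩ : ∃ z, y = v * z := ⟨v⁻¹ * y, by rw [mul_inv_cancel_left]⟩
  have hvz : cs.length (v * z) = cs.length v + cs.length z := by
    simpa [WeakLE] using hvy
  have hz := hy.of_mul_left hvz (length_mul_maxPrefix cs v w)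
  refine WeakLE.mul_left ?_ hvx
  refine weakLE_maxPrefix cs (hz.trans (maxPrefix_weakLE cs v w)) ?_
  rw [mul_assoc]; omega

end WeakOrder

/-! ### The first Garside factor -/

section Garside

variable {B : Type*} {M : CoxeterMatrix B} {W : Type*} [Group W] (cs : CoxeterSystem M W)

/-- The action of `W` by which the positive Artin monoid acts on pairs consisting of a simple
element and a remainder. -/
def normalAct (u : W) (p : W × M.ArtinMonoid) : W × M.ArtinMonoid :=
  (u * maxPrefix cs u p.1, cs.toArtin ((maxPrefix cs u p.1)⁻¹ * p.1) * p.2)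

theorem normalAct_one (p : W × M.ArtinMonoid) : normalAct cs 1 p = p := by
  simp [normalAct, maxPrefix_one, toArtin_one]

theorem normalAct_mul {u v : W} (h : cs.length (u * v) = cs.length u + cs.length v)
    (p : W × M.ArtinMonoid) : normalAct cs u (normalAct cs v p) = normalAct cs (u * v) p := by
  have hv := maxPrefix_weakLE cs v p.1
  have e := maxPrefix_mul cs (w := p.1) h
  simp only [normalAct, e, mul_assoc u v, Prod.mk.injEq, true_and]
  rw [← mul_assoc, ← toArtin_mul]
  · congr 2; group
  · have h1 := maxPrefix_weakLE cs (u * v) p.1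
    have h2 := length_mul_maxPrefix cs (u * v) p.1
    have h3 : WeakLE cs (maxPrefix cs (u * v) p.1) (maxPrefix cs v p.1) :=
      weakLE_maxPrefix cs h1 (length_mul_of_length_mul_mul cs h h2)
    have := h3.length_inv_mul hv
    convert this using 2 <;> group

/-- `normalAct`, as an endomorphism. -/
def normalEnd (u : W) : Function.End (W × M.ArtinMonoid) := normalAct cs u

theorem normalEnd_smul (u : W) (p : W × M.ArtinMonoid) :
    normalEnd cs u • p = normalAct cs u p := rfl

theorem functionEnd_ext {X : Type*} {f g : Function.End X} (h : ∀ p : X, f • p = g • p) : f = g :=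
  funext h

theorem normalEnd_wordProd {ω : List B} (h : cs.IsReduced ω) :
    (ω.map fun i => normalEnd cs (cs.simple i)).prod = normalEnd cs (cs.wordProd ω) := by
  induction ω with
  | nil =>
    refine functionEnd_ext fun p => ?_
    rw [wordProd_nil, normalEnd_smul, normalAct_one, List.map_nil, List.prod_nil, one_smul]
  | cons i ω ih =>
    have h' := (isReduced_cons cs).1 h
    rw [List.map_cons, List.prod_cons, ih h'.1, wordProd_cons]
    refine functionEnd_ext fun p => ?_
    rw [mul_smul]
    refine normalAct_mul cs ?_ p
    rw [cs.not_isLeftDescent_iff.1 h'.2, length_simple, add_comm]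

/-- The action of the positive Artin monoid on pairs consisting of a simple element and a
remainder. -/
def artinAct : M.ArtinMonoid →* Function.End (W × M.ArtinMonoid) :=
  artinLift M (fun i => normalEnd cs (cs.simple i)) fun i j => by
    by_cases h : i = j
    · rw [h]
    · rw [normalEnd_wordProd cs (isReduced_braidWord cs h),
        normalEnd_wordProd cs (isReduced_braidWord cs (Ne.symm h)), wordProd_braidWord_eq]

theorem artinAct_toArtin (u : W) : artinAct cs (cs.toArtin u) = normalEnd cs u := by
  obtain ⟨ω, h1, rfl⟩ := cs.exists_isReduced u
  rw [toArtin_wordProd cs h1, artinAct, artinLift_artinProd, normalEnd_wordProd cs h1]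

theorem normalAct_eval (u : W) (p : W × M.ArtinMonoid) :
    cs.toArtin (normalAct cs u p).1 * (normalAct cs u p).2 =
      cs.toArtin u * (cs.toArtin p.1 * p.2) := by
  rw [normalAct, toArtin_mul cs (length_mul_maxPrefix cs u p.1),
    (maxPrefix_weakLE cs u p.1).toArtin]
  simp only [mul_assoc]

theorem artin_induction {P : M.ArtinMonoid → Prop} (b : M.ArtinMonoid) (one : P 1)
    (mul : ∀ i b, P b → P (PresentedMonoid.of M.BraidRel i * b)) : P b := by
  obtain ⟨ω, rfl⟩ := artinProd_surjective M b
  induction ω with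
  | nil => exact one
  | cons i ω ih => rw [artinProd_cons]; exact mul i _ ih

theorem artinAct_of_mul (i : B) (b : M.ArtinMonoid) (p : W × M.ArtinMonoid) :
    artinAct cs (PresentedMonoid.of M.BraidRel i * b) • p =
      normalAct cs (cs.simple i) (artinAct cs b • p) := by
  rw [map_mul, ← toArtin_simple cs i, artinAct_toArtin, mul_smul, normalEnd_smul]

theorem artinAct_toArtin_mul (u : W) (b : M.ArtinMonoid) (p : W × M.ArtinMonoid) :
    artinAct cs (cs.toArtin u * b) • p = normalAct cs u (artinAct cs b • p) := by
  rw [map_mul, artinAct_toArtin, mul_smul, normalEnd_smul]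

/-- The first Garside factor: the greatest simple left divisor. -/
def head (b : M.ArtinMonoid) : W := (artinAct cs b • ((1, 1) : W × M.ArtinMonoid)).1

/-- What remains after removing the first Garside factor. -/
def rest (b : M.ArtinMonoid) : M.ArtinMonoid := (artinAct cs b • ((1, 1) : W × M.ArtinMonoid)).2

theorem toArtin_head_mul_rest (b : M.ArtinMonoid) : cs.toArtin (head cs b) * rest cs b = b := by
  unfold head rest
  induction b using artin_induction with
  | one => rw [map_one, one_smul, toArtin_one, one_mul]
  | mul i b ih => rw [artinAct_of_mul, normalAct_eval, ih, toArtin_simple]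

theorem head_toArtin_mul (u : W) (b : M.ArtinMonoid) :
    head cs (cs.toArtin u * b) = u * maxPrefix cs u (head cs b) := by
  rw [head, artinAct_toArtin_mul]; rfl

theorem rest_toArtin_mul (u : W) (b : M.ArtinMonoid) : rest cs (cs.toArtin u * b) =
    cs.toArtin ((maxPrefix cs u (head cs b))⁻¹ * head cs b) * rest cs b := by
  rw [rest, artinAct_toArtin_mul]; rfl

theorem toArtin_dvd_iff {u : W} {b : M.ArtinMonoid} :
    cs.toArtin u ∣ b ↔ WeakLE cs u (head cs b) := by
  constructor
  · rintro ⟨x, rfl⟩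
    rw [head_toArtin_mul]
    exact weakLE_mul cs (length_mul_maxPrefix cs _ _)
  · intro h
    rw [← toArtin_head_mul_rest cs b, h.toArtin, mul_assoc]
    exact dvd_mul_right _ _

theorem eq_toArtin_mul_rest (u : W) (b : M.ArtinMonoid) :
    b = cs.toArtin (u⁻¹ * head cs (cs.toArtin u * b)) * rest cs (cs.toArtin u * b) := by
  rw [head_toArtin_mul, rest_toArtin_mul, inv_mul_cancel_left, ← mul_assoc,
    ← (maxPrefix_weakLE cs u (head cs b)).toArtin, toArtin_head_mul_rest]

theorem toArtin_mul_left_cancel {u : W} {b b' : M.ArtinMonoid}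
    (h : cs.toArtin u * b = cs.toArtin u * b') : b = b' := by
  rw [eq_toArtin_mul_rest cs u b, h, ← eq_toArtin_mul_rest cs u b']

theorem of_mul_left_cancel (cs : CoxeterSystem M W) {i : B} {b b' : M.ArtinMonoid}
    (h : PresentedMonoid.of M.BraidRel i * b = PresentedMonoid.of M.BraidRel i * b') : b = b' := by
  rw [← toArtin_simple cs] at h
  exact toArtin_mul_left_cancel cs h

theorem of_dvd_iff {i : B} {b : M.ArtinMonoid} :
    PresentedMonoid.of M.BraidRel i ∣ b ↔ cs.IsLeftDescent (head cs b) i := by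
  rw [← toArtin_simple cs, toArtin_dvd_iff, weakLE_simple_iff]

end Garside

/-! ### Inversions as roots -/

section Roots

variable {B : Type*} {M : CoxeterMatrix B} {W : Type*} [Group W] (cs : CoxeterSystem M W)

theorem map_nonneg_of_forall_root {N : Type*} [AddCommGroup N] [PartialOrder N]
    [IsOrderedAddMonoid N] [Module ℝ N] [PosSMulMono ℝ N] (f : (B →₀ ℝ) →ₗ[ℝ] N) {x : B →₀ ℝ}
    (hx : 0 ≤ x) (h : ∀ i, x i ≠ 0 → 0 ≤ f (root i)) : 0 ≤ f x := by
  rw [← sum_smul_root x, map_finsuppSum]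
  refine Finset.sum_nonneg fun i hi => ?_
  change 0 ≤ f (x i • root i)
  rw [map_smul]
  exact smul_nonneg (hx i) (h i (Finsupp.mem_support_iff.1 hi))

theorem geom_conj_simple (g : W) (j : B) (x : B →₀ ℝ) :
    geom cs (g * cs.simple j * g⁻¹) x =
      x - form M (geom cs g (root j)) x • geom cs g (root j) := by
  rw [geom_mul, geom_mul, geom_simple, map_sub, map_smul, geom_geom_inv, ← form_geom cs g,
    geom_geom_inv]

theorem conj_simple_eq {g h : W} {i j : B}
    (e : geom cs g (root i) = geom cs h (root j) ∨ geom cs g (root i) = -geom cs h (root j)) :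
    g * cs.simple i * g⁻¹ = h * cs.simple j * h⁻¹ := by
  apply eq_of_geom_root_eq cs
  intro s
  rw [geom_conj_simple, geom_conj_simple]
  rcases e with e | e <;> simp [e]

theorem mul_simple_eq_simple_mul {g : W} {i j : B}
    (e : geom cs g (root i) = root j ∨ geom cs g (root i) = -root j) :
    g * cs.simple i = cs.simple j * g := by
  have := conj_simple_eq cs (g := g) (h := 1) (i := i) (j := j) (by simpa using e)
  simp only [one_mul, inv_one, mul_one] at this
  rw [← this, inv_mul_cancel_right]

/-- The positive roots: the images of simple roots that have nonnegative coordinates. -/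
def IsPosRoot (τ : B →₀ ℝ) : Prop := (∃ g i, τ = geom cs g (root i)) ∧ 0 ≤ τ

/-- The positive roots that `v⁻¹` makes negative. Their reflections are the left inversions
of `v`. -/
def inversionRoots (v : W) : Set (B →₀ ℝ) := {τ | IsPosRoot cs τ ∧ geom cs v⁻¹ τ ≤ 0}

variable {cs}

theorem IsPosRoot.form_self {τ : B →₀ ℝ} (h : IsPosRoot cs τ) : form M τ τ = 2 := by
  obtain ⟨⟨g, i, rfl⟩, -⟩ := h
  exact form_geom_root cs g i

theorem IsPosRoot.ne_zero {τ : B →₀ ℝ} (h : IsPosRoot cs τ) : τ ≠ 0 := by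
  obtain ⟨⟨g, i, rfl⟩, -⟩ := h
  exact geom_root_ne_zero cs g i

theorem IsPosRoot.not_nonpos {τ : B →₀ ℝ} (h : IsPosRoot cs τ) : ¬ τ ≤ 0 := fun h' =>
  h.ne_zero (le_antisymm h' h.2)

theorem IsPosRoot.geom_or {τ : B →₀ ℝ} (h : IsPosRoot cs τ) (w : W) :
    IsPosRoot cs (geom cs w τ) ∨ geom cs w τ ≤ 0 := by
  obtain ⟨⟨g, i, rfl⟩, -⟩ := h
  rw [← geom_mul]
  rcases geom_root_nonneg_or_nonpos cs (w * g) i with h | h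
  · exact Or.inl ⟨⟨_, _, rfl⟩, h⟩
  · exact Or.inr h

theorem IsPosRoot.eq_root {τ : B →₀ ℝ} (h : IsPosRoot cs τ) {s : B}
    (h0 : ∀ i, i ≠ s → τ i = 0) : τ = root s := by
  have e : τ = τ s • root s := by
    ext i
    by_cases hi : i = s
    · subst hi; simp [root_apply_self]
    · simp [h0 i hi, root_apply_ne (Ne.symm hi)]
  have h1 := h.form_self
  rw [e] at h1
  simp only [map_smul, LinearMap.smul_apply, form_root_self, smul_eq_mul] at h1
  have h2 : 0 ≤ τ s := h.2 s
  have h3 : τ s = 1 := by nlinarith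
  rw [e, h3, one_smul]

theorem IsPosRoot.geom_simple {τ : B →₀ ℝ} (h : IsPosRoot cs τ) {s : B} (hs : τ ≠ root s) :
    IsPosRoot cs (geom cs (cs.simple s) τ) := by
  refine (h.geom_or (cs.simple s)).resolve_right fun hn => hs (h.eq_root fun i hi => ?_)
  have h1 := hn i
  rw [geom_simple_apply_ne cs (Ne.symm hi)] at h1
  exact le_antisymm h1 (h.2 i)

variable (cs)

theorem isPosRoot_root (s : B) : IsPosRoot cs (root s) := ⟨⟨1, s, by simp⟩, root_nonneg s⟩

theorem root_mem_inversionRoots {v : W} {s : B} :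
    root s ∈ inversionRoots cs v ↔ cs.IsLeftDescent v s := by
  rw [isLeftDescent_iff_geom]
  exact ⟨fun h => h.2, fun h => ⟨isPosRoot_root cs s, h⟩⟩

theorem inversionRoots_one : inversionRoots cs 1 = ∅ := by
  ext τ
  simp only [inversionRoots, Set.mem_ofPred_eq, inv_one, Set.mem_empty_iff_false, iff_false]
  rintro ⟨h, h'⟩
  rw [geom_one] at h'
  exact h.not_nonpos h'

theorem geom_mem_inversionRoots_mul {v : W} {s : B} (h : ¬ cs.IsLeftDescent v s) {β : B →₀ ℝ}
    (hβ : β ∈ inversionRoots cs v) :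
    geom cs (cs.simple s) β ∈ inversionRoots cs (cs.simple s * v) := by
  refine ⟨hβ.1.geom_simple ?_, ?_⟩
  · rintro rfl
    exact h ((root_mem_inversionRoots cs).1 hβ)
  · rw [mul_inv_rev, inv_simple, geom_mul, geom_simple_geom_simple]
    exact hβ.2

theorem geom_mem_inversionRoots {v : W} {s : B} {β : B →₀ ℝ}
    (hβ : β ∈ inversionRoots cs (cs.simple s * v)) (hne : β ≠ root s) :
    geom cs (cs.simple s) β ∈ inversionRoots cs v := by
  refine ⟨hβ.1.geom_simple hne, ?_⟩
  have := hβ.2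
  rwa [mul_inv_rev, inv_simple, geom_mul] at this

theorem neg_geom_root_mem {v : W} {i : B} (h : cs.IsRightDescent v i) :
    -geom cs v (root i) ∈ inversionRoots cs v := by
  rw [isRightDescent_iff_geom] at h
  refine ⟨⟨⟨v * cs.simple i, i, ?_⟩, neg_nonneg.2 h⟩, ?_⟩
  · rw [geom_mul, geom_simple_root, map_neg]
  · rw [map_neg, geom_inv_geom]; exact neg_nonpos.2 (root_nonneg i)

theorem conj_mem_leftInvSeq {ω : List B} {g : W} {j : B} (h0 : 0 ≤ geom cs g (root j))
    (h : geom cs (cs.wordProd ω)⁻¹ (geom cs g (root j)) ≤ 0) :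
    g * cs.simple j * g⁻¹ ∈ cs.leftInvSeq ω := by
  induction ω generalizing g with
  | nil =>
    rw [wordProd_nil, inv_one, geom_one] at h
    exact absurd (le_antisymm h h0) (geom_root_ne_zero cs g j)
  | cons b ω ih =>
    rw [leftInvSeq, List.mem_cons]
    by_cases e : geom cs g (root j) = root b
    · left
      rw [mul_simple_eq_simple_mul cs (Or.inl e), mul_inv_cancel_right]
    · right
      have hp : IsPosRoot cs (geom cs g (root j)) := ⟨⟨_, _, rfl⟩, h0⟩
      have h1 := (hp.geom_simple e).2
      rw [wordProd_cons, mul_inv_rev, inv_simple, geom_mul, ← geom_mul _ _ g] at h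
      rw [← geom_mul] at h1
      rw [List.mem_map]
      refine ⟨_, ih h1 h, ?_⟩
      simp only [MulAut.conj_apply, mul_inv_rev, inv_simple]
      simp [mul_assoc]

theorem exists_eraseIdx {ω : List B} {s : B} (h : cs.IsLeftDescent (cs.wordProd ω) s) :
    ∃ j < ω.length, cs.simple s * cs.wordProd ω = cs.wordProd (ω.eraseIdx j) := by
  rw [isLeftDescent_iff_geom] at h
  have := conj_mem_leftInvSeq cs (g := 1) (j := s) (ω := ω) (by simpa using root_nonneg s)
    (by simpa using h)
  simp only [one_mul, inv_one, mul_one] at this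
  obtain ⟨j, hj, e⟩ := List.getElem_of_mem this
  rw [length_leftInvSeq] at hj
  refine ⟨j, hj, ?_⟩
  rw [← cs.getD_leftInvSeq_mul_wordProd, ← e, List.getD_eq_getElem]

end Roots

/-! ### Parabolic subgroups and longest elements -/

section Parabolic

variable {B : Type*} {M : CoxeterMatrix B} {W : Type*} [Group W] (cs : CoxeterSystem M W)

/-- The element `v` acts trivially on the coordinates outside `c`, as the elements of the parabolic
subgroup generated by `c` do. -/
def IsSupportedIn (c : List B) (v : W) : Prop := ∀ i, i ∉ c → ∀ x, geom cs v x i = x i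

theorem isSupportedIn_wordProd {c ω : List B} (h : ∀ i ∈ ω, i ∈ c) :
    IsSupportedIn cs c (cs.wordProd ω) := by
  intro i hi x
  induction ω with
  | nil => simp
  | cons b ω ih =>
    rw [wordProd_cons, geom_mul, geom_simple_apply_ne cs, ih fun j hj => h j (by simp [hj])]
    rintro rfl
    exact hi (h _ (by simp))

variable {cs}

theorem IsSupportedIn.inv {c : List B} {v : W} (h : IsSupportedIn cs c v) :
    IsSupportedIn cs c v⁻¹ := by
  intro i hi x
  rw [← h i hi (geom cs v⁻¹ x), geom_geom_inv]

/-- `x` lies in the span of the simple roots in `c`. -/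
def VecSupportedIn (c : List B) (x : B →₀ ℝ) : Prop := ∀ i, i ∉ c → x i = 0

theorem IsSupportedIn.vec_iff {c : List B} {v : W} (h : IsSupportedIn cs c v) {x : B →₀ ℝ} :
    VecSupportedIn c (geom cs v x) ↔ VecSupportedIn c x := by
  unfold VecSupportedIn
  exact forall₂_congr fun i hi => by rw [h i hi]

theorem vecSupportedIn_root {c : List B} {i : B} (h : i ∈ c) : VecSupportedIn c (root i) := by
  intro j hj
  exact root_apply_ne (by rintro rfl; exact hj h)

theorem IsSupportedIn.vec_of_mem {c : List B} {v : W} (h : IsSupportedIn cs c v) {β : B →₀ ℝ}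
    (hβ : β ∈ inversionRoots cs v) : VecSupportedIn c β := by
  intro i hi
  have h1 := hβ.2 i
  rw [h.inv i hi] at h1
  exact le_antisymm h1 (hβ.1.2 i)

theorem IsSupportedIn.mem_of_isRightDescent {c : List B} {v : W} (h : IsSupportedIn cs c v) {i : B}
    (hi : cs.IsRightDescent v i) : i ∈ c := by
  by_contra hc
  have h1 := (isRightDescent_iff_geom cs).1 hi i
  rw [h i hc, root_apply_self] at h1
  norm_num at h1

variable (cs)

theorem exists_isReduced_subset (ω : List B) : ∃ ω', cs.IsReduced ω' ∧
    cs.wordProd ω' = cs.wordProd ω ∧ ∀ i ∈ ω', i ∈ ω := by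
  induction ω with
  | nil => exact ⟨[], by simp [CoxeterSystem.IsReduced], rfl, by simp⟩
  | cons b ω ih =>
    obtain ⟨ω', h1, h2, h3⟩ := ih
    by_cases hb : cs.IsLeftDescent (cs.wordProd ω') b
    · obtain ⟨j, hj, e⟩ := exists_eraseIdx cs hb
      refine ⟨ω'.eraseIdx j, ?_, ?_, fun i hi => ?_⟩
      · have h4 := cs.isLeftDescent_iff.1 hb
        rw [h1.eq, e] at h4
        rw [CoxeterSystem.IsReduced, List.length_eraseIdx_of_lt hj]
        omega
      · rw [← e, wordProd_cons, h2]
      · exact List.mem_cons_of_mem _ (h3 i (List.mem_of_mem_eraseIdx hi))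
    · refine ⟨b :: ω', (isReduced_cons cs).2 ⟨h1, hb⟩, by rw [wordProd_cons, wordProd_cons, h2], ?_⟩
      intro i hi
      rw [List.mem_cons] at hi ⊢
      exact hi.imp_right (h3 i)

theorem wordProd_mem_parabolic {J : Set B} {ω : List B} (h : ∀ i ∈ ω, i ∈ J) :
    cs.wordProd ω ∈ cs.parabolic J := by
  induction ω with
  | nil => exact one_mem _
  | cons b ω ih =>
    rw [wordProd_cons]
    exact mul_mem (Subgroup.subset_closure ⟨b, h b (by simp), rfl⟩)
      (ih fun i hi => h i (by simp [hi]))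

theorem exists_isReduced_of_mem_parabolic {J : Set B} {v : W} (h : v ∈ cs.parabolic J) :
    ∃ ω, cs.IsReduced ω ∧ cs.wordProd ω = v ∧ ∀ i ∈ ω, i ∈ J := by
  have : ∃ ω, cs.wordProd ω = v ∧ ∀ i ∈ ω, i ∈ J := by
    induction h using Subgroup.closure_induction with
    | mem x hx =>
      obtain ⟨i, hi, rfl⟩ := hx
      exact ⟨[i], by simp, by simpa using hi⟩
    | one => exact ⟨[], by simp, by simp⟩
    | mul x y _ _ hx hy =>
      obtain ⟨ω, rfl, h1⟩ := hx
      obtain ⟨ω', rfl, h2⟩ := hy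
      exact ⟨ω ++ ω', wordProd_append _ _ _, fun i hi => (List.mem_append.1 hi).elim (h1 i) (h2 i)⟩
    | inv x _ hx =>
      obtain ⟨ω, rfl, h1⟩ := hx
      exact ⟨ω.reverse, wordProd_reverse _ _, fun i hi => h1 i (List.mem_reverse.1 hi)⟩
  obtain ⟨ω, rfl, h1⟩ := this
  obtain ⟨ω', h2, h3, h4⟩ := exists_isReduced_subset cs ω
  exact ⟨ω', h2, h3, fun i hi => h1 i (h4 i hi)⟩

theorem isSupportedIn_of_mem_parabolic {c : List B} {v : W} (h : v ∈ cs.parabolic {i | i ∈ c}) :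
    IsSupportedIn cs c v := by
  obtain ⟨ω, -, rfl, h1⟩ := exists_isReduced_of_mem_parabolic cs h
  exact isSupportedIn_wordProd cs h1

variable [Finite W]

theorem longest_mem (J : Set B) : cs.longest J ∈ cs.parabolic J :=
  (Classical.choose_spec (cs.exists_longest J)).1

theorem length_le_longest {J : Set B} {u : W} (h : u ∈ cs.parabolic J) :
    cs.length u ≤ cs.length (cs.longest J) :=
  (Classical.choose_spec (cs.exists_longest J)).2 u h

theorem isLeftDescent_longest {J : Set B} {i : B} (hi : i ∈ J) :
    cs.IsLeftDescent (cs.longest J) i := by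
  have h := length_le_longest cs (mul_mem (Subgroup.subset_closure ⟨i, hi, rfl⟩) (longest_mem cs J))
  have := cs.length_simple_mul_ne (cs.longest J) i
  exact lt_of_le_of_ne h this

theorem geom_longest_inv_nonpos {c : List B} {τ : B →₀ ℝ} (h : 0 ≤ τ) (hc : VecSupportedIn c τ) :
    geom cs (cs.longest {i | i ∈ c})⁻¹ τ ≤ 0 := by
  have := map_nonneg_of_forall_root (-(geom cs (cs.longest {i | i ∈ c})⁻¹).toLinearMap) h ?_
  · simpa using this
  · intro i hi
    have hic : i ∈ c := by
      by_contra h'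
      exact hi (hc i h')
    simpa using (isLeftDescent_iff_geom cs).1 (isLeftDescent_longest cs (J := {i | i ∈ c}) hic)

theorem eq_longest_of_forall_isRightDescent {x : W} (h : ∀ i, cs.IsRightDescent x i) :
    x = cs.longest Set.univ := by
  have : (cs.longest Set.univ)⁻¹ * x = 1 := by
    by_contra hne
    obtain ⟨i, hi⟩ := cs.exists_rightDescent_of_ne_one hne
    refine absurd hi ((not_isRightDescent_iff_geom cs).2 ?_)
    have h1 : 0 ≤ -geom cs x (root i) := neg_nonneg.2 ((isRightDescent_iff_geom cs).1 (h i))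
    have := map_nonneg_of_forall_root (-(geom cs (cs.longest Set.univ)⁻¹).toLinearMap) h1
      fun j _ => by
        simpa using (isLeftDescent_iff_geom cs).1 (isLeftDescent_longest cs (Set.mem_univ j))
    rw [geom_mul]
    simpa using this
  rw [inv_mul_eq_one] at this
  exact this.symm

theorem weakLE_longest (u : W) : WeakLE cs u (cs.longest Set.univ) := by
  obtain ⟨x, hx, hmax⟩ := Set.exists_max_image {x | WeakLE cs u x} cs.length (Set.toFinite _)
    ⟨u, weakLE_refl cs u⟩
  rw [← eq_longest_of_forall_isRightDescent cs (x := x)]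
  · exact hx
  · intro i
    by_contra hi
    have h1 := hmax (x * cs.simple i) (WeakLE.trans hx (weakLE_mul_simple cs hi))
    rw [cs.not_isRightDescent_iff.1 hi] at h1
    omega

end Parabolic

/-! ### Letters, divisors and Garside factors in the Artin monoid -/

section Letters

variable {B : Type*} {M : CoxeterMatrix B}

theorem mem_alternatingWord_add_two {i j k : B} {m : ℕ} :
    k ∈ alternatingWord i j (m + 2) ↔ k = i ∨ k = j := by
  induction m generalizing i j with
  | zero => simp [alternatingWord]
  | succ m ih =>
    simp only [alternatingWord_succ _ _ (m + 2), List.concat_eq_append, List.mem_append, ih,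
      List.mem_singleton]
    tauto

theorem mem_braidWord_comm (i j k : B) : k ∈ braidWord M i j ↔ k ∈ braidWord M j i := by
  rcases eq_or_ne i j with rfl | hij
  · rfl
  rw [braidWord, braidWord, M.symmetric j i]
  rcases hm : M i j with _ | _ | m
  · simp [alternatingWord]
  · exact absurd hm (M.off_diagonal i j hij)
  · rw [mem_alternatingWord_add_two, mem_alternatingWord_add_two, or_comm]

open Classical in
theorem prod_map_ite_eq (i : B) (ω : List B) :
    (ω.map fun j => if j = i then 0 else 1).prod = if i ∈ ω then (0 : ℕ) else 1 := by
  induction ω with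
  | nil => simp
  | cons j ω ih =>
    rcases eq_or_ne j i with rfl | h
    · simp
    · simp [h, h.symm, ih]

theorem mem_iff_of_artinProd_eq {ω ω' : List B} (h : M.artinProd ω = M.artinProd ω') (i : B) :
    i ∈ ω ↔ i ∈ ω' := by
  classical
  have h' := congrArg (artinLift M (fun j => if j = i then (0 : ℕ) else 1) fun a b => by
    simp only [prod_map_ite_eq, mem_braidWord_comm a b]) h
  simp only [artinLift_artinProd, prod_map_ite_eq] at h'
  split_ifs at h' <;> simp_all

/-- The generator `i` does not occur in the words for `b`. -/
def Avoids (i : B) (b : M.ArtinMonoid) : Prop := ∃ ω, M.artinProd ω = b ∧ i ∉ ω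

theorem avoids_artinProd {i : B} {ω : List B} : Avoids i (M.artinProd ω) ↔ i ∉ ω := by
  refine ⟨?_, fun h => ⟨ω, rfl, h⟩⟩
  rintro ⟨ω', h, hi⟩
  rwa [← mem_iff_of_artinProd_eq h]

theorem avoids_mul {i : B} {a b : M.ArtinMonoid} :
    Avoids i (a * b) ↔ Avoids i a ∧ Avoids i b := by
  obtain ⟨ω, rfl⟩ := artinProd_surjective M a
  obtain ⟨ω', rfl⟩ := artinProd_surjective M b
  rw [← artinProd_append, avoids_artinProd, avoids_artinProd, avoids_artinProd, List.mem_append,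
    not_or]

theorem avoids_of {i j : B} : Avoids i (PresentedMonoid.of M.BraidRel j) ↔ i ≠ j := by
  rw [← mul_one (PresentedMonoid.of M.BraidRel j), ← artinProd_nil, ← artinProd_cons,
    avoids_artinProd, List.mem_singleton]

theorem of_mul_ne_one {i : B} {b : M.ArtinMonoid} : PresentedMonoid.of M.BraidRel i * b ≠ 1 := by
  obtain ⟨ω, rfl⟩ := artinProd_surjective M b
  rw [← artinProd_cons, ← artinProd_nil]
  exact fun h => by simpa using length_eq_of_artinProd_eq M h

theorem prod_map_op_of (M : CoxeterMatrix B) (ω : List B) :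
    (ω.map fun i => MulOpposite.op (PresentedMonoid.of M.BraidRel i)).prod =
      MulOpposite.op (M.artinProd ω.reverse) := by
  induction ω with
  | nil => simp [artinProd_nil]
  | cons i ω ih =>
    rw [List.map_cons, List.prod_cons, ih, List.reverse_cons, artinProd_append, artinProd_cons,
      artinProd_nil, mul_one, MulOpposite.op_mul]

theorem artinProd_reverse_braidWord (M : CoxeterMatrix B) (i j : B) :
    M.artinProd (braidWord M i j).reverse = M.artinProd (braidWord M j i).reverse := by
  have h := artinProd_braidWord M i j
  rw [braidWord, braidWord, M.symmetric j i] at h ⊢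
  rw [reverse_alternatingWord, reverse_alternatingWord]
  split_ifs
  exacts [h.symm, h]

variable (M)

/-- Reversal of words, as a homomorphism to the opposite monoid. -/
def artinRev : M.ArtinMonoid →* M.ArtinMonoidᵐᵒᵖ :=
  artinLift M (fun i => MulOpposite.op (PresentedMonoid.of M.BraidRel i)) fun i j => by
    rw [prod_map_op_of, prod_map_op_of, artinProd_reverse_braidWord]

theorem artinRev_artinProd (ω : List B) :
    artinRev M (M.artinProd ω) = MulOpposite.op (M.artinProd ω.reverse) := by
  rw [artinRev, artinLift_artinProd, prod_map_op_of]

theorem artinRev_artinRev (b : M.ArtinMonoid) : (artinRev M (artinRev M b).unop).unop = b := by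
  obtain ⟨ω, rfl⟩ := artinProd_surjective M b
  simp [artinRev_artinProd]

end Letters

section GarsideFactors

variable {B : Type*} {M : CoxeterMatrix B} {W : Type*} [Group W] (cs : CoxeterSystem M W)

theorem artinRev_toArtin (u : W) :
    artinRev M (cs.toArtin u) = MulOpposite.op (cs.toArtin u⁻¹) := by
  obtain ⟨ω, h1, rfl⟩ := cs.exists_isReduced u
  rw [toArtin_wordProd cs h1, artinRev_artinProd, ← wordProd_reverse,
    toArtin_wordProd cs h1.reverse]

theorem head_one : head cs (1 : M.ArtinMonoid) = 1 := by rw [head, map_one, one_smul]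

theorem rest_one : rest cs (1 : M.ArtinMonoid) = 1 := by rw [rest, map_one, one_smul]

theorem head_toArtin (u : W) : head cs (cs.toArtin u) = u := by
  have := head_toArtin_mul cs u 1
  rw [mul_one, head_one] at this
  have h1 := (maxPrefix_weakLE cs u 1).length_le
  rw [length_one, Nat.le_zero, length_eq_zero_iff] at h1
  rw [this, h1, mul_one]

theorem rest_toArtin (u : W) : rest cs (cs.toArtin u) = 1 := by
  have := toArtin_head_mul_rest cs (cs.toArtin u)
  rw [head_toArtin] at this
  exact toArtin_mul_left_cancel cs (by rw [this, mul_one])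

theorem of_dvd_toArtin {i : B} {u : W} :
    PresentedMonoid.of M.BraidRel i ∣ cs.toArtin u ↔ cs.IsLeftDescent u i := by
  rw [of_dvd_iff cs, head_toArtin]

/-- `b` is a product of `k` simple elements. -/
def IsSimpleProd (k : ℕ) (b : M.ArtinMonoid) : Prop :=
  ∃ l : List W, l.length = k ∧ b = (l.map cs.toArtin).prod

theorem isSimpleProd_zero {b : M.ArtinMonoid} : IsSimpleProd cs 0 b ↔ b = 1 := by
  simp [IsSimpleProd]

variable {cs}

theorem IsSimpleProd.toArtin_mul {k : ℕ} {b : M.ArtinMonoid} (h : IsSimpleProd cs k b) (u : W) :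
    IsSimpleProd cs (k + 1) (cs.toArtin u * b) := by
  obtain ⟨l, rfl, rfl⟩ := h
  exact ⟨u :: l, rfl, by simp⟩

theorem IsSimpleProd.rest {k : ℕ} {b : M.ArtinMonoid} (h : IsSimpleProd cs (k + 1) b) :
    IsSimpleProd cs k (rest cs b) := by
  induction k generalizing b with
  | zero =>
    obtain ⟨l, hl, rfl⟩ := h
    obtain ⟨u, rfl⟩ := List.length_eq_one_iff.1 hl
    refine ⟨[], rfl, ?_⟩
    simp [rest_toArtin]
  | succ k ih =>
    obtain ⟨l, hl, rfl⟩ := h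
    obtain _ | ⟨u, l⟩ := l
    · simp at hl
    rw [List.map_cons, List.prod_cons, rest_toArtin_mul]
    exact (ih ⟨l, by simpa using hl, rfl⟩).toArtin_mul _

theorem IsSimpleProd.of_right {k : ℕ} {a b : M.ArtinMonoid} (h : IsSimpleProd cs k (a * b)) :
    IsSimpleProd cs k b := by
  induction a using artin_induction with
  | one => rwa [one_mul] at h
  | mul i a ih =>
    apply ih
    rw [mul_assoc] at h
    cases k with
    | zero => exact absurd ((isSimpleProd_zero cs).1 h) of_mul_ne_one
    | succ k =>
      rw [← toArtin_simple cs] at h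
      rw [eq_toArtin_mul_rest cs (cs.simple i) (a * b)]
      exact h.rest.toArtin_mul _

theorem IsSimpleProd.rev {k : ℕ} {b : M.ArtinMonoid} (h : IsSimpleProd cs k b) :
    IsSimpleProd cs k (artinRev M b).unop := by
  obtain ⟨l, hl, rfl⟩ := h
  refine ⟨l.reverse.map (·⁻¹), by simpa using hl, ?_⟩
  clear hl
  induction l with
  | nil => simp
  | cons u l ih =>
    rw [List.map_cons, List.prod_cons, map_mul, MulOpposite.unop_mul, ih, artinRev_toArtin]
    simp

theorem IsSimpleProd.of_dvd {k : ℕ} {a b : M.ArtinMonoid} (h : IsSimpleProd cs k b) (hd : a ∣ b) :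
    IsSimpleProd cs k a := by
  obtain ⟨x, rfl⟩ := hd
  have := h.rev
  rw [map_mul, MulOpposite.unop_mul] at this
  have h2 := this.of_right.rev
  rwa [artinRev_artinRev] at h2

variable (cs)

theorem of_commute {i j : B} (h : M i j = 2) :
    PresentedMonoid.of M.BraidRel i * PresentedMonoid.of M.BraidRel j =
      PresentedMonoid.of M.BraidRel j * PresentedMonoid.of M.BraidRel i := by
  have := artinProd_braidWord M i j
  simp only [braidWord, h, M.symmetric j i, alternatingWord, List.concat_eq_append, List.nil_append,
    List.cons_append, artinProd_cons, artinProd_nil, mul_one] at this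
  exact this

theorem of_dvd_of_mul_iff (cs : CoxeterSystem M W) {i j : B} (h : M i j = 2)
    {b : M.ArtinMonoid} : PresentedMonoid.of M.BraidRel j ∣ PresentedMonoid.of M.BraidRel i * b ↔
      PresentedMonoid.of M.BraidRel j ∣ b := by
  constructor
  · intro hj
    have hij : i ≠ j := by
      rintro rfl
      simp at h
    obtain ⟨v, hv, hl, -⟩ := exists_eq_braidWord_mul cs hij
      ((of_dvd_iff cs).1 (dvd_mul_right (PresentedMonoid.of M.BraidRel i) b)) ((of_dvd_iff cs).1 hj)
    have hp : WeakLE cs (cs.wordProd (braidWord M i j))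
        (head cs (PresentedMonoid.of M.BraidRel i * b)) := by
      rw [hv]; apply weakLE_mul
      rw [← hv, hl, (isReduced_braidWord cs hij).eq, length_alternatingWord]
    rw [← toArtin_dvd_iff, toArtin_wordProd cs (isReduced_braidWord cs hij)] at hp
    simp only [braidWord, h, alternatingWord, List.concat_eq_append, List.nil_append,
      List.cons_append, artinProd_cons, artinProd_nil, mul_one] at hp
    obtain ⟨x, hx⟩ := hp
    rw [mul_assoc] at hx
    exact ⟨x, of_mul_left_cancel cs hx⟩
  · rintro ⟨x, rfl⟩
    rw [← mul_assoc, of_commute h, mul_assoc]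
    exact dvd_mul_right _ _

variable [Finite W]

theorem isSimpleProd_of_mem_mWeak {m : ℕ} {w : M.ArtinMonoid} (hw : w ∈ cs.mWeak m) :
    IsSimpleProd cs m w :=
  IsSimpleProd.of_dvd
    ⟨List.replicate m (cs.longest Set.univ), by simp, by simp [fundamental]⟩ hw

theorem toArtin_dvd_fundamental (u : W) : cs.toArtin u ∣ cs.fundamental := by
  rw [fundamental, toArtin_dvd_iff, head_toArtin]
  exact weakLE_longest cs u

theorem exists_eq_toArtin {d : M.ArtinMonoid} (h : d ∣ cs.fundamental) :
    ∃ u, d = cs.toArtin u := by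
  obtain ⟨x, hx⟩ := h
  obtain ⟨ω, rfl⟩ := artinProd_surjective M d
  obtain ⟨ω', rfl⟩ := artinProd_surjective M x
  rw [← artinProd_append] at hx
  have : ω ++ ω' ∈ cs.reducedWords (cs.longest Set.univ) := by
    rw [← artinWords_toArtin]; exact hx.symm
  have h1 := this.1.take ω.length
  rw [List.take_left] at h1
  exact ⟨cs.wordProd ω, (toArtin_wordProd cs h1).symm⟩

theorem isGarsideFactorization_head (w : M.ArtinMonoid) :
    cs.IsGarsideFactorization w fun k => head cs ((rest cs)^[k] w) := by
  refine ⟨fun k => (rest cs)^[k] w, rfl, fun k => ⟨?_, toArtin_dvd_fundamental cs _, ?_⟩⟩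
  · dsimp only
    rw [Function.iterate_succ_apply', toArtin_head_mul_rest]
  · intro d hd hd'
    obtain ⟨u, rfl⟩ := exists_eq_toArtin cs hd'
    rw [toArtin_dvd_iff] at hd
    rwa [toArtin_dvd_iff, head_toArtin]

theorem eq_head_of_isGarsideFactorization {w : M.ArtinMonoid} {v : ℕ → W}
    (h : cs.IsGarsideFactorization w v) (k : ℕ) : v k = head cs ((rest cs)^[k] w) := by
  obtain ⟨r, rfl, hr⟩ := h
  have key : ∀ k, v k = head cs (r k) := by
    intro k
    have h1 := (hr k).2.2 (cs.toArtin (head cs (r k)))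
      ((toArtin_dvd_iff cs).2 (weakLE_refl cs _)) (toArtin_dvd_fundamental cs _)
    have h2 : cs.toArtin (v k) ∣ r k := ⟨_, (hr k).1⟩
    rw [toArtin_dvd_iff] at h1 h2
    rw [head_toArtin] at h1
    exact h2.antisymm h1
  have hrk : ∀ k, r k = (rest cs)^[k] (r 0) := by
    intro k
    induction k with
    | zero => rfl
    | succ k ih =>
      rw [Function.iterate_succ_apply', ← ih]
      apply toArtin_mul_left_cancel cs (u := v k)
      rw [← (hr k).1, key, toArtin_head_mul_rest]
  rw [key, hrk]

end GarsideFactors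

/-! ### The skew-symmetric form of a Coxeter element -/

section SkewForm

variable {B : Type*} (M : CoxeterMatrix B)

/-- The part of the linear form `form M (root s)` that comes from the letters of `c`. -/
def partialForm : List B → B → (B →₀ ℝ) →ₗ[ℝ] ℝ
  | [], _ => 0
  | i :: c, s => gram M s i • Finsupp.lapply i + partialForm c s

/-- The skew-symmetric form of Reading and Speyer attached to the word `c` of a Coxeter element.
For two letters `s ≠ t` of `c`, its value at `(root s, root t)` is `-gram M s t` if `s` precedes
`t` in `c`, and `gram M s t` otherwise. -/
def skewForm : List B → (B →₀ ℝ) →ₗ[ℝ] (B →₀ ℝ) →ₗ[ℝ] ℝ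
  | [] => 0
  | s :: c => skewForm c + (partialForm M c s).smulRight (Finsupp.lapply s) -
      (Finsupp.lapply s : (B →₀ ℝ) →ₗ[ℝ] ℝ).smulRight (partialForm M c s)

theorem partialForm_cons (i : B) (c : List B) (s : B) (x : B →₀ ℝ) :
    partialForm M (i :: c) s x = gram M s i * x i + partialForm M c s x := by
  simp [partialForm]

theorem partialForm_nil (s : B) (x : B →₀ ℝ) : partialForm M [] s x = 0 := by simp [partialForm]

theorem skewForm_nil (x y : B →₀ ℝ) : skewForm M [] x y = 0 := by simp [skewForm]

theorem skewForm_cons (s : B) (c : List B) (x y : B →₀ ℝ) :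
    skewForm M (s :: c) x y =
      skewForm M c x y + partialForm M c s x * y s - x s * partialForm M c s y := by
  simp [skewForm]

theorem partialForm_append_singleton (c : List B) (i s : B) (x : B →₀ ℝ) :
    partialForm M (c ++ [i]) s x = partialForm M c s x + gram M s i * x i := by
  induction c with
  | nil => simp [partialForm_cons, partialForm_nil]
  | cons a c ih => rw [List.cons_append, partialForm_cons, ih, partialForm_cons]; ring

theorem skewForm_append_singleton (c : List B) (s : B) (x y : B →₀ ℝ) :
    skewForm M (c ++ [s]) x y =
      skewForm M c x y - partialForm M c s x * y s + x s * partialForm M c s y := by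
  induction c with
  | nil => simp [skewForm_cons, skewForm_nil, partialForm_nil]
  | cons a c ih =>
    rw [List.cons_append, skewForm_cons, ih, skewForm_cons, partialForm_append_singleton,
      partialForm_append_singleton,
      partialForm_cons, partialForm_cons, gram_comm M s a]
    ring

theorem skewForm_neg_symm (c : List B) (x y : B →₀ ℝ) : skewForm M c x y = -skewForm M c y x := by
  induction c with
  | nil => simp [skewForm_nil]
  | cons s c ih => rw [skewForm_cons, ih, skewForm_cons]; ring

theorem skewForm_self (c : List B) (x : B →₀ ℝ) : skewForm M c x x = 0 := by
  have := skewForm_neg_symm M c x x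
  linarith

variable {M}

theorem partialForm_congr {c : List B} {s : B} {x x' : B →₀ ℝ} (h : ∀ i ∈ c, x i = x' i) :
    partialForm M c s x = partialForm M c s x' := by
  induction c with
  | nil => simp [partialForm_nil]
  | cons a c ih =>
    rw [partialForm_cons, partialForm_cons, h a (by simp), ih fun i hi => h i (by simp [hi])]

theorem skewForm_congr {c : List B} {x x' y y' : B →₀ ℝ} (h : ∀ i ∈ c, x i = x' i)
    (h' : ∀ i ∈ c, y i = y' i) : skewForm M c x y = skewForm M c x' y' := by
  induction c with
  | nil => simp [skewForm_nil]
  | cons a c ih =>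
    have h1 : ∀ i ∈ c, x i = x' i := fun i hi => h i (by simp [hi])
    have h2 : ∀ i ∈ c, y i = y' i := fun i hi => h' i (by simp [hi])
    rw [skewForm_cons, skewForm_cons, ih h1 h2, partialForm_congr h1, partialForm_congr h2,
      h a (by simp), h' a (by simp)]

theorem partialForm_eq_zero {c : List B} {s : B} {x : B →₀ ℝ} (h : ∀ i ∈ c, x i = 0) :
    partialForm M c s x = 0 := by
  rw [partialForm_congr (x' := 0) (by simpa using h), map_zero]

theorem partialForm_nonpos {c : List B} {s : B} (hs : s ∉ c) {x : B →₀ ℝ} (h : ∀ i ∈ c, 0 ≤ x i) :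
    partialForm M c s x ≤ 0 := by
  induction c with
  | nil => simp [partialForm_nil]
  | cons a c ih =>
    rw [partialForm_cons]
    have h1 := ih (fun h => hs (by simp [h])) fun i hi => h i (by simp [hi])
    have h2 := mul_nonpos_of_nonpos_of_nonneg (gram_nonpos M (i := s) (j := a)
      (by rintro rfl; exact hs (by simp))) (h a (by simp))
    linarith

theorem form_root_eq_partialForm {c : List B} (hc : c.Nodup) {x : B →₀ ℝ} (hx : VecSupportedIn c x)
    (s : B) : form M (root s) x = partialForm M c s x := by
  induction c generalizing x with
  | nil =>
    have : x = 0 := by ext i; exact hx i (by simp)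
    simp [this]
  | cons a c ih =>
    rw [List.nodup_cons] at hc
    have h1 : VecSupportedIn c (x - x a • root a) := by
      intro i hi
      by_cases hia : i = a
      · subst hia; simp [root_apply_self]
      · simp [root_apply_ne (Ne.symm hia), hx i (by simp [hia, hi])]
    have := ih hc.2 h1
    have h2 : partialForm M c s (x - x a • root a) = partialForm M c s x := by
      refine partialForm_congr fun i hi => ?_
      have : a ≠ i := by rintro rfl; exact hc.1 hi
      simp [root_apply_ne this]
    rw [h2, map_sub, map_smul, form_root_root, smul_eq_mul] at this
    rw [partialForm_cons, ← this]; ring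

theorem form_root_eq {s : B} {c : List B} (hc : (s :: c).Nodup) {x : B →₀ ℝ}
    (hx : VecSupportedIn (s :: c) x) : form M (root s) x = 2 * x s + partialForm M c s x := by
  rw [form_root_eq_partialForm hc hx, partialForm_cons, gram_self]

theorem skewForm_root_left {s : B} {c : List B} (hs : s ∉ c) (x : B →₀ ℝ) :
    skewForm M (s :: c) (root s) x = -partialForm M c s x := by
  have h0 : ∀ i ∈ c, (root s : B →₀ ℝ) i = 0 := fun i hi =>
    root_apply_ne (by rintro rfl; exact hs hi)
  rw [skewForm_cons, partialForm_eq_zero h0, root_apply_self,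
    skewForm_congr (x' := 0) (y' := x) (by simpa using h0) fun _ _ => rfl]
  simp

theorem skewForm_root_right {s : B} {c : List B} (hs : s ∉ c) (x : B →₀ ℝ) :
    skewForm M (c ++ [s]) x (root s) = -partialForm M c s x := by
  have h0 : ∀ i ∈ c, (root s : B →₀ ℝ) i = 0 := fun i hi =>
    root_apply_ne (by rintro rfl; exact hs hi)
  rw [skewForm_append_singleton, partialForm_eq_zero h0, root_apply_self,
    skewForm_congr (x' := x) (y' := 0) (fun _ _ => rfl) (by simpa using h0)]
  simp

theorem skewForm_cons_of_supported {s : B} {c : List B} (hs : s ∉ c) {x y : B →₀ ℝ}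
    (hx : VecSupportedIn c x) (hy : VecSupportedIn c y) :
    skewForm M (s :: c) x y = skewForm M c x y := by
  rw [skewForm_cons, hx s hs, hy s hs]; ring

theorem skewForm_append_of_supported {s : B} {c : List B} {x y : B →₀ ℝ}
    (hx : x s = 0) (hy : y s = 0) : skewForm M (c ++ [s]) x y = skewForm M (s :: c) x y := by
  rw [skewForm_append_singleton, skewForm_cons, hx, hy]; ring

variable {W : Type*} [Group W]

theorem skewForm_rotate (cs : CoxeterSystem M W) {s : B} {c : List B} (hc : (s :: c).Nodup)
    {x y : B →₀ ℝ} (hx : VecSupportedIn (s :: c) x) (hy : VecSupportedIn (s :: c) y) :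
    skewForm M (c ++ [s]) (geom cs (cs.simple s) x) (geom cs (cs.simple s) y) =
      skewForm M (s :: c) x y := by
  have hs := (List.nodup_cons.1 hc).1
  have e : ∀ z : B →₀ ℝ, ∀ i ∈ c, geom cs (cs.simple s) z i = z i := fun z i hi =>
    geom_simple_apply_ne cs (by rintro rfl; exact hs hi) z
  rw [skewForm_append_singleton, skewForm_cons, skewForm_congr (e x) (e y),
    partialForm_congr (e x), partialForm_congr (e y)]
  simp only [geom_simple, Finsupp.coe_sub, Finsupp.coe_smul, Pi.sub_apply, Pi.smul_apply,
    root_apply_self, smul_eq_mul, form_root_eq hc hx, form_root_eq hc hy]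
  ring

theorem VecSupportedIn.cons {s : B} {c : List B} {x : B →₀ ℝ} (h : VecSupportedIn c x) :
    VecSupportedIn (s :: c) x := fun i hi => h i fun h => hi (by simp [h])

theorem vecSupportedIn_rotate {s : B} {c : List B} {x : B →₀ ℝ} :
    VecSupportedIn (c ++ [s]) x ↔ VecSupportedIn (s :: c) x := by
  unfold VecSupportedIn
  refine forall_congr' fun i => ?_
  simp [or_comm]

variable {cs : CoxeterSystem M W}

theorem vecSupportedIn_geom_simple {s : B} {c : List B} {x : B →₀ ℝ} :
    VecSupportedIn (s :: c) (geom cs (cs.simple s) x) ↔ VecSupportedIn (s :: c) x := by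
  have : IsSupportedIn cs (s :: c) (cs.simple s) := by
    have := isSupportedIn_wordProd cs (c := s :: c) (ω := [s]) (by simp)
    simpa using this
  exact this.vec_iff

theorem IsPosRoot.skewForm_root_left_nonneg {s : B} {c : List B} (hs : s ∉ c) {x : B →₀ ℝ}
    (hx : IsPosRoot cs x) : 0 ≤ skewForm M (s :: c) (root s) x := by
  rw [skewForm_root_left hs]
  have := partialForm_nonpos (M := M) hs fun i _ => hx.2 i
  linarith

theorem IsPosRoot.skewForm_root_right_nonneg {s : B} {c : List B} (hs : s ∉ c) {x : B →₀ ℝ}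
    (hx : IsPosRoot cs x) : 0 ≤ skewForm M (c ++ [s]) x (root s) := by
  rw [skewForm_root_right hs]
  have := partialForm_nonpos (M := M) hs fun i _ => hx.2 i
  linarith

theorem IsPosRoot.apply_eq_zero_of_partialForm_eq_zero {s : B} {c : List B}
    (hc : (s :: c).Nodup) {x : B →₀ ℝ} (hx : IsPosRoot cs x) (hne : x ≠ root s)
    (hsupp : VecSupportedIn (s :: c) x) (h : partialForm M c s x = 0) :
    x s = 0 ∧ form M (root s) x = 0 := by
  have h1 := (hx.geom_simple hne).2 s
  rw [CoxeterSortable.geom_simple, form_root_eq hc hsupp, h] at h1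
  simp only [Finsupp.coe_zero, Pi.zero_apply, Finsupp.coe_sub, Finsupp.coe_smul, Pi.sub_apply,
    Pi.smul_apply, root_apply_self, smul_eq_mul] at h1
  have h2 : 0 ≤ x s := hx.2 s
  have h3 : x s = 0 := by linarith
  exact ⟨h3, by rw [form_root_eq hc hsupp, h, h3]; ring⟩

theorem IsPosRoot.skewForm_root_left_pos {s : B} {c : List B} (hc : (s :: c).Nodup) {x : B →₀ ℝ}
    (hx : IsPosRoot cs x) (hne : x ≠ root s) (hsupp : VecSupportedIn (s :: c) x) :
    form M (root s) x = 0 ∨ 0 < skewForm M (s :: c) (root s) x := by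
  rcases (hx.skewForm_root_left_nonneg (List.nodup_cons.1 hc).1).eq_or_lt with h | h
  · left
    rw [skewForm_root_left (List.nodup_cons.1 hc).1] at h
    exact (hx.apply_eq_zero_of_partialForm_eq_zero hc hne hsupp (by linarith)).2
  · exact Or.inr h

theorem IsPosRoot.skewForm_root_right_pos {s : B} {c : List B} (hc : (s :: c).Nodup) {x : B →₀ ℝ}
    (hx : IsPosRoot cs x) (hne : x ≠ root s) (hsupp : VecSupportedIn (s :: c) x) :
    form M (root s) x = 0 ∨ 0 < skewForm M (c ++ [s]) x (root s) := by
  have := hx.skewForm_root_left_pos hc hne hsupp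
  have hs := (List.nodup_cons.1 hc).1
  rwa [skewForm_root_left hs, ← skewForm_root_right hs] at this

end SkewForm

/-! ### Sorting words in the Artin monoid -/

section ArtinSorting

variable {B : Type*} (M : CoxeterMatrix B)

/-- `ω` is the `c`-sorting word of `w`, and `w` is `c`-sortable. Here sortability is encoded by
recursion on the initial letter `s` of `c`: if `s` is used, then `s` becomes the last letter of
`c`, and if it is not used, then `s` is dropped for good. -/
inductive IsArtinSorting : List B → M.ArtinMonoid → List B → Prop
  | nil : IsArtinSorting [] 1 []
  | take {s : B} {c : List B} {w : M.ArtinMonoid} {ω : List B} :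
      IsArtinSorting (c ++ [s]) w ω →
      IsArtinSorting (s :: c) (PresentedMonoid.of M.BraidRel s * w) (s :: ω)
  | skip {s : B} {c : List B} {w : M.ArtinMonoid} {ω : List B} :
      ¬ PresentedMonoid.of M.BraidRel s ∣ w →
      IsArtinSorting c w ω → IsArtinSorting (s :: c) w ω

/-- Sortability in the recursive form of `IsArtinSorting`. -/
def IsArtinSortable (c : List B) (w : M.ArtinMonoid) : Prop := ∃ ω, IsArtinSorting M c w ω

variable {M}

theorem nodup_rotate {s : B} {c : List B} (hc : (s :: c).Nodup) : (c ++ [s]).Nodup := by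
  simpa using (List.perm_append_singleton s c).nodup_iff.2 hc

theorem mem_rotate {s i : B} {c : List B} : i ∈ c ++ [s] ↔ i ∈ s :: c :=
  (List.perm_append_singleton s c).mem_iff

theorem not_avoids_of_dvd {i : B} {w : M.ArtinMonoid}
    (h : PresentedMonoid.of M.BraidRel i ∣ w) : ¬ Avoids i w := by
  obtain ⟨w', rfl⟩ := h
  rw [avoids_mul, avoids_of]
  simp

theorem IsArtinSorting.artinProd_eq {c ω : List B} {w : M.ArtinMonoid}
    (h : IsArtinSorting M c w ω) : M.artinProd ω = w := by
  induction h with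
  | nil => exact artinProd_nil M
  | take _ ih => rw [artinProd_cons, ih]
  | skip _ _ ih => exact ih

theorem IsArtinSorting.subset {c ω : List B} {w : M.ArtinMonoid} (h : IsArtinSorting M c w ω) :
    ∀ i ∈ ω, i ∈ c := by
  induction h with
  | nil => simp
  | take h ih =>
    intro i hi
    rcases List.mem_cons.1 hi with rfl | hi
    · simp
    · have := ih i hi
      simp only [List.mem_append, List.mem_singleton] at this
      simp only [List.mem_cons]; tauto
  | skip _ _ ih => exact fun i hi => List.mem_cons_of_mem _ (ih i hi)

theorem IsArtinSortable.avoids {c : List B} {w : M.ArtinMonoid}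
    (h : IsArtinSortable M c w) {i : B} (hi : i ∉ c) : Avoids i w := by
  obtain ⟨ω, h⟩ := h
  rw [← h.artinProd_eq, avoids_artinProd]
  exact fun h' => hi (h.subset i h')

theorem isArtinSortable_nil {w : M.ArtinMonoid} : IsArtinSortable M [] w ↔ w = 1 := by
  constructor
  · rintro ⟨ω, h⟩
    cases h
    rfl
  · rintro rfl
    exact ⟨[], .nil⟩

theorem isArtinSorting_one (c : List B) : IsArtinSorting M c 1 [] := by
  induction c with
  | nil => exact .nil
  | cons s c ih => exact .skip (fun ⟨_, h⟩ => of_mul_ne_one h.symm) ih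

theorem IsArtinSorting.cons {s : B} {c ω : List B} {w : M.ArtinMonoid}
    (h : IsArtinSorting M c w ω) (hs : s ∉ c) : IsArtinSorting M (s :: c) w ω :=
  .skip (fun hd => not_avoids_of_dvd hd (IsArtinSortable.avoids ⟨ω, h⟩ hs)) h

theorem IsArtinSorting.insert {s : B} {x y ω : List B} {w : M.ArtinMonoid}
    (h : IsArtinSorting M (x ++ y) w ω) (hs : s ∉ x ++ y) : IsArtinSorting M (x ++ s :: y) w ω := by
  generalize hc : x ++ y = c at h hs
  induction h generalizing x y with
  | nil =>
    obtain ⟨rfl, rfl⟩ := List.append_eq_nil_iff.1 hc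
    exact isArtinSorting_one _
  | @take a c w ω h ih =>
    obtain _ | ⟨b, x⟩ := x
    · obtain rfl : y = a :: c := hc
      exact (IsArtinSorting.take h).cons hs
    · obtain ⟨rfl, rfl⟩ := List.cons.inj hc
      exact .take (by simpa using ih (x := x) (y := y ++ [b]) (by simp) (mt mem_rotate.1 hs))
  | @skip a c w ω ha h ih =>
    obtain _ | ⟨b, x⟩ := x
    · obtain rfl : y = a :: c := hc
      exact (IsArtinSorting.skip ha h).cons hs
    · obtain ⟨rfl, rfl⟩ := List.cons.inj hc
      exact .skip ha (ih rfl fun h => hs (List.mem_cons_of_mem _ h))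

theorem IsArtinSorting.remove {s : B} {x y ω : List B} {w : M.ArtinMonoid}
    (h : IsArtinSorting M (x ++ s :: y) w ω) (hs : s ∉ ω) : IsArtinSorting M (x ++ y) w ω := by
  generalize hc : x ++ s :: y = c at h
  induction h generalizing x y with
  | nil => simp at hc
  | take h ih =>
    obtain _ | ⟨b, x⟩ := x
    · obtain ⟨rfl, rfl⟩ := List.cons.inj hc
      simp at hs
    · obtain ⟨rfl, rfl⟩ := List.cons.inj hc
      have := ih (x := x) (y := y ++ [b]) (fun h => hs (List.mem_cons_of_mem _ h)) (by simp)
      exact .take (by simpa using this)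
  | skip ha h ih =>
    obtain _ | ⟨b, x⟩ := x
    · obtain ⟨rfl, rfl⟩ := List.cons.inj hc
      exact h
    · obtain ⟨rfl, rfl⟩ := List.cons.inj hc
      exact .skip ha (ih hs rfl)

variable {W : Type*} [Group W]

theorem isArtinSortable_cons {s : B} {c : List B} {w : M.ArtinMonoid}
    (h : ¬ PresentedMonoid.of M.BraidRel s ∣ w) :
    IsArtinSortable M (s :: c) w ↔ IsArtinSortable M c w := by
  constructor
  · rintro ⟨ω, hω⟩
    cases hω with
    | take _ => exact absurd (dvd_mul_right _ _) h
    | skip _ h' => exact ⟨_, h'⟩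
  · rintro ⟨ω, hω⟩
    exact ⟨ω, .skip h hω⟩

theorem isArtinSortable_cons_of_mul (cs : CoxeterSystem M W) {s : B} {c : List B}
    {w : M.ArtinMonoid} :
    IsArtinSortable M (s :: c) (PresentedMonoid.of M.BraidRel s * w) ↔
      IsArtinSortable M (c ++ [s]) w := by
  constructor
  · rintro ⟨ω, hω⟩
    generalize e : PresentedMonoid.of M.BraidRel s * w = w' at hω
    cases hω with
    | take h' =>
      rw [of_mul_left_cancel cs e]
      exact ⟨_, h'⟩
    | skip h _ => exact absurd (e ▸ dvd_mul_right _ _) h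
  · rintro ⟨ω, hω⟩
    exact ⟨_, .take hω⟩

theorem IsArtinSortable.swap (cs : CoxeterSystem M W) {a b : B} (hab : M a b = 2) (n : ℕ)
    {x y ω : List B} {w : M.ArtinMonoid} (hn : ω.length + x.length + y.length ≤ n)
    (h : IsArtinSorting M (x ++ a :: b :: y) w ω) : IsArtinSortable M (x ++ b :: a :: y) w := by
  have hba : M b a = 2 := by rw [M.symmetric, hab]
  induction n generalizing x y w ω with
  | zero =>
    obtain rfl : ω = [] := List.eq_nil_of_length_eq_zero (by omega)
    obtain rfl : x = [] := List.eq_nil_of_length_eq_zero (by omega)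
    cases h with | skip h1 h => cases h with | skip h2 h => exact ⟨[], .skip h2 (.skip h1 h)⟩
  | succ n ih =>
    obtain _ | ⟨p, x⟩ := x
    · cases h with
      | @take _ _ w ω h =>
        cases h with
        | @take _ _ w ω h =>
          obtain ⟨ω', h'⟩ := ih (x := y) (y := []) (w := w) (ω := ω)
            (by simp only [List.length_cons, List.length_nil] at hn ⊢; omega) (by simpa using h)
          rw [← mul_assoc, of_commute hab, mul_assoc]
          exact ⟨_, .take (.take (by simpa using h'))⟩
        | skip h1 h =>
          exact ⟨_, .skip (by rwa [of_dvd_of_mul_iff cs hab]) (.take h)⟩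
      | skip h1 h =>
        cases h with
        | take h =>
          rw [of_dvd_of_mul_iff cs hba] at h1
          exact ⟨_, .take (.skip h1 h)⟩
        | skip h2 h => exact ⟨_, .skip h2 (.skip h1 h)⟩
    · cases h with
      | @take _ _ w ω h =>
        obtain ⟨ω', h'⟩ := ih (x := x) (y := y ++ [p]) (w := w) (ω := ω)
          (by simp at hn ⊢; omega) (by simpa using h)
        exact ⟨_, .take (by simpa using h')⟩
      | skip hp h =>
        obtain ⟨ω', h'⟩ := ih (x := x) (y := y) (by simp at hn; omega) h
        exact ⟨_, .skip hp h'⟩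

theorem isArtinSortable_swap_iff (cs : CoxeterSystem M W) {a b : B} (hab : M a b = 2)
    {x y : List B} {w : M.ArtinMonoid} :
    IsArtinSortable M (x ++ a :: b :: y) w ↔ IsArtinSortable M (x ++ b :: a :: y) w :=
  ⟨fun ⟨_, h⟩ => IsArtinSortable.swap cs hab _ le_rfl h,
    fun ⟨_, h⟩ => IsArtinSortable.swap cs (by rw [M.symmetric, hab]) _ le_rfl h⟩

theorem isArtinSortable_move_iff (cs : CoxeterSystem M W) {i : B} {x y : List B}
    (h : ∀ j ∈ x, M j i = 2) {w : M.ArtinMonoid} :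
    IsArtinSortable M (x ++ i :: y) w ↔ IsArtinSortable M (i :: x ++ y) w := by
  induction x using List.reverseRecOn generalizing y with
  | nil => rfl
  | append_singleton x j ih =>
    rw [List.append_assoc, List.singleton_append, isArtinSortable_swap_iff cs (h j (by simp)),
      ih fun k hk => h k (by simp [hk])]
    simp

end ArtinSorting

/-! ### Sorting words in the Coxeter group -/

section Sorting

variable {B : Type*} {M : CoxeterMatrix B} {W : Type*} [Group W] (cs : CoxeterSystem M W)

/-- `ω` is the `c`-sorting word of `v`, and `v` is `c`-sortable: the analogue of `IsArtinSorting`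
for elements of the Coxeter group. -/
inductive IsSorting : List B → W → List B → Prop
  | nil : IsSorting [] 1 []
  | take {s : B} {c : List B} {v : W} {ω : List B} : ¬ cs.IsLeftDescent v s →
      IsSorting (c ++ [s]) v ω → IsSorting (s :: c) (cs.simple s * v) (s :: ω)
  | skip {s : B} {c : List B} {v : W} {ω : List B} : ¬ cs.IsLeftDescent v s →
      IsSorting c v ω → IsSorting (s :: c) v ω

/-- The pairs formed by the product of a proper prefix of a word and the letter that follows it. -/
def letterSeq : List B → List (W × B)
  | [] => []
  | b :: ω => (1, b) :: (letterSeq ω).map fun p => (cs.simple b * p.1, p.2)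

variable {cs}

theorem IsSorting.isArtinSorting {c ω : List B} {v : W} (h : IsSorting cs c v ω) :
    IsArtinSorting M c (cs.toArtin v) ω := by
  induction h with
  | nil => rw [toArtin_one]; exact .nil
  | take hs _ ih => rw [toArtin_simple_mul cs hs]; exact .take ih
  | skip hs _ ih => exact .skip (by rwa [of_dvd_toArtin]) ih

theorem isSorting_iff_isArtinSorting {c ω : List B} {v : W} :
    IsSorting cs c v ω ↔ IsArtinSorting M c (cs.toArtin v) ω := by
  refine ⟨IsSorting.isArtinSorting, fun h => ?_⟩
  generalize hw : cs.toArtin v = w at h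
  induction h generalizing v with
  | nil =>
    obtain rfl : v = 1 := toArtin_injective cs (by rw [hw, toArtin_one])
    exact .nil
  | @take s c w ω _ ih =>
    have hd : cs.IsLeftDescent v s := (of_dvd_toArtin cs).1 (hw ▸ dvd_mul_right _ _)
    obtain ⟨y, rfl⟩ : ∃ y, v = cs.simple s * y :=
      ⟨cs.simple s * v, by rw [simple_mul_simple_cancel_left]⟩
    rw [isLeftDescent_iff_not_isLeftDescent_mul, simple_mul_simple_cancel_left] at hd
    rw [toArtin_simple_mul cs hd] at hw
    exact .take hd (ih (of_mul_left_cancel cs hw))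
  | skip hs _ ih => exact .skip (by rwa [← hw, of_dvd_toArtin] at hs) (ih hw)

theorem IsSorting.wordProd_eq {c ω : List B} {v : W} (h : IsSorting cs c v ω) :
    cs.wordProd ω = v := by
  induction h with
  | nil => simp
  | take _ _ ih => rw [wordProd_cons, ih]
  | skip _ _ ih => exact ih

theorem IsSorting.isReduced {c ω : List B} {v : W} (h : IsSorting cs c v ω) : cs.IsReduced ω := by
  induction h with
  | nil => simp [CoxeterSystem.IsReduced]
  | take hs h ih => exact (isReduced_cons cs).2 ⟨ih, by rwa [h.wordProd_eq]⟩
  | skip _ _ ih => exact ih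

theorem IsSorting.subset {c ω : List B} {v : W} (h : IsSorting cs c v ω) : ∀ i ∈ ω, i ∈ c :=
  h.isArtinSorting.subset

theorem IsSorting.isSupportedIn {c ω : List B} {v : W} (h : IsSorting cs c v ω) :
    IsSupportedIn cs c v := by
  rw [← h.wordProd_eq]; exact isSupportedIn_wordProd cs h.subset

theorem IsSorting.cons {c ω : List B} {v : W} (h : IsSorting cs c v ω) {s : B} (hs : s ∉ c) :
    IsSorting cs (s :: c) v ω :=
  isSorting_iff_isArtinSorting.2 (h.isArtinSorting.cons hs)

theorem IsSorting.append_singleton {c ω : List B} {v : W} (h : IsSorting cs c v ω) {s : B}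
    (hs : s ∉ c) : IsSorting cs (c ++ [s]) v ω :=
  isSorting_iff_isArtinSorting.2 (.insert (by simpa using h.isArtinSorting) (by simpa using hs))

theorem IsSorting.of_append_singleton {c ω : List B} {v : W} {s : B}
    (h : IsSorting cs (c ++ [s]) v ω) (hs : s ∉ ω) : IsSorting cs c v ω :=
  isSorting_iff_isArtinSorting.2 (by simpa using h.isArtinSorting.remove hs)

variable (cs) in
theorem leftInvSeq_eq (ω : List B) :
    cs.leftInvSeq ω = (letterSeq cs ω).map fun p => p.1 * cs.simple p.2 * p.1⁻¹ := by
  induction ω with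
  | nil => rfl
  | cons b ω ih =>
    rw [leftInvSeq, letterSeq, ih]
    simp [mul_assoc]

theorem isLeftDescent_simple_mul {s : B} {v : W} (h : ¬ cs.IsLeftDescent v s) :
    cs.IsLeftDescent (cs.simple s * v) s := by
  rw [isLeftDescent_iff_not_isLeftDescent_mul, simple_mul_simple_cancel_left]
  exact h

theorem geom_ne_root_of_nonneg {s : B} {β : B →₀ ℝ} (h : 0 ≤ β) :
    geom cs (cs.simple s) β ≠ root s := by
  intro e
  have e2 := congrArg (geom cs (cs.simple s)) e
  rw [geom_simple_geom_simple, geom_simple_root] at e2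
  exact (isPosRoot_root cs s).not_nonpos (neg_nonneg.1 (e2 ▸ h))

variable (cs) in
theorem geom_mem_of_mem_letterSeq {ω : List B} (h : cs.IsReduced ω) {p : W × B}
    (hp : p ∈ letterSeq cs ω) :
    geom cs p.1 (root p.2) ∈ inversionRoots cs (cs.wordProd ω) := by
  induction ω generalizing p with
  | nil => simp [letterSeq] at hp
  | cons b ω ih =>
    have h' := (isReduced_cons cs).1 h
    rw [letterSeq, List.mem_cons, List.mem_map] at hp
    rw [wordProd_cons]
    rcases hp with rfl | ⟨q, hq, rfl⟩
    · rw [geom_one, root_mem_inversionRoots]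
      exact isLeftDescent_simple_mul h'.2
    · rw [geom_mul]
      exact geom_mem_inversionRoots_mul cs h'.2 (ih h'.1 hq)

theorem IsSorting.geom_mem_of_mem_letterSeq {c ω : List B} {v : W} (h : IsSorting cs c v ω)
    {p : W × B} (hp : p ∈ letterSeq cs ω) : geom cs p.1 (root p.2) ∈ inversionRoots cs v := by
  rw [← h.wordProd_eq]
  exact CoxeterSortable.geom_mem_of_mem_letterSeq cs h.isReduced hp

theorem IsSorting.pairwise {c ω : List B} {v : W} (hc : c.Nodup) (h : IsSorting cs c v ω) :
    (letterSeq cs ω).Pairwise fun p q =>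
      form M (geom cs p.1 (root p.2)) (geom cs q.1 (root q.2)) = 0 ∨
        0 < skewForm M c (geom cs p.1 (root p.2)) (geom cs q.1 (root q.2)) := by
  induction h with
  | nil => simp [letterSeq]
  | @take s c v ω hs h ih =>
    have hinv : ∀ r ∈ letterSeq cs ω, geom cs (cs.simple s) (geom cs r.1 (root r.2)) ∈
        inversionRoots cs (cs.simple s * v) := fun r hr =>
      geom_mem_inversionRoots_mul cs hs (h.geom_mem_of_mem_letterSeq hr)
    have hsupp : ∀ r ∈ letterSeq cs ω,
        VecSupportedIn (s :: c) (geom cs (cs.simple s) (geom cs r.1 (root r.2))) := fun r hr =>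
      (IsSorting.take hs h).isSupportedIn.vec_of_mem (hinv r hr)
    rw [letterSeq, List.pairwise_cons, List.pairwise_map]
    constructor
    · intro p hp
      obtain ⟨q, hq, rfl⟩ := List.mem_map.1 hp
      rw [geom_one, geom_mul]
      exact (hinv q hq).1.skewForm_root_left_pos hc
        (geom_ne_root_of_nonneg (h.geom_mem_of_mem_letterSeq hq).1.2) (hsupp q hq)
    · refine (ih (nodup_rotate hc)).imp_of_mem fun {p q} hp hq hpq => ?_
      rw [geom_mul, geom_mul, form_geom]
      rwa [← skewForm_rotate cs hc (hsupp p hp) (hsupp q hq), geom_simple_geom_simple,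
        geom_simple_geom_simple]
  | @skip s c v ω _ h ih =>
    rw [List.nodup_cons] at hc
    refine (ih hc.2).imp_of_mem fun {p q} hp hq hpq => ?_
    rwa [skewForm_cons_of_supported hc.1
      (h.isSupportedIn.vec_of_mem (h.geom_mem_of_mem_letterSeq hp))
      (h.isSupportedIn.vec_of_mem (h.geom_mem_of_mem_letterSeq hq))]

section Orthogonal

variable {s : B}

variable (cs) in
theorem gram_eq_zero_of_form_eq_zero {ω : List B} (hω : cs.IsReduced ω)
    (h : ∀ β ∈ inversionRoots cs (cs.wordProd ω), form M (root s) β = 0) :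
    ∀ b ∈ ω, gram M s b = 0 := by
  induction ω with
  | nil => simp
  | cons b ω ih =>
    have h' := (isReduced_cons cs).1 hω
    rw [wordProd_cons] at h
    have hb : gram M s b = 0 := by
      rw [← form_root_root]
      exact h _ ((root_mem_inversionRoots cs).2 (isLeftDescent_simple_mul h'.2))
    intro i hi
    rcases List.mem_cons.1 hi with rfl | hi
    · exact hb
    · refine ih h'.1 (fun β hβ => ?_) i hi
      have h1 := h _ (geom_mem_inversionRoots_mul cs h'.2 hβ)
      rwa [geom_simple, map_sub, map_smul, form_root_root, hb, smul_zero, sub_zero] at h1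

variable (cs) in
theorem geom_wordProd_root_eq {ω : List B} (h : ∀ b ∈ ω, gram M s b = 0) :
    geom cs (cs.wordProd ω) (root s) = root s := by
  induction ω with
  | nil => simp
  | cons b ω ih =>
    rw [wordProd_cons, geom_mul, ih fun i hi => h i (by simp [hi]), geom_simple, form_root_root,
      gram_comm, h b (by simp), zero_smul, sub_zero]

variable (cs) in
theorem not_mem_of_form_eq_zero {ω : List B} (hω : cs.IsReduced ω)
    (h : ∀ β ∈ inversionRoots cs (cs.wordProd ω), form M (root s) β = 0) : s ∉ ω := by
  intro hs
  have := gram_eq_zero_of_form_eq_zero cs hω h s hs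
  rw [gram_self] at this
  norm_num at this

theorem geom_root_eq_of_form_eq_zero {v : W}
    (h : ∀ β ∈ inversionRoots cs v, form M (root s) β = 0) : geom cs v (root s) = root s := by
  obtain ⟨ω, hω, rfl⟩ := cs.exists_isReduced v
  exact geom_wordProd_root_eq cs (gram_eq_zero_of_form_eq_zero cs hω h)

end Orthogonal

theorem not_isLeftDescent_mul_simple {y : W} {s i : B} (hs : ¬ cs.IsLeftDescent y s)
    (hi : cs.IsRightDescent y i) : ¬ cs.IsLeftDescent (y * cs.simple i) s := by
  intro h
  have h1 := cs.not_isLeftDescent_iff.1 hs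
  have h2 := cs.isRightDescent_iff.1 hi
  have h3 := cs.isLeftDescent_iff.1 h
  have h4 := cs.length_mul_simple (cs.simple s * y) i
  rw [← mul_assoc] at h3
  omega

variable (cs) in
theorem eq_root_of_isLeftDescent_mul_simple {y : W} {s j : B} (hs : ¬ cs.IsLeftDescent y s)
    (h : cs.IsLeftDescent (y * cs.simple j) s) : geom cs y (root j) = root s := by
  rw [not_isLeftDescent_iff_geom] at hs
  rw [isLeftDescent_iff_geom, mul_inv_rev, inv_simple, geom_mul] at h
  have hp : IsPosRoot cs (geom cs y⁻¹ (root s)) := ⟨⟨_, _, rfl⟩, hs⟩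
  by_cases e : geom cs y⁻¹ (root s) = root j
  · rw [← e, geom_geom_inv]
  · exact absurd h (hp.geom_simple e).not_nonpos

theorem IsSorting.mul_simple_of_geom_eq_root {s i : B} {c ω : List B} {v : W}
    (hs : ¬ cs.IsLeftDescent v s) (hsc : s ∉ c) (h : IsSorting cs c v ω)
    (hi : geom cs v (root i) = root s) : IsSorting cs (s :: c) (v * cs.simple i) (s :: ω) := by
  rw [mul_simple_eq_simple_mul cs (Or.inl hi)]
  exact .take hs (h.append_singleton hsc)

theorem IsSorting.form_eq_zero_of_skewForm_nonpos {s : B} {c ω : List B} {v : W}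
    (hc : (s :: c).Nodup) (hs : ¬ cs.IsLeftDescent v s) (h : IsSorting cs (c ++ [s]) v ω)
    (hmax : ∀ β ∈ inversionRoots cs (cs.simple s * v), skewForm M (s :: c) (root s) β ≤ 0) :
    ∀ β ∈ inversionRoots cs v, form M (root s) β = 0 := by
  intro β hβ
  have hβ' := geom_mem_inversionRoots_mul cs hs hβ
  rcases hβ'.1.skewForm_root_left_pos hc (geom_ne_root_of_nonneg hβ.1.2)
    ((IsSorting.take hs h).isSupportedIn.vec_of_mem hβ') with h0 | hpos
  · rw [geom_simple, map_sub, map_smul, form_root_self, smul_eq_mul] at h0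
    linarith
  · exact absurd hpos (not_lt.2 (hmax _ hβ'))

theorem IsSorting.exists_remove_inversion {c ω : List B} {v : W} (hc : c.Nodup)
    (h : IsSorting cs c v ω) {τ : B →₀ ℝ} (hτ : τ ∈ inversionRoots cs v)
    (hmax : ∀ β ∈ inversionRoots cs v, skewForm M c τ β ≤ 0) :
    ∃ i ω', geom cs v (root i) = -τ ∧ IsSorting cs c (v * cs.simple i) ω' := by
  induction h generalizing τ with
  | nil => rw [inversionRoots_one] at hτ; exact hτ.elim
  | @take s c y ω hs h ih =>
    have hT := IsSorting.take hs h
    by_cases e : τ = root s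
    · subst e
      have h0 := h.form_eq_zero_of_skewForm_nonpos hc hs hmax
      have hfix := geom_root_eq_of_form_eq_zero h0
      refine ⟨s, ω, by rw [geom_mul, hfix, geom_simple_root], ?_⟩
      rw [mul_assoc, mul_simple_eq_simple_mul cs (Or.inl hfix), simple_mul_simple_cancel_left]
      exact (h.of_append_singleton (not_mem_of_form_eq_zero cs h.isReduced
        (by rwa [h.wordProd_eq]))).cons (List.nodup_cons.1 hc).1
    · have hτ' := geom_mem_inversionRoots cs hτ e
      obtain ⟨i, ω', h1, h2⟩ := ih (nodup_rotate hc) hτ' fun β hβ => by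
        have h3 := geom_mem_inversionRoots_mul cs hs hβ
        have h4 := hmax _ h3
        rwa [← skewForm_rotate cs hc (hT.isSupportedIn.vec_of_mem hτ)
          (hT.isSupportedIn.vec_of_mem h3), geom_simple_geom_simple] at h4
      refine ⟨i, s :: ω', by rw [geom_mul, h1, map_neg, geom_simple_geom_simple], ?_⟩
      rw [mul_assoc]
      refine .take (not_isLeftDescent_mul_simple hs ?_) h2
      rw [isRightDescent_iff_geom, h1]
      exact neg_nonpos.2 hτ'.1.2
  | @skip s c y ω _ h ih =>
    obtain ⟨hsc, hc⟩ := List.nodup_cons.1 hc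
    obtain ⟨i, ω', h1, h2⟩ := ih hc hτ fun β hβ => by
      have := hmax β hβ
      rwa [skewForm_cons_of_supported hsc (h.isSupportedIn.vec_of_mem hτ)
        (h.isSupportedIn.vec_of_mem hβ)] at this
    exact ⟨i, ω', h1, h2.cons hsc⟩

end Sorting

/-! ### Cover reflections of sortable elements -/

section CoverReflections

variable {B : Type*} {M : CoxeterMatrix B} {W : Type*} [Group W] {cs : CoxeterSystem M W}

/-- The root `geom cs v (root j)`, which right multiplication by the simple reflection `j` adds to
the inversions of `v`, is positive, supported in `c`, and weakly follows every inversion of `v`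
with respect to `skewForm M c`. -/
structure IsAddable (cs : CoxeterSystem M W) (c : List B) (v : W) (j : B) : Prop where
  nonneg : 0 ≤ geom cs v (root j)
  supported : VecSupportedIn c (geom cs v (root j))
  skewForm_nonneg : ∀ β ∈ inversionRoots cs v, 0 ≤ skewForm M c β (geom cs v (root j))

variable (cs) in
theorem map_geom_root_sub_nonneg (f : (B →₀ ℝ) →ₗ[ℝ] ℝ) {s : B} {ω : List B} (hs : s ∉ ω)
    (hω : cs.IsReduced ω) (h : ∀ β ∈ inversionRoots cs (cs.wordProd ω), 0 ≤ f β) :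
    0 ≤ f (geom cs (cs.wordProd ω) (root s) - root s) := by
  induction ω generalizing f with
  | nil => simp
  | cons b ω ih =>
    have h' := (isReduced_cons cs).1 hω
    rw [wordProd_cons] at h ⊢
    have h1 := ih (f ∘ₗ (geom cs (cs.simple b)).toLinearMap) (fun h => hs (by simp [h])) h'.1
      fun β hβ => h _ (geom_mem_inversionRoots_mul cs h'.2 hβ)
    have h2 := h _ ((root_mem_inversionRoots cs).2 (isLeftDescent_simple_mul h'.2))
    have h3 : gram M b s ≤ 0 := gram_nonpos M (by rintro rfl; exact hs (by simp))
    simp only [LinearMap.coe_comp, LinearEquiv.coe_coe, Function.comp_apply, map_sub] at h1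
    rw [geom_simple cs b (root s), form_root_root, map_sub, map_smul, smul_eq_mul] at h1
    rw [geom_mul, map_sub]
    nlinarith

theorem exists_skewForm_neg {s : B} {c ω : List B} (hc : (s :: c).Nodup) (hω : cs.IsReduced ω)
    (hsub : ∀ i ∈ ω, i ∈ c) (hne : geom cs (cs.wordProd ω) (root s) ≠ root s) :
    ∃ β ∈ inversionRoots cs (cs.wordProd ω),
      skewForm M (s :: c) β (geom cs (cs.wordProd ω) (root s)) < 0 := by
  by_contra! hcon
  have hs := (List.nodup_cons.1 hc).1
  set τ := geom cs (cs.wordProd ω) (root s) with hτ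
  have h1 : τ s = 1 := by
    rw [hτ, isSupportedIn_wordProd cs hsub s hs, root_apply_self]
  have hp : IsPosRoot cs τ := by
    refine ⟨⟨_, _, rfl⟩, (geom_root_nonneg_or_nonpos cs _ _).resolve_right fun h => ?_⟩
    have := h s
    rw [← hτ, h1] at this
    norm_num at this
  have h2 := map_geom_root_sub_nonneg cs ((skewForm M (s :: c)).flip τ)
    (fun h => hs (hsub s h)) hω (by simpa using hcon)
  rw [LinearMap.flip_apply, ← hτ, map_sub, LinearMap.sub_apply, skewForm_self,
    skewForm_root_left hs] at h2
  have h3 := partialForm_nonpos (M := M) hs fun i _ => hp.2 i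
  have h4 : VecSupportedIn (s :: c) τ :=
    (isSupportedIn_wordProd cs fun i hi => List.mem_cons_of_mem _ (hsub i hi)).vec_iff.2
      (vecSupportedIn_root (by simp))
  have := (hp.apply_eq_zero_of_partialForm_eq_zero hc hne h4 (by linarith)).1
  rw [h1] at this
  norm_num at this

variable {s j : B} {c : List B} {v : W}

theorem geom_root_ne_neg_root (hs : ¬ cs.IsLeftDescent v s) :
    geom cs v (root j) ≠ -root s := by
  intro e
  have hj : cs.IsRightDescent v j := by
    rw [isRightDescent_iff_geom, e]
    exact neg_nonpos.2 (root_nonneg s)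
  have hmem := neg_geom_root_mem cs hj
  rw [e, neg_neg] at hmem
  exact hs ((root_mem_inversionRoots cs).1 hmem)

theorem geom_root_eq_of_isRightDescent_simple_mul (hj : cs.IsRightDescent (cs.simple s * v) j)
    (hv : ¬ cs.IsRightDescent v j) : geom cs v (root j) = root s := by
  by_contra hne
  have hp : IsPosRoot cs (geom cs v (root j)) :=
    ⟨⟨_, _, rfl⟩, (not_isRightDescent_iff_geom cs).1 hv⟩
  rw [isRightDescent_iff_geom, geom_mul] at hj
  exact (hp.geom_simple hne).not_nonpos hj

theorem isAddable_of_geom_eq_root (hs : s ∉ c) (hj : geom cs v (root j) = root s) :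
    IsAddable cs (c ++ [s]) v j where
  nonneg := hj ▸ root_nonneg s
  supported := hj ▸ vecSupportedIn_root (by simp)
  skewForm_nonneg _ hβ := hj ▸ hβ.1.skewForm_root_right_nonneg hs

theorem IsAddable.of_simple_mul {ω : List B} (hc : (s :: c).Nodup) (hs : ¬ cs.IsLeftDescent v s)
    (h : IsSorting cs (c ++ [s]) v ω) (hj : IsAddable cs (s :: c) (cs.simple s * v) j) :
    IsAddable cs (c ++ [s]) v j := by
  have heq : geom cs v (root j) = geom cs (cs.simple s) (geom cs (cs.simple s * v) (root j)) := by
    rw [geom_mul, geom_simple_geom_simple]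
  have hpos : IsPosRoot cs (geom cs (cs.simple s * v) (root j)) := ⟨⟨_, _, rfl⟩, hj.nonneg⟩
  have hne : geom cs (cs.simple s * v) (root j) ≠ root s := fun e =>
    geom_root_ne_neg_root (j := j) hs (by rw [heq, e, geom_simple_root])
  refine ⟨heq ▸ (hpos.geom_simple hne).2,
    heq ▸ vecSupportedIn_rotate.2 (vecSupportedIn_geom_simple.2 hj.supported), fun β hβ => ?_⟩
  have hβ' := geom_mem_inversionRoots_mul cs hs hβ
  have hskew := hj.skewForm_nonneg _ hβ'
  rwa [← skewForm_rotate cs hc ((IsSorting.take hs h).isSupportedIn.vec_of_mem hβ') hj.supported,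
    geom_simple_geom_simple, ← heq] at hskew

theorem IsAddable.of_cons {ω : List B} (hs : s ∉ c) (h : IsSorting cs c v ω)
    (hj : IsAddable cs (s :: c) v j) (hsupp : VecSupportedIn c (geom cs v (root j))) :
    IsAddable cs c v j :=
  ⟨hj.nonneg, hsupp, fun β hβ => by
    have := hj.skewForm_nonneg β hβ
    rwa [skewForm_cons_of_supported hs (h.isSupportedIn.vec_of_mem hβ) hsupp] at this⟩

theorem IsAddable.eq_of_not_supported {ω : List B} (hc : (s :: c).Nodup) (h : IsSorting cs c v ω)
    (hj : IsAddable cs (s :: c) v j) (hsupp : ¬ VecSupportedIn c (geom cs v (root j))) :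
    j = s ∧ geom cs v (root j) = root s := by
  obtain rfl : j = s := by
    by_contra hne
    refine hsupp fun i hi => ?_
    by_cases his : i = s
    · subst his
      rw [h.isSupportedIn i hi, root_apply_ne hne]
    · exact hj.supported i (by simp [his, hi])
  refine ⟨rfl, ?_⟩
  by_contra hne
  obtain ⟨β, hβ, hneg⟩ := exists_skewForm_neg hc h.isReduced h.subset (by rwa [h.wordProd_eq])
  rw [h.wordProd_eq] at hβ hneg
  exact absurd hneg (not_lt.2 (hj.skewForm_nonneg β hβ))

theorem IsAddable.exists_isSorting {ω : List B} (hc : c.Nodup) (h : IsSorting cs c v ω)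
    (hj : IsAddable cs c v j) : ∃ ω', IsSorting cs c (v * cs.simple j) ω' := by
  induction h with
  | nil => exact absurd (Finsupp.ext fun i => hj.supported i (by simp)) (geom_root_ne_zero cs 1 j)
  | @take s c y ω hs h ih =>
    obtain ⟨ω', hω'⟩ := ih (nodup_rotate hc) (hj.of_simple_mul hc hs h)
    refine ⟨s :: ω', ?_⟩
    rw [mul_assoc]
    refine .take (fun hd => ?_) hω'
    have hnonneg := hj.nonneg
    rw [geom_mul, eq_root_of_isLeftDescent_mul_simple cs hs hd, geom_simple_root] at hnonneg
    exact (isPosRoot_root cs s).not_nonpos (neg_nonneg.1 hnonneg)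
  | @skip s c v ω hs h ih =>
    obtain ⟨hsc, hc0⟩ := List.nodup_cons.1 hc
    by_cases hsupp : VecSupportedIn c (geom cs v (root j))
    · exact (ih hc0 (hj.of_cons hsc h hsupp)).imp fun _ h' => h'.cons hsc
    · exact ⟨_, h.mul_simple_of_geom_eq_root hs hsc (hj.eq_of_not_supported hc h hsupp).2⟩

/-- The addable roots are listed along with the cover roots because the induction needs them: when
`s` is prepended, the addable root `root s` becomes the cover root `-root s`. -/
theorem IsSorting.exists_cover_list {ω : List B} (hc : c.Nodup) (h : IsSorting cs c v ω) :
    ∃ C : List (B →₀ ℝ), C.Pairwise (fun x y => skewForm M c x y = -form M x y) ∧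
      (∀ x ∈ C, VecSupportedIn c x) ∧ (∀ j, IsAddable cs c v j → geom cs v (root j) ∈ C) ∧
      ∀ i, cs.IsRightDescent v i → geom cs v (root i) ∈ C := by
  induction h with
  | nil =>
    refine ⟨[], by simp, by simp, fun j hj => ?_, fun i hi => ?_⟩
    · exact absurd (Finsupp.ext fun i => hj.supported i (by simp)) (geom_root_ne_zero cs 1 j)
    · simp [IsRightDescent] at hi
  | @take s c y ω hs h ih =>
    obtain ⟨C, hpair, hsupp, hadd, hdesc⟩ := ih (nodup_rotate hc)
    have hsupp' : ∀ x ∈ C, VecSupportedIn (s :: c) (geom cs (cs.simple s) x) := fun x hx =>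
      vecSupportedIn_geom_simple.2 (vecSupportedIn_rotate.1 (hsupp x hx))
    refine ⟨C.map (geom cs (cs.simple s)), List.pairwise_map.2 ?_, by simpa using hsupp',
      fun j hj => ?_, fun i hi => ?_⟩
    · refine hpair.imp_of_mem fun {x z} hx hz hxz => ?_
      rwa [← skewForm_rotate cs hc (hsupp' x hx) (hsupp' z hz), geom_simple_geom_simple,
        geom_simple_geom_simple, form_geom]
    · rw [geom_mul]
      exact List.mem_map_of_mem (hadd j (hj.of_simple_mul hc hs h))
    · rw [geom_mul]
      refine List.mem_map_of_mem ?_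
      by_cases hyi : cs.IsRightDescent y i
      · exact hdesc i hyi
      · exact hadd i (isAddable_of_geom_eq_root (List.nodup_cons.1 hc).1
          (geom_root_eq_of_isRightDescent_simple_mul hi hyi))
  | @skip s c v ω _ h ih =>
    obtain ⟨hsc, hc0⟩ := List.nodup_cons.1 hc
    obtain ⟨C, hpair, hsupp, hadd, hdesc⟩ := ih hc0
    refine ⟨root s :: C, List.pairwise_cons.2 ⟨fun y hy => ?_, ?_⟩, List.forall_mem_cons.2
      ⟨vecSupportedIn_root (by simp), fun x hx => (hsupp x hx).cons⟩, fun j hj => ?_,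
      fun i hi => List.mem_cons_of_mem _ (hdesc i hi)⟩
    · rw [skewForm_root_left hsc, form_root_eq_partialForm hc0 (hsupp y hy)]
    · refine hpair.imp_of_mem fun {x y} hx hy hxy => ?_
      rw [skewForm_cons_of_supported hsc (hsupp x hx) (hsupp y hy), hxy]
    · by_cases hjs : VecSupportedIn c (geom cs v (root j))
      · exact List.mem_cons_of_mem _ (hadd j (hj.of_cons hsc h hjs))
      · simp [(hj.eq_of_not_supported hc h hjs).2]

variable (cs) in
theorem geom_root_ne (v : W) {i j : B} (hij : i ≠ j) : geom cs v (root i) ≠ geom cs v (root j) := by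
  intro e
  have := DFunLike.congr_fun ((geom cs v).injective e) i
  rw [root_apply_self, root_apply_ne hij.symm] at this
  norm_num at this

theorem IsSorting.skewForm_geom_root {ω : List B} (hc : c.Nodup) (h : IsSorting cs c v ω)
    {i j : B} (hi : cs.IsRightDescent v i) (hj : cs.IsRightDescent v j) (hij : i ≠ j) :
    skewForm M c (geom cs v (root i)) (geom cs v (root j)) = -gram M i j ∨
      skewForm M c (geom cs v (root i)) (geom cs v (root j)) = gram M i j := by
  obtain ⟨C, hpair, -, -, hdesc⟩ := h.exists_cover_list hc
  have : Std.Symm fun x y => skewForm M c x y = -form M x y ∨ skewForm M c x y = form M x y :=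
    ⟨fun x y hxy => by
      rw [skewForm_neg_symm, form_comm M y, neg_inj, neg_eq_iff_eq_neg]
      exact hxy.symm⟩
  have := (hpair.imp fun {a b} hab => (Or.inl hab : _ ∨ skewForm M c a b = form M a b)).forall
    (hdesc i hi) (hdesc j hj) (geom_root_ne cs v hij)
  rwa [form_geom, form_root_root] at this

theorem IsSorting.apply_eq_zero {ω : List B} (hc : (s :: c).Nodup)
    (h : IsSorting cs (c ++ [s]) v ω) {i : B} (hi : geom cs v (root i) = -root s)
    (hj : cs.IsRightDescent v j) (hij : j ≠ i) : geom cs v (root j) s = 0 := by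
  have hi' : cs.IsRightDescent v i := by
    rw [isRightDescent_iff_geom, hi]; exact neg_nonpos.2 (root_nonneg s)
  have key := h.skewForm_geom_root (nodup_rotate hc) hi' hj hij.symm
  have hxs : geom cs v (root j) s ≤ 0 := (isRightDescent_iff_geom cs).1 hj s
  have hform := form_geom cs v (root i) (root j)
  have hgram := gram_nonpos M hij.symm
  have hsupp : VecSupportedIn (s :: c) (geom cs v (root j)) := vecSupportedIn_rotate.1 <| by
    obtain ⟨C, -, hsupp, -, hdesc⟩ := h.exists_cover_list (nodup_rotate hc)
    exact hsupp _ (hdesc j hj)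
  have hf := form_root_eq (M := M) hc hsupp
  rw [hi, map_neg, LinearMap.neg_apply, skewForm_neg_symm, neg_neg,
    skewForm_root_right (List.nodup_cons.1 hc).1] at key
  rw [hi, form_root_root, map_neg, LinearMap.neg_apply] at hform
  rcases key with key | key <;> linarith

end CoverReflections

/-! ### Sorting words of longest elements -/

section LongestSorting

variable {B : Type*} {M : CoxeterMatrix B} {W : Type*} [Group W] {cs : CoxeterSystem M W}
  {c₁ c : List B} {u x : W} {s : B}

/-- A stage of the construction of the `c₁`-sorting word of the longest element `u * x` of the
parabolic subgroup generated by the letters of `c₁`: the prefix with product `u` has been read, and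
a `c`-sorting word of `x` remains to be found. -/
structure IsLongestSplit [Finite W] (cs : CoxeterSystem M W) (c₁ c : List B) (u x : W) : Prop where
  subset : ∀ i ∈ c, i ∈ c₁
  isSupportedIn : IsSupportedIn cs c₁ u
  mem_parabolic : x ∈ cs.parabolic {i | i ∈ c}
  mul_eq : u * x = cs.longest {i | i ∈ c₁}
  skewForm_eq : ∀ y z, VecSupportedIn c y → VecSupportedIn c z →
    skewForm M c₁ (geom cs u y) (geom cs u z) = skewForm M c y z
  pairwise : ∀ β ∈ inversionRoots cs u, ∀ γ ∈ inversionRoots cs x,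
    form M β (geom cs u γ) = 0 ∨ 0 < skewForm M c₁ β (geom cs u γ)

theorem eq_geom_root_of_mem_inversionRoots_mul_simple {β : B →₀ ℝ}
    (hβ : β ∈ inversionRoots cs (u * cs.simple s)) (hu : β ∉ inversionRoots cs u) :
    β = geom cs u (root s) := by
  have hpos : IsPosRoot cs (geom cs u⁻¹ β) :=
    (hβ.1.geom_or u⁻¹).resolve_right fun h => hu ⟨hβ.1, h⟩
  suffices h : geom cs u⁻¹ β = root s by rw [← h, geom_geom_inv]
  by_contra hne
  have hneg := hβ.2
  rw [mul_inv_rev, inv_simple, geom_mul] at hneg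
  exact (hpos.geom_simple hne).not_nonpos hneg

theorem mem_parabolic_of_form_eq_zero (hx : x ∈ cs.parabolic {i | i ∈ s :: c})
    (h : ∀ β ∈ inversionRoots cs x, form M (root s) β = 0) : x ∈ cs.parabolic {i | i ∈ c} := by
  obtain ⟨ω, hω, rfl, hsub⟩ := exists_isReduced_of_mem_parabolic cs hx
  have hs := not_mem_of_form_eq_zero cs hω h
  exact wordProd_mem_parabolic cs fun i hi =>
    (List.mem_cons.1 (hsub i hi)).resolve_left fun e => hs (e ▸ hi)

theorem parabolic_rotate : cs.parabolic {i | i ∈ c ++ [s]} = cs.parabolic {i | i ∈ s :: c} :=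
  congrArg _ (Set.ext fun _ => mem_rotate)

variable [Finite W]

theorem isLongestSplit_one (cs : CoxeterSystem M W) (c : List B) :
    IsLongestSplit cs c c 1 (cs.longest {i | i ∈ c}) where
  subset _ hi := hi
  isSupportedIn i _ x := by rw [geom_one]
  mem_parabolic := longest_mem cs _
  mul_eq := one_mul _
  skewForm_eq y z _ _ := by rw [geom_one, geom_one]
  pairwise β hβ := by rw [inversionRoots_one] at hβ; exact hβ.elim

theorem IsLongestSplit.pairwise_mul_simple (hc : (s :: c).Nodup) (hs : ¬ cs.IsLeftDescent x s)
    (h : IsLongestSplit cs c₁ (s :: c) u (cs.simple s * x)) :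
    ∀ β ∈ inversionRoots cs (u * cs.simple s), ∀ γ ∈ inversionRoots cs x,
      form M β (geom cs (u * cs.simple s) γ) = 0 ∨
        0 < skewForm M c₁ β (geom cs (u * cs.simple s) γ) := by
  intro β hβ γ hγ
  have hγ' := geom_mem_inversionRoots_mul cs hs hγ
  rw [geom_mul]
  by_cases hβu : β ∈ inversionRoots cs u
  · exact h.pairwise β hβu _ hγ'
  · have hsupp := (isSupportedIn_of_mem_parabolic cs h.mem_parabolic).vec_of_mem hγ'
    rw [eq_geom_root_of_mem_inversionRoots_mul_simple hβ hβu, form_geom,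
      h.skewForm_eq _ _ (vecSupportedIn_root (by simp)) hsupp]
    exact hγ'.1.skewForm_root_left_pos hc (geom_ne_root_of_nonneg hγ.1.2) hsupp

theorem IsLongestSplit.take (hc : (s :: c).Nodup) (hs : ¬ cs.IsLeftDescent x s)
    (h : IsLongestSplit cs c₁ (s :: c) u (cs.simple s * x)) :
    IsLongestSplit cs c₁ (c ++ [s]) (u * cs.simple s) x where
  subset i hi := h.subset i (mem_rotate.1 hi)
  isSupportedIn i hi z := by
    rw [geom_mul, h.isSupportedIn i hi, geom_simple_apply_ne cs]
    rintro rfl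
    exact hi (h.subset _ (by simp))
  mem_parabolic := by
    have hs : cs.simple s ∈ cs.parabolic {i | i ∈ s :: c} :=
      Subgroup.subset_closure ⟨s, by simp, rfl⟩
    rw [parabolic_rotate, ← cs.simple_mul_simple_cancel_left s (w := x)]
    exact mul_mem hs h.mem_parabolic
  mul_eq := by rw [mul_assoc, h.mul_eq]
  skewForm_eq y z hy hz := by
    have hy' := vecSupportedIn_geom_simple (cs := cs).2 (vecSupportedIn_rotate.1 hy)
    have hz' := vecSupportedIn_geom_simple (cs := cs).2 (vecSupportedIn_rotate.1 hz)
    rw [geom_mul, geom_mul, h.skewForm_eq _ _ hy' hz', ← skewForm_rotate cs hc hy' hz',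
      geom_simple_geom_simple, geom_simple_geom_simple]
  pairwise := h.pairwise_mul_simple hc hs

theorem IsLongestSplit.isRightDescent (hs : ¬ cs.IsLeftDescent x s)
    (h : IsLongestSplit cs c₁ (s :: c) u x) : cs.IsRightDescent u s := by
  by_contra hcon
  rw [not_isRightDescent_iff_geom] at hcon
  have := geom_longest_inv_nonpos cs hcon
    (h.isSupportedIn.vec_iff.2 (vecSupportedIn_root (h.subset s (by simp))))
  rw [← h.mul_eq, mul_inv_rev, geom_mul, geom_inv_geom] at this
  exact hs ((isLeftDescent_iff_geom cs).2 this)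

theorem IsLongestSplit.form_eq_zero (hc : (s :: c).Nodup) (hs : ¬ cs.IsLeftDescent x s)
    (h : IsLongestSplit cs c₁ (s :: c) u x) :
    ∀ β ∈ inversionRoots cs x, form M (root s) β = 0 := by
  intro β hβ
  rcases h.pairwise _ (neg_geom_root_mem cs (h.isRightDescent hs)) β hβ with h0 | hpos
  · rw [map_neg, LinearMap.neg_apply, form_geom] at h0
    linarith
  · rw [map_neg, LinearMap.neg_apply, h.skewForm_eq _ _ (vecSupportedIn_root (by simp))
      ((isSupportedIn_of_mem_parabolic cs h.mem_parabolic).vec_of_mem hβ)] at hpos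
    have := hβ.1.skewForm_root_left_nonneg (List.nodup_cons.1 hc).1
    linarith

theorem IsLongestSplit.skip (hc : (s :: c).Nodup) (hs : ¬ cs.IsLeftDescent x s)
    (h : IsLongestSplit cs c₁ (s :: c) u x) : IsLongestSplit cs c₁ c u x where
  subset i hi := h.subset i (List.mem_cons_of_mem _ hi)
  isSupportedIn := h.isSupportedIn
  mem_parabolic := mem_parabolic_of_form_eq_zero h.mem_parabolic (h.form_eq_zero hc hs)
  mul_eq := h.mul_eq
  skewForm_eq y z hy hz := by
    rw [h.skewForm_eq y z hy.cons hz.cons,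
      skewForm_cons_of_supported (List.nodup_cons.1 hc).1 hy hz]
  pairwise := h.pairwise

theorem IsLongestSplit.exists_isSorting (n : ℕ) (hn : cs.length x + c.length ≤ n) (hc : c.Nodup)
    (h : IsLongestSplit cs c₁ c u x) : ∃ ω, IsSorting cs c x ω := by
  induction n generalizing c u x with
  | zero =>
    obtain rfl : c = [] := List.eq_nil_of_length_eq_zero (by omega)
    obtain rfl : x = 1 := cs.length_eq_zero_iff.1 (by omega)
    exact ⟨[], .nil⟩
  | succ n ih =>
    obtain _ | ⟨s, c⟩ := c
    · obtain ⟨ω, -, rfl, hω⟩ := exists_isReduced_of_mem_parabolic cs h.mem_parabolic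
      obtain rfl : ω = [] := List.eq_nil_iff_forall_not_mem.2 fun i hi => by simpa using hω i hi
      exact ⟨[], by simpa using IsSorting.nil (cs := cs)⟩
    rw [List.length_cons] at hn
    by_cases hsx : cs.IsLeftDescent x s
    · obtain ⟨y, rfl⟩ : ∃ y, x = cs.simple s * y :=
        ⟨cs.simple s * x, by rw [simple_mul_simple_cancel_left]⟩
      rw [isLeftDescent_iff_not_isLeftDescent_mul, simple_mul_simple_cancel_left] at hsx
      have hlen := cs.not_isLeftDescent_iff.1 hsx
      obtain ⟨ω, hω⟩ := ih (by rw [List.length_append, List.length_singleton]; omega)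
        (nodup_rotate hc) (h.take hc hsx)
      exact ⟨s :: ω, .take hsx hω⟩
    · obtain ⟨ω, hω⟩ := ih (by omega) (List.nodup_cons.1 hc).2 (h.skip hc hsx)
      exact ⟨ω, .skip hsx hω⟩

theorem exists_isSorting_longest (cs : CoxeterSystem M W) {c : List B} (hc : c.Nodup) :
    ∃ ω, IsSorting cs c (cs.longest {i | i ∈ c}) ω :=
  (isLongestSplit_one cs c).exists_isSorting _ le_rfl hc

end LongestSorting

/-! ### Restrictions of Coxeter elements -/

section Restriction

variable {B : Type*} {M : CoxeterMatrix B} {W : Type*} [Group W] (cs : CoxeterSystem M W)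

theorem simple_injective (cs : CoxeterSystem M W) : Function.Injective cs.simple := by
  intro i j h
  by_contra hij
  have h1 := geom_simple_root cs i
  rw [h, geom_simple, form_root_root] at h1
  have h2 := DFunLike.congr_fun h1 i
  simp only [Finsupp.coe_sub, Finsupp.coe_smul, Pi.sub_apply, Pi.smul_apply, Finsupp.coe_neg,
    Pi.neg_apply, root_apply_self, root_apply_ne (Ne.symm hij), smul_eq_mul] at h2
  norm_num at h2

theorem geom_root_eq_neg_of_conj_eq {g h : W} {i j : B}
    (e : g * cs.simple i * g⁻¹ = h * cs.simple j * h⁻¹) (hg : 0 ≤ geom cs g (root i))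
    (hh : geom cs h (root j) ≤ 0) : geom cs h (root j) = -geom cs g (root i) := by
  have h1 := geom_conj_simple cs g i (geom cs g (root i))
  rw [e, geom_conj_simple, form_geom_root] at h1
  set x := geom cs g (root i)
  set y := geom cs h (root j) with hy
  have hxx : form M x x = 2 := form_geom_root cs g i
  have hyy : form M y y = 2 := form_geom_root cs h j
  set a := form M y x with ha
  have h2 : (2 : ℝ) • x = a • y := sub_right_injective h1.symm
  have h3 : a * a = 4 := by
    have := congrArg (form M y) h2
    rw [map_smul, map_smul, hyy, ← ha, smul_eq_mul, smul_eq_mul] at this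
    have h4 := congrArg (form M x) h2
    rw [map_smul, map_smul, hxx, form_comm M, ← ha, smul_eq_mul, smul_eq_mul] at h4
    linarith
  rcases mul_self_eq_mul_self_iff.1 (show a * a = 2 * 2 by rw [h3]; norm_num) with h4 | h4
  · rw [h4] at h2
    have h5 : x = y := smul_right_injective _ (by norm_num : (2 : ℝ) ≠ 0) h2
    rw [h5] at hg
    exact absurd (le_antisymm hh hg) (geom_root_ne_zero cs h j)
  · rw [h4, neg_smul, ← smul_neg] at h2
    rw [smul_right_injective _ (by norm_num : (2 : ℝ) ≠ 0) h2, neg_neg]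

/-- The restriction of the Coxeter element `c` with respect to `v`, up to commutation of letters:
`d` lists the right descents of `v` in an order compatible with the skew-symmetric form of `c`. -/
structure IsRestrictionWord (c : List B) (v : W) (d : List B) : Prop where
  nodup : d.Nodup
  mem_iff : ∀ i, i ∈ d ↔ cs.IsRightDescent v i
  pairwise : d.Pairwise fun i j =>
    gram M i j = 0 ∨ 0 < skewForm M c (geom cs v (root i)) (geom cs v (root j))

section Finite

variable [Finite W] {c ω : List B} {v : W}

theorem conj_simple_mem_leftInvSeq_of_isRightDescent
    (hω : IsSorting cs c (cs.longest {i | i ∈ c}) ω) (hv : v ∈ cs.parabolic {i | i ∈ c}) {i : B}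
    (hi : cs.IsRightDescent v i) : v * cs.simple i * v⁻¹ ∈ cs.leftInvSeq ω := by
  have hinv := neg_geom_root_mem cs hi
  have hconj : v * cs.simple i * v⁻¹ = (v * cs.simple i) * cs.simple i * (v * cs.simple i)⁻¹ := by
    simp [mul_assoc]
  have hroot : geom cs (v * cs.simple i) (root i) = -geom cs v (root i) := by
    rw [geom_mul, geom_simple_root, map_neg]
  rw [hconj]
  refine conj_mem_leftInvSeq cs (hroot ▸ hinv.1.2) ?_
  rw [hroot, hω.wordProd_eq]
  exact geom_longest_inv_nonpos cs hinv.1.2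
    ((isSupportedIn_of_mem_parabolic cs hv).vec_of_mem hinv)

theorem exists_sublist_leftInvSeq (hω : IsSorting cs c (cs.longest {i | i ∈ c}) ω)
    (hv : v ∈ cs.parabolic {i | i ∈ c}) :
    ∃ d : List B, d.Nodup ∧ (∀ i, i ∈ d ↔ cs.IsRightDescent v i) ∧
      (d.map fun i => v * cs.simple i * v⁻¹).Sublist (cs.leftInvSeq ω) := by
  classical
  set f : B → W := fun i => v * cs.simple i * v⁻¹ with hf
  have hfi : Function.Injective f := fun i j h => simple_injective cs (by simpa [hf] using h)
  set L := (cs.leftInvSeq ω).filter fun t => ∃ i, cs.IsRightDescent v i ∧ f i = t with hL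
  have hmem : ∀ t, t ∈ L ↔ t ∈ cs.leftInvSeq ω ∧ ∃ i, cs.IsRightDescent v i ∧ f i = t := by
    simp [hL, List.mem_filter]
  have hsub : L.Sublist (cs.leftInvSeq ω) := List.filter_sublist
  obtain ⟨d, hd⟩ : L ∈ Set.range (List.map f) := by
    rw [Set.range_list_map]
    exact fun t ht => (((hmem t).1 ht).2).imp fun _ h => h.2
  refine ⟨d, ?_, fun i => ?_, hd ▸ hsub⟩
  · exact List.Nodup.of_map f (hd ▸ hsub.nodup hω.isReduced.nodup_leftInvSeq)
  · rw [← List.mem_map_of_injective hfi, hd, hmem]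
    constructor
    · rintro ⟨-, j, hj, hji⟩
      exact hfi hji ▸ hj
    · exact fun hi => ⟨conj_simple_mem_leftInvSeq_of_isRightDescent cs hω hv hi, i, hi, rfl⟩

theorem isRestrictionWord_of_sublist {d : List B} (hc : c.Nodup)
    (hω : IsSorting cs c (cs.longest {i | i ∈ c}) ω) (hd : d.Nodup)
    (hmem : ∀ i, i ∈ d ↔ cs.IsRightDescent v i)
    (hsub : (d.map fun i => v * cs.simple i * v⁻¹).Sublist (cs.leftInvSeq ω)) :
    IsRestrictionWord cs c v d := by
  refine ⟨hd, hmem, ?_⟩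
  rw [leftInvSeq_eq, List.sublist_map_iff] at hsub
  obtain ⟨l, hl, e⟩ := hsub
  have h1 := (hω.pairwise hc).sublist hl
  have hpos : ∀ p ∈ l, 0 ≤ geom cs p.1 (root p.2) := fun p hp =>
    (geom_mem_of_mem_letterSeq cs hω.isReduced (hl.subset hp)).1.2
  have h2 : (l.map fun p => p.1 * cs.simple p.2 * p.1⁻¹).Pairwise fun t t' =>
      ∀ i j, cs.IsRightDescent v i → cs.IsRightDescent v j → v * cs.simple i * v⁻¹ = t →
        v * cs.simple j * v⁻¹ = t' →
        gram M i j = 0 ∨ 0 < skewForm M c (geom cs v (root i)) (geom cs v (root j)) := by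
    rw [List.pairwise_map]
    refine h1.imp_of_mem fun {p q} hp hq hpq i j hi hj hip hjq => ?_
    have ei := geom_root_eq_neg_of_conj_eq cs hip.symm (hpos p hp)
      ((isRightDescent_iff_geom cs).1 hi)
    have ej := geom_root_eq_neg_of_conj_eq cs hjq.symm (hpos q hq)
      ((isRightDescent_iff_geom cs).1 hj)
    rw [← form_root_root, ← form_geom cs v, ei, ej]
    simpa using hpq
  rw [← e, List.pairwise_map] at h2
  exact h2.imp_of_mem fun {i j} hi hj h => h i j ((hmem i).1 hi) ((hmem j).1 hj) rfl rfl

theorem exists_isRestrictionWord (hc : c.Nodup) (hv : v ∈ cs.parabolic {i | i ∈ c}) :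
    ∃ d, IsRestrictionWord cs c v d := by
  obtain ⟨ω, hω⟩ := exists_isSorting_longest cs hc
  obtain ⟨d, h1, h2, h3⟩ := exists_sublist_leftInvSeq cs hω hv
  exact ⟨d, isRestrictionWord_of_sublist cs hc hω h1 h2 h3⟩

end Finite

theorem head_mem_parabolic {c : List B} {w : M.ArtinMonoid}
    (h : ∀ i, i ∉ c → Avoids i w) : head cs w ∈ cs.parabolic {i | i ∈ c} := by
  obtain ⟨ω, h1, h2⟩ := cs.exists_isReduced (head cs w)
  rw [h2]
  refine wordProd_mem_parabolic cs fun i hi => ?_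
  by_contra hc
  have h3 := h i hc
  rw [← toArtin_head_mul_rest cs w, avoids_mul, h2, toArtin_wordProd cs h1,
    avoids_artinProd] at h3
  exact h3.1 hi

variable {cs}

theorem IsRestrictionWord.skewForm_eq {s : B} {c d : List B} {v : W} (hs : s ∉ c)
    (hv : IsSupportedIn cs c v) (h : IsRestrictionWord cs (s :: c) v d) :
    IsRestrictionWord cs c v d := by
  refine ⟨h.nodup, h.mem_iff, h.pairwise.imp_of_mem fun {i j} hi hj hij => ?_⟩
  have hi' := hv.vec_iff.2 (vecSupportedIn_root (hv.mem_of_isRightDescent ((h.mem_iff i).1 hi)))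
  have hj' := hv.vec_iff.2 (vecSupportedIn_root (hv.mem_of_isRightDescent ((h.mem_iff j).1 hj)))
  rwa [skewForm_cons_of_supported hs hi' hj'] at hij

theorem isRightDescent_of_simple_mul {s i : B} {y : W} (hs : ¬ cs.IsLeftDescent y s) :
    cs.IsRightDescent y i ↔ cs.IsRightDescent (cs.simple s * y) i ∧
      geom cs (cs.simple s * y) (root i) ≠ -root s := by
  constructor
  · intro hi
    have h1 := neg_geom_root_mem cs hi
    constructor
    · rw [isRightDescent_iff_geom, geom_mul]
      have h2 := (geom_mem_inversionRoots_mul cs hs h1).1.2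
      rwa [map_neg, neg_nonneg] at h2
    · rw [geom_mul]
      intro e
      refine geom_ne_root_of_nonneg (cs := cs) (s := s) h1.1.2 ?_
      rw [map_neg, e, neg_neg]
  · rintro ⟨hi, hne⟩
    by_contra hcon
    rw [geom_mul, geom_root_eq_of_isRightDescent_simple_mul hi hcon, geom_simple_root] at hne
    exact hne rfl

theorem IsRestrictionWord.of_simple_mul {s : B} {c d d' : List B} {y : W} (hc : (s :: c).Nodup)
    (hv : IsSupportedIn cs (s :: c) (cs.simple s * y)) (hs : ¬ cs.IsLeftDescent y s)
    (h : IsRestrictionWord cs (s :: c) (cs.simple s * y) d) (hsub : d'.Sublist d)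
    (hd' : ∀ i, i ∈ d' ↔ i ∈ d ∧ geom cs (cs.simple s * y) (root i) ≠ -root s) :
    IsRestrictionWord cs (c ++ [s]) y d' := by
  refine ⟨hsub.nodup h.nodup, fun i => ?_, ?_⟩
  · rw [hd', h.mem_iff, isRightDescent_of_simple_mul hs]
  · refine (h.pairwise.sublist hsub).imp_of_mem fun {i j} hi hj hij => ?_
    have key : ∀ k ∈ d', VecSupportedIn (s :: c) (geom cs (cs.simple s * y) (root k)) :=
      fun k hk => hv.vec_iff.2 (vecSupportedIn_root
        (hv.mem_of_isRightDescent ((h.mem_iff k).1 ((hd' k).1 hk).1)))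
    rw [← skewForm_rotate cs hc (key i hi) (key j hj), geom_mul, geom_mul, geom_simple_geom_simple,
      geom_simple_geom_simple] at hij
    exact hij

theorem IsRestrictionWord.exists_split {s i : B} {c d : List B} {v : W} (hs : s ∉ c)
    (h : IsRestrictionWord cs (s :: c) v d) (hi : geom cs v (root i) = -root s) :
    ∃ d₁ d₂, d = d₁ ++ i :: d₂ ∧ ∀ j ∈ d₁, M j i = 2 := by
  have hid : i ∈ d := by
    rw [h.mem_iff, isRightDescent_iff_geom, hi]; exact neg_nonpos.2 (root_nonneg s)
  obtain ⟨d₁, d₂, rfl⟩ := List.append_of_mem hid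
  refine ⟨d₁, d₂, rfl, fun j hj => eq_two_of_gram_eq_zero M ?_⟩
  refine ((List.pairwise_append.1 h.pairwise).2.2 j hj i (by simp)).resolve_right fun hlt => ?_
  have h1 := neg_geom_root_mem cs ((h.mem_iff j).1 (by simp [hj]))
  have h2 := h1.1.skewForm_root_left_nonneg hs
  rw [hi, skewForm_neg_symm] at hlt
  simp only [map_neg, LinearMap.neg_apply] at hlt h2
  linarith

theorem IsRestrictionWord.rotate {s i : B} {c d₁ d₂ ω : List B} {v : W} (hc : (s :: c).Nodup)
    (h : IsRestrictionWord cs (s :: c) v (d₁ ++ i :: d₂)) (hi : geom cs v (root i) = -root s)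
    (hω : IsSorting cs (c ++ [s]) v ω) :
    IsRestrictionWord cs (c ++ [s]) v (d₁ ++ d₂ ++ [i]) := by
  have hnd : (i :: (d₁ ++ d₂)).Nodup := List.nodup_middle.1 h.nodup
  have hmem : ∀ j, j ∈ d₁ ++ d₂ ++ [i] ↔ j ∈ d₁ ++ i :: d₂ := fun j => by
    simp only [List.mem_append, List.mem_cons, List.not_mem_nil]; tauto
  have hrd : ∀ j ∈ d₁ ++ d₂, cs.IsRightDescent v j ∧ j ≠ i := fun j hj => by
    refine ⟨(h.mem_iff j).1 ((hmem j).1 (by simp only [List.mem_append] at hj ⊢; tauto)), ?_⟩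
    rintro rfl
    exact (List.nodup_cons.1 hnd).1 hj
  have hsupp := hω.isSupportedIn
  refine ⟨nodup_rotate hnd, fun j => by rw [hmem, h.mem_iff], ?_⟩
  rw [List.pairwise_append]
  refine ⟨?_, by simp, ?_⟩
  · have h1 : (d₁ ++ d₂).Sublist (d₁ ++ i :: d₂) :=
      List.Sublist.append_left (List.sublist_cons_self _ _) _
    refine (h.pairwise.sublist h1).imp_of_mem fun {j k} hj hk hjk => ?_
    rwa [skewForm_append_of_supported (hω.apply_eq_zero hc hi (hrd j hj).1 (hrd j hj).2)
      (hω.apply_eq_zero hc hi (hrd k hk).1 (hrd k hk).2)]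
  · intro j hj k hk
    obtain rfl := List.mem_singleton.1 hk
    have h1 := neg_geom_root_mem cs (hrd j hj).1
    have hne : -geom cs v (root j) ≠ root s := by
      rw [Ne, neg_eq_iff_eq_neg, ← hi]
      exact geom_root_ne cs v (hrd j hj).2
    have h2 := h1.1.skewForm_root_right_pos hc hne (vecSupportedIn_rotate.1 (hsupp.vec_of_mem h1))
    rw [← form_root_root, ← form_geom cs v, hi, form_comm M]
    simpa using h2

end Restriction

/-! ### The first Garside factor of a sortable element -/

section HeadRest

variable {B : Type*} {M : CoxeterMatrix B} {W : Type*} [Group W] {cs : CoxeterSystem M W}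

variable (cs) in
theorem toArtin_mul_simple {u : W} {i : B} (h : ¬ cs.IsRightDescent u i) :
    cs.toArtin (u * cs.simple i) = cs.toArtin u * PresentedMonoid.of M.BraidRel i := by
  rw [← toArtin_simple cs, toArtin_mul cs]
  rw [length_simple]
  exact cs.not_isRightDescent_iff.1 h

variable (cs) in
theorem toArtin_inv_mul {u v : W} {i : B} (h : ¬ cs.IsRightDescent u i)
    (hp : WeakLE cs (u * cs.simple i) v) :
    cs.toArtin (u⁻¹ * v) =
      PresentedMonoid.of M.BraidRel i * cs.toArtin ((u * cs.simple i)⁻¹ * v) := by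
  apply toArtin_mul_left_cancel cs (u := u)
  rw [← ((weakLE_mul_simple cs h).trans hp).toArtin, hp.toArtin, toArtin_mul_simple cs h,
    mul_assoc]

theorem IsArtinSortable.isSupportedIn {c : List B} {v : W}
    (h : IsArtinSortable M c (cs.toArtin v)) : IsSupportedIn cs c v := by
  obtain ⟨ω, h⟩ := h
  exact (isSorting_iff_isArtinSorting.2 h).isSupportedIn

theorem toAdd_artinLength_of_mul (s : B) (w : M.ArtinMonoid) :
    (artinLength M (PresentedMonoid.of M.BraidRel s * w)).toAdd = (artinLength M w).toAdd + 1 := by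
  have := artinLength_artinProd M [s]
  rw [artinProd_cons, artinProd_nil, mul_one] at this
  rw [map_mul, this, toAdd_mul, add_comm]
  rfl

theorem not_dvd_rest {i : B} {w : M.ArtinMonoid} (hi : ¬ cs.IsRightDescent (head cs w) i) :
    ¬ PresentedMonoid.of M.BraidRel i ∣ rest cs w := by
  rintro ⟨r, hr⟩
  have h1 : cs.toArtin (head cs w * cs.simple i) ∣ w := by
    refine ⟨r, ?_⟩
    rw [toArtin_mul_simple cs hi, mul_assoc, ← hr, toArtin_head_mul_rest]
  have h2 := ((toArtin_dvd_iff cs).1 h1).length_le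
  rw [cs.not_isRightDescent_iff.1 hi] at h2
  omega

/-- `y` is the largest element of the weak order interval below `v` that does not have `s` as a
left descent. Then `s * y` is the first Garside factor of `s * w` whenever `v` is that of `w`. -/
structure IsMaxNotDescent (cs : CoxeterSystem M W) (s : B) (v y : W) : Prop where
  weakLE : WeakLE cs y v
  not_isLeftDescent : ¬ cs.IsLeftDescent y s
  weakLE_of : ∀ x, WeakLE cs x v → ¬ cs.IsLeftDescent x s → WeakLE cs x y

variable (cs) in
theorem exists_head_of_mul (s : B) (w : M.ArtinMonoid) :
    ∃ y, IsMaxNotDescent cs s (head cs w) y ∧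
      head cs (PresentedMonoid.of M.BraidRel s * w) = cs.simple s * y ∧
      rest cs (PresentedMonoid.of M.BraidRel s * w) =
        cs.toArtin (y⁻¹ * head cs w) * rest cs w := by
  have hhead := head_toArtin_mul cs (cs.simple s) w
  have hrest := rest_toArtin_mul cs (cs.simple s) w
  have hlen := length_mul_maxPrefix cs (cs.simple s) (head cs w)
  rw [toArtin_simple] at hhead hrest
  rw [length_simple, add_comm, ← cs.not_isLeftDescent_iff] at hlen
  exact ⟨_, ⟨maxPrefix_weakLE cs _ _, hlen, fun x hx hxs => weakLE_maxPrefix cs hx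
    (by rw [length_simple, cs.not_isLeftDescent_iff.1 hxs, add_comm])⟩, hhead, hrest⟩

namespace IsMaxNotDescent

variable {s : B} {v y : W}

theorem exists_simple_mul_weakLE (h : IsMaxNotDescent cs s v y) (hyv : y ≠ v) :
    ∃ i, ¬ cs.IsRightDescent y i ∧ geom cs y (root i) = root s ∧
      y * cs.simple i = cs.simple s * y ∧ WeakLE cs (cs.simple s * y) v := by
  obtain ⟨i, hiy, hle⟩ := exists_mul_simple_weakLE cs h.weakLE hyv
  have hdesc : cs.IsLeftDescent (y * cs.simple i) s := by
    by_contra hcon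
    have hlen := (h.weakLE_of _ hle hcon).length_le
    rw [cs.not_isRightDescent_iff.1 hiy] at hlen
    omega
  have hroot := eq_root_of_isLeftDescent_mul_simple cs h.not_isLeftDescent hdesc
  have hcomm := mul_simple_eq_simple_mul cs (Or.inl hroot)
  exact ⟨i, hiy, hroot, hcomm, hcomm ▸ hle⟩

theorem isLeftDescent (h : IsMaxNotDescent cs s v y) (hyv : y ≠ v) : cs.IsLeftDescent v s := by
  by_contra hcon
  exact hyv (h.weakLE.eq_of_length_le (h.weakLE_of v (weakLE_refl cs v) hcon).length_le)

theorem exists_isSorting {c ω : List B} (hc : (s :: c).Nodup)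
    (hy : IsMaxNotDescent cs s v y) (hyv : y ≠ v) (h : IsSorting cs (c ++ [s]) v ω) :
    cs.simple s * y = v ∧ ∃ ω', IsSorting cs (c ++ [s]) y ω' := by
  have hsv := hy.isLeftDescent hyv
  obtain ⟨i, ω', hroot, hω'⟩ := h.exists_remove_inversion (nodup_rotate hc)
    ((root_mem_inversionRoots cs).2 hsv) fun β hβ => by
      rw [skewForm_neg_symm]
      have := hβ.1.skewForm_root_right_nonneg (List.nodup_cons.1 hc).1
      linarith
  have hi : cs.IsRightDescent v i := by
    rw [isRightDescent_iff_geom, hroot]; exact neg_nonpos.2 (root_nonneg s)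
  have hcomm := mul_simple_eq_simple_mul cs (Or.inr hroot)
  have hlast : v * cs.simple i = y := by
    refine (hy.weakLE_of _ (mul_simple_weakLE cs hi) ?_).eq_of_length_le ?_
    · rw [hcomm]; exact cs.isLeftDescent_iff_not_isLeftDescent_mul.1 hsv
    · have hlen : cs.length y ≠ cs.length v := fun e => hyv (hy.weakLE.eq_of_length_le e.ge)
      have := hy.weakLE.length_le
      have := cs.isRightDescent_iff.1 hi
      omega
  rw [← hlast]
  exact ⟨by rw [hcomm, simple_mul_simple_cancel_left], ω', hω'⟩

end IsMaxNotDescent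

/-- The element `w` is `c`-sortable if and only if its first Garside factor is, and the remaining
factor is sortable for the restriction of `c`. This is the statement proved by induction in
`sortsByHead`; it is named so that its inductive steps can be stated separately. -/
def SortsByHead (cs : CoxeterSystem M W) (c : List B) (w : M.ArtinMonoid) : Prop :=
  ∀ d, IsRestrictionWord cs c (head cs w) d → (IsArtinSortable M c w ↔
    IsArtinSortable M c (cs.toArtin (head cs w)) ∧ IsArtinSortable M d (rest cs w))

theorem sortsByHead_of_not_avoids {c : List B} {w : M.ArtinMonoid} {i : B} (hi : i ∉ c)
    (hw : ¬ Avoids i w) : SortsByHead cs c w := by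
  refine fun d hd => iff_of_false (fun h => hw (h.avoids hi)) fun h => hw ?_
  rw [← toArtin_head_mul_rest cs w, avoids_mul]
  exact ⟨h.1.avoids hi, h.2.avoids fun hid =>
    hi (h.1.isSupportedIn.mem_of_isRightDescent ((hd.mem_iff i).1 hid))⟩

theorem sortsByHead_one : SortsByHead cs [] (1 : M.ArtinMonoid) := by
  intro d hd
  obtain rfl : d = [] := List.eq_nil_iff_forall_not_mem.2 fun i hi => by
    have := (hd.mem_iff i).1 hi
    rw [head_one] at this
    simp [IsRightDescent] at this
  rw [head_one, rest_one, toArtin_one, isArtinSortable_nil]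
  simp

theorem sortsByHead_nil (w : M.ArtinMonoid) : SortsByHead cs [] w := by
  by_cases hw : ∀ i, Avoids i w
  · obtain ⟨ω, rfl⟩ := artinProd_surjective M w
    obtain rfl : ω = [] := List.eq_nil_iff_forall_not_mem.2 fun i => avoids_artinProd.1 (hw i)
    rw [artinProd_nil]
    exact sortsByHead_one
  · obtain ⟨i, hi⟩ := not_forall.1 hw
    exact sortsByHead_of_not_avoids List.not_mem_nil hi

variable {s : B} {c d : List B} {w : M.ArtinMonoid} {y : W}

theorem SortsByHead.cons_of_not_dvd (ih : SortsByHead cs c w) (hsc : s ∉ c)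
    (hsw : ¬ PresentedMonoid.of M.BraidRel s ∣ w) : SortsByHead cs (s :: c) w := by
  intro d hd
  have hsh : ¬ PresentedMonoid.of M.BraidRel s ∣ cs.toArtin (head cs w) := by
    rwa [of_dvd_toArtin, ← of_dvd_iff]
  rw [isArtinSortable_cons hsw, isArtinSortable_cons hsh]
  by_cases hsupp : IsSupportedIn cs c (head cs w)
  · exact ih d (hd.skewForm_eq hsc hsupp)
  · exact iff_of_false (fun h => hsupp (isSupportedIn_of_mem_parabolic cs
      (head_mem_parabolic cs fun i hi => h.avoids hi))) fun h => hsupp h.1.isSupportedIn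

theorem IsRestrictionWord.exists_of_simple_mul_head (hc : (s :: c).Nodup)
    (hsupp : IsSupportedIn cs (s :: c) (cs.simple s * head cs w))
    (hs : ¬ cs.IsLeftDescent (head cs w) s)
    (hd : IsRestrictionWord cs (s :: c) (cs.simple s * head cs w) d) :
    ∃ d', IsRestrictionWord cs (c ++ [s]) (head cs w) d' ∧
      (IsArtinSortable M d (rest cs w) ↔ IsArtinSortable M d' (rest cs w)) := by
  by_cases hi : ∃ i, geom cs (cs.simple s * head cs w) (root i) = -root s
  · obtain ⟨i, hi⟩ := hi
    obtain ⟨d₁, d₂, rfl, hcomm⟩ := hd.exists_split (List.nodup_cons.1 hc).1 hi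
    have hi' : i ∉ d₁ ++ d₂ := (List.nodup_cons.1 (List.nodup_middle.1 hd.nodup)).1
    refine ⟨d₁ ++ d₂, hd.of_simple_mul hc hsupp hs
      (List.Sublist.append_left (List.sublist_cons_self _ _) _) fun j => ?_, ?_⟩
    · rw [← hi, (List.perm_middle (a := i)).mem_iff, List.mem_cons]
      refine ⟨fun hj => ⟨Or.inr hj, geom_root_ne cs _ fun e => hi' (e ▸ hj)⟩, ?_⟩
      rintro ⟨rfl | hj, hne⟩
      exacts [absurd rfl hne, hj]
    · rw [isArtinSortable_move_iff cs hcomm, List.cons_append, isArtinSortable_cons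
        (not_dvd_rest fun h => ((isRightDescent_of_simple_mul hs).1 h).2 hi)]
  · exact ⟨d, hd.of_simple_mul hc hsupp hs (List.Sublist.refl _)
      fun j => ⟨fun hj => ⟨hj, fun e => hi ⟨j, e⟩⟩, fun hj => hj.1⟩, Iff.rfl⟩

theorem SortsByHead.of_head_eq (ih : SortsByHead cs (c ++ [s]) w) (hc : (s :: c).Nodup)
    (hsupp : IsSupportedIn cs (s :: c) (cs.simple s * head cs w))
    (hs : ¬ cs.IsLeftDescent (head cs w) s)
    (hd : IsRestrictionWord cs (s :: c) (cs.simple s * head cs w) d) :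
    IsArtinSortable M (c ++ [s]) w ↔ IsArtinSortable M (c ++ [s]) (cs.toArtin (head cs w)) ∧
      IsArtinSortable M d (rest cs w) := by
  obtain ⟨d', hd', hiff⟩ := hd.exists_of_simple_mul_head hc hsupp hs
  rw [hiff]
  exact ih d' hd'

theorem SortsByHead.iff_of_isSorting {i : B} {d₁ d₂ ω : List B}
    (ih : SortsByHead cs (c ++ [s]) w) (hc : (s :: c).Nodup)
    (hd : IsRestrictionWord cs (s :: c) (head cs w) (d₁ ++ i :: d₂))
    (hi : geom cs (head cs w) (root i) = -root s) (hω : IsSorting cs (c ++ [s]) (head cs w) ω) :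
    IsArtinSortable M (c ++ [s]) w ↔ IsArtinSortable M (d₁ ++ d₂ ++ [i]) (rest cs w) := by
  rw [ih _ (hd.rotate hc hi hω)]
  exact and_iff_right ⟨ω, hω.isArtinSorting⟩

theorem eq_of_isArtinSortable_toArtin_mul {c : List B} {v : W} {r : M.ArtinMonoid}
    (hy : WeakLE cs y v) (hc : ∀ i, cs.IsRightDescent y i ∨ i ∉ c)
    (h : IsArtinSortable M c (cs.toArtin (y⁻¹ * v) * r)) : y = v := by
  by_contra hne
  obtain ⟨j, hj, hle⟩ := exists_mul_simple_weakLE cs hy hne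
  rw [toArtin_inv_mul cs hj hle, mul_assoc] at h
  exact not_avoids_of_dvd (dvd_mul_right _ _) (h.avoids ((hc j).resolve_left hj))

theorem SortsByHead.of_head_ne [Finite W] (ih : SortsByHead cs (c ++ [s]) w) (hc : (s :: c).Nodup)
    (hw : ∀ i, i ∉ c ++ [s] → Avoids i w) (hy : IsMaxNotDescent cs s (head cs w) y)
    (hne : y ≠ head cs w) (hd : IsRestrictionWord cs (s :: c) (cs.simple s * y) d) :
    IsArtinSortable M (c ++ [s]) w ↔ IsArtinSortable M (c ++ [s]) (cs.toArtin y) ∧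
      IsArtinSortable M d (cs.toArtin (y⁻¹ * head cs w) * rest cs w) := by
  obtain ⟨i, hiy, hroot, hcomm, hle⟩ := hy.exists_simple_mul_weakLE hne
  have hneg : geom cs (cs.simple s * y) (root i) = -root s := by
    rw [geom_mul, hroot, geom_simple_root]
  obtain ⟨d₁, d₂, rfl, hmove⟩ := hd.exists_split (List.nodup_cons.1 hc).1 hneg
  rw [toArtin_inv_mul cs hiy (hcomm ▸ hle), hcomm, mul_assoc, isArtinSortable_move_iff cs hmove,
    List.cons_append, isArtinSortable_cons_of_mul cs]
  have key : ∀ ω, cs.simple s * y = head cs w → IsSorting cs (c ++ [s]) (cs.simple s * y) ω →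
      (IsArtinSortable M (c ++ [s]) w ↔ IsArtinSortable M (d₁ ++ d₂ ++ [i])
        (cs.toArtin ((cs.simple s * y)⁻¹ * head cs w) * rest cs w)) := by
    intro ω e hω
    rw [e] at hd hneg hω
    rw [e, inv_mul_cancel, toArtin_one, one_mul]
    exact ih.iff_of_isSorting hc hd hneg hω
  constructor
  · intro h
    obtain ⟨d', hd'⟩ := exists_isRestrictionWord cs (nodup_rotate hc) (head_mem_parabolic cs hw)
    obtain ⟨ω, hω⟩ := ((ih d' hd').1 h).1
    rw [← isSorting_iff_isArtinSorting] at hω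
    obtain ⟨e, ω', hω'⟩ := hy.exists_isSorting hc hne hω
    exact ⟨⟨ω', hω'.isArtinSorting⟩, (key ω e (e ▸ hω)).1 h⟩
  · rintro ⟨⟨ω, hω⟩, h⟩
    rw [← isSorting_iff_isArtinSorting] at hω
    obtain ⟨ω', hω'⟩ := (isAddable_of_geom_eq_root (List.nodup_cons.1 hc).1 hroot).exists_isSorting
      (nodup_rotate hc) hω
    rw [hcomm] at hω'
    refine (key ω' (eq_of_isArtinSortable_toArtin_mul hle (fun j => ?_) h) hω').2 h
    rw [← hd.mem_iff]
    simp only [List.mem_append, List.mem_cons, List.not_mem_nil]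
    tauto

theorem SortsByHead.of_mul [Finite W] (ih : SortsByHead cs (c ++ [s]) w) (hc : (s :: c).Nodup) :
    SortsByHead cs (s :: c) (PresentedMonoid.of M.BraidRel s * w) := by
  by_cases hw : ∀ i, i ∉ s :: c → Avoids i (PresentedMonoid.of M.BraidRel s * w)
  · intro d hd
    have hsupp := isSupportedIn_of_mem_parabolic cs (head_mem_parabolic cs hw)
    obtain ⟨y, hy, hhead, hrest⟩ := exists_head_of_mul cs s w
    rw [hhead] at hd hsupp
    rw [hhead, hrest, toArtin_simple_mul cs hy.not_isLeftDescent, isArtinSortable_cons_of_mul cs,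
      isArtinSortable_cons_of_mul cs]
    by_cases hne : y = head cs w
    · subst hne
      rw [inv_mul_cancel, toArtin_one, one_mul]
      exact ih.of_head_eq hc hsupp hy.not_isLeftDescent hd
    · exact ih.of_head_ne hc (fun i hi => (avoids_mul.1 (hw i (mt mem_rotate.2 hi))).2) hy hne hd
  · push Not at hw
    obtain ⟨i, hi, hiw⟩ := hw
    exact sortsByHead_of_not_avoids hi hiw

variable (cs) in
theorem sortsByHead [Finite W] {c : List B} (hc : c.Nodup) (w : M.ArtinMonoid) :
    SortsByHead cs c w := by
  obtain ⟨n, hn⟩ : ∃ n, (artinLength M w).toAdd + c.length = n := ⟨_, rfl⟩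
  induction n generalizing c w with
  | zero =>
    obtain rfl : c = [] := List.eq_nil_of_length_eq_zero (by omega)
    exact sortsByHead_nil w
  | succ n ih =>
    obtain _ | ⟨s, c⟩ := c
    · exact sortsByHead_nil w
    obtain ⟨hsc, hc'⟩ := List.nodup_cons.1 hc
    rw [List.length_cons] at hn
    by_cases hsw : PresentedMonoid.of M.BraidRel s ∣ w
    · obtain ⟨w, rfl⟩ := hsw
      rw [toAdd_artinLength_of_mul] at hn
      refine (ih (nodup_rotate hc) w ?_).of_mul hc
      rw [List.length_append, List.length_singleton]
      omega
    · exact (ih hc' w (by omega)).cons_of_not_dvd hsc hsw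

end HeadRest

/-! ### Cyclic sorting words and greedy search -/

section CyclicSorting

variable {B : Type*} (M : CoxeterMatrix B)

/-- A variant of `IsArtinSorting` in which the word `c` is only rotated: a letter that is skipped
must not be used later. -/
inductive IsCyclicSorting : List B → M.ArtinMonoid → List B → Prop
  | nil {c : List B} : IsCyclicSorting c 1 []
  | take {s : B} {c : List B} {w : M.ArtinMonoid} {ω : List B} :
      IsCyclicSorting (c ++ [s]) w ω →
      IsCyclicSorting (s :: c) (PresentedMonoid.of M.BraidRel s * w) (s :: ω)
  | skip {s : B} {c : List B} {w : M.ArtinMonoid} {ω : List B} :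
      s ∉ ω → IsCyclicSorting (c ++ [s]) w ω → IsCyclicSorting (s :: c) w ω

variable {M} {s a : B} {c ω : List B} {w : M.ArtinMonoid}

theorem IsCyclicSorting.artinProd_eq (h : IsCyclicSorting M c w ω) : M.artinProd ω = w := by
  induction h with
  | nil => exact artinProd_nil M
  | take _ ih => rw [artinProd_cons, ih]
  | skip _ _ ih => exact ih

theorem IsCyclicSorting.insert_of_forall_cons (hs : s ∉ ω)
    (h : ∀ x y, x ++ y = c → IsCyclicSorting M (a :: x ++ s :: y) w ω) :
    ∀ x y, x ++ y = a :: c → IsCyclicSorting M (x ++ s :: y) w ω := by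
  rintro (_ | ⟨b, x⟩) y hxy
  · obtain rfl : y = a :: c := hxy
    exact .skip hs (h c [] (List.append_nil c))
  · obtain ⟨rfl, rfl⟩ := List.cons.inj hxy
    exact h x y rfl

theorem IsCyclicSorting.insert (h : IsCyclicSorting M c w ω) (hs : s ∉ ω) :
    ∀ x y, x ++ y = c → IsCyclicSorting M (x ++ s :: y) w ω := by
  induction h with
  | nil => exact fun _ _ _ => .nil
  | @take a c w ω _ ih =>
    refine insert_of_forall_cons hs fun x y hxy => .take ?_
    simpa using ih (mt (List.mem_cons_of_mem a) hs) x (y ++ [a]) (by simp [← hxy])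
  | @skip a c w ω ha _ ih =>
    refine insert_of_forall_cons hs fun x y hxy => .skip ha ?_
    simpa using ih hs x (y ++ [a]) (by simp [← hxy])

theorem isCyclicSorting_iff (hc : c.Nodup) : IsCyclicSorting M c w ω ↔ IsArtinSorting M c w ω := by
  constructor
  · intro h
    clear hc
    induction h with
    | nil => exact isArtinSorting_one _
    | take _ ih => exact .take ih
    | @skip s c w ω hs h ih =>
      refine .skip (fun hd => not_avoids_of_dvd hd ?_) ?_
      · rwa [← h.artinProd_eq, avoids_artinProd]
      · simpa using ih.remove (x := c) (y := []) hs
  · intro h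
    induction h with
    | nil => exact .nil
    | take _ ih => exact .take (ih (nodup_rotate hc))
    | @skip s c w ω _ h ih =>
      obtain ⟨hsc, hc'⟩ := List.nodup_cons.1 hc
      have hs : s ∉ ω := fun hm => hsc (h.subset s hm)
      exact .skip hs ((ih hc').insert hs c [] (List.append_nil c))

end CyclicSorting

section Greedy

variable {B : Type*} {M : CoxeterMatrix B} {W : Type*} [Group W]

/-- The increasing list of positions, starting with `t`, that are found by the greedy search for
a word for `w` in the sequence of letters `f`. -/
inductive IsGreedy (M : CoxeterMatrix B) (f : ℕ → B) : ℕ → M.ArtinMonoid → List ℕ → Prop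
  | nil {t : ℕ} : IsGreedy M f t 1 []
  | take {t : ℕ} {w : M.ArtinMonoid} {p : List ℕ} : IsGreedy M f (t + 1) w p →
      IsGreedy M f t (PresentedMonoid.of M.BraidRel (f t) * w) (t :: p)
  | skip {t : ℕ} {w : M.ArtinMonoid} {p : List ℕ} : ¬ PresentedMonoid.of M.BraidRel (f t) ∣ w →
      IsGreedy M f (t + 1) w p → IsGreedy M f t w p

/-- `p` is an increasing list of positions, none of them before `t`, at which the sequence of
letters `f` spells a word for `w`. -/
structure IsSubwordAt (M : CoxeterMatrix B) (f : ℕ → B) (t : ℕ) (w : M.ArtinMonoid)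
    (p : List ℕ) : Prop where
  lt : p.Pairwise (· < ·)
  le : ∀ k ∈ p, t ≤ k
  prod : M.artinProd (p.map f) = w

variable {f : ℕ → B} {t a n : ℕ} {w : M.ArtinMonoid} {p q : List ℕ}

theorem IsSubwordAt.of_succ (h : IsSubwordAt M f (t + 1) w p) : IsSubwordAt M f t w p :=
  ⟨h.lt, fun k hk => Nat.le_of_succ_le (h.le k hk), h.prod⟩

theorem IsSubwordAt.cons (h : IsSubwordAt M f (t + 1) w p) :
    IsSubwordAt M f t (PresentedMonoid.of M.BraidRel (f t) * w) (t :: p) := by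
  refine ⟨List.pairwise_cons.2 ⟨fun k hk => h.le k hk, h.lt⟩, fun k hk => ?_, ?_⟩
  · rcases List.mem_cons.1 hk with rfl | hk
    · exact le_rfl
    · exact Nat.le_of_succ_le (h.le k hk)
  · rw [List.map_cons, artinProd_cons, h.prod]

theorem IsSubwordAt.succ (h : IsSubwordAt M f t w (a :: p)) (ha : t < a) :
    IsSubwordAt M f (t + 1) w (a :: p) := by
  refine ⟨h.lt, fun k hk => ?_, h.prod⟩
  rcases List.mem_cons.1 hk with rfl | hk
  · exact ha
  · exact ha.trans ((List.pairwise_cons.1 h.lt).1 k hk)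

theorem IsSubwordAt.tail (cs : CoxeterSystem M W)
    (h : IsSubwordAt M f t (PresentedMonoid.of M.BraidRel (f t) * w) (t :: p)) :
    IsSubwordAt M f (t + 1) w p := by
  refine ⟨(List.pairwise_cons.1 h.lt).2, fun k hk => (List.pairwise_cons.1 h.lt).1 k hk, ?_⟩
  have := h.prod
  rw [List.map_cons, artinProd_cons] at this
  exact of_mul_left_cancel cs this

theorem IsGreedy.isSubwordAt (h : IsGreedy M f t w p) : IsSubwordAt M f t w p := by
  induction h with
  | nil => exact ⟨by simp, by simp, artinProd_nil M⟩
  | take _ ih => exact ih.cons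
  | skip _ _ ih => exact ih.of_succ

theorem IsGreedy.le (cs : CoxeterSystem M W) (h : IsGreedy M f t w p)
    (hq : IsSubwordAt M f t w q) : p ≤ q := by
  induction h generalizing q with
  | nil => exact not_lt.1 (List.not_lt_nil q)
  | @take t w p _ ih =>
    obtain _ | ⟨a, q⟩ := q
    · exact absurd hq.prod.symm of_mul_ne_one
    · rcases (hq.le a (by simp)).eq_or_lt with rfl | ha
      · exact List.cons_le_cons _ (ih (hq.tail cs))
      · exact le_of_lt (List.cons_lt_cons_iff.2 (Or.inl ha))
  | @skip t w p hd _ ih =>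
    obtain _ | ⟨a, q⟩ := q
    · exact ih ⟨by simp, by simp, hq.prod⟩
    · rcases (hq.le a (by simp)).eq_or_lt with rfl | ha
      · refine absurd ?_ hd
        rw [← hq.prod, List.map_cons, artinProd_cons]
        exact dvd_mul_right _ _
      · exact ih (hq.succ ha)

theorem exists_le_eq_of_periodic (hf : f.Periodic n) (hn : 0 < n) (k t : ℕ) :
    ∃ j, t ≤ j ∧ f j = f k :=
  ⟨k + t * n, (Nat.le_mul_of_pos_right t hn).trans (Nat.le_add_left _ _), hf.nat_mul t k⟩

theorem exists_isSubwordAt (hf : f.Periodic n) (hn : 0 < n) {ω : List B}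
    (hω : ∀ i ∈ ω, i ∈ Set.range f) (t : ℕ) : ∃ q, IsSubwordAt M f t (M.artinProd ω) q := by
  induction ω generalizing t with
  | nil => exact ⟨[], by simp, by simp, rfl⟩
  | cons i ω ih =>
    obtain ⟨k, rfl⟩ := hω i (by simp)
    obtain ⟨j, hj, hjk⟩ := exists_le_eq_of_periodic hf hn k t
    obtain ⟨q, hq⟩ := ih (fun i hi => hω i (by simp [hi])) (j + 1)
    refine ⟨j :: q, hq.cons.lt, fun i hi => hj.trans (hq.cons.le i hi), ?_⟩
    rw [hq.cons.prod, artinProd_cons, hjk]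

theorem IsSubwordAt.exists_cons (hf : f.Periodic n) (hn : 0 < n)
    (h : IsSubwordAt M f t (PresentedMonoid.of M.BraidRel (f t) * w) p) :
    ∃ q, IsSubwordAt M f t (PresentedMonoid.of M.BraidRel (f t) * w) (t :: q) := by
  obtain ⟨ω, rfl⟩ := artinProd_surjective M w
  obtain ⟨q, hq⟩ := exists_isSubwordAt (M := M) hf hn (ω := ω) (fun i hi => by
    have hmem : i ∈ p.map f :=
      (mem_iff_of_artinProd_eq (h.prod.trans (artinProd_cons M _ _).symm) i).2
        (List.mem_cons_of_mem _ hi)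
    obtain ⟨k, -, hk⟩ := List.mem_map.1 hmem
    exact ⟨k, hk⟩) (t + 1)
  exact ⟨q, hq.cons⟩

theorem IsSubwordAt.isGreedy (cs : CoxeterSystem M W) (hf : f.Periodic n) (hn : 0 < n)
    (h : IsSubwordAt M f t w p) (hmin : ∀ q, IsSubwordAt M f t w q → p ≤ q) :
    IsGreedy M f t w p := by
  induction p generalizing t w with
  | nil =>
    rw [← h.prod]
    exact .nil
  | cons a p ih =>
    obtain ⟨m, hm⟩ := Nat.exists_eq_add_of_le (h.le a (by simp))
    induction m generalizing t with
    | zero =>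
      obtain rfl : a = t := hm
      obtain rfl : PresentedMonoid.of M.BraidRel (f a) * M.artinProd (p.map f) = w := by
        rw [← h.prod, List.map_cons, artinProd_cons]
      refine .take (ih (h.tail cs) fun q hq => ?_)
      have := hmin _ hq.cons
      exact not_lt.1 fun h => not_lt.2 this (List.cons_lt_cons_iff.2 (Or.inr ⟨rfl, h⟩))
    | succ m ihm =>
      refine .skip ?_ (ihm (h.succ (by omega)) (fun q hq => hmin q hq.of_succ) (by omega))
      rintro ⟨w', rfl⟩
      obtain ⟨q, hq⟩ := h.exists_cons hf hn
      exact absurd (hmin _ hq) (not_le.2 (List.cons_lt_cons_iff.2 (Or.inl (by omega))))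

/-- The `n` consecutive letters of the sequence `f` that start at position `t`. For `f` of period
`n`, passing from `t` to `t + 1` rotates the window. -/
def window (f : ℕ → B) (n t : ℕ) : List B := (List.range n).map fun k => f (t + k)

theorem exists_window_eq (hf : f.Periodic n) (hn : 0 < n) (t : ℕ) : ∃ c : List B,
    window f n t = f t :: c ∧ window f n (t + 1) = c ++ [f t] := by
  obtain ⟨n, rfl⟩ := Nat.exists_eq_succ_of_ne_zero hn.ne'
  refine ⟨(List.range n).map fun k => f (t + 1 + k), ?_, ?_⟩
  · rw [window, List.range_succ_eq_map, List.map_cons, List.map_map, Nat.add_zero]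
    congr 1
    exact List.map_congr_left fun k _ => congrArg f (by simp; omega)
  · rw [window, List.range_succ, List.map_append, List.map_singleton, ← hf t]
    congr 3
    omega

theorem IsCyclicSorting.exists_isGreedy (hf : f.Periodic n) (hn : 0 < n) {c ω : List B}
    (h : IsCyclicSorting M c w ω) (hc : c = window f n t) :
    ∃ p, IsGreedy M f t w p ∧ p.map f = ω ∧ ∀ k, k + n ∈ p → t ≤ k → k ∈ p := by
  induction h generalizing t with
  | nil => exact ⟨[], .nil, rfl, by simp⟩
  | @take s c w ω h ih =>
    obtain ⟨c', h1, h2⟩ := exists_window_eq hf hn t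
    obtain ⟨rfl, rfl⟩ := List.cons.inj (hc.trans h1)
    obtain ⟨p, hp, rfl, hdec⟩ := ih h2.symm
    refine ⟨t :: p, .take hp, rfl, fun k hk htk => ?_⟩
    rw [List.mem_cons] at hk ⊢
    rcases htk.eq_or_lt with rfl | htk
    · exact Or.inl rfl
    · exact Or.inr (hdec k (hk.resolve_left (by omega)) htk)
  | @skip s c w ω hs h ih =>
    obtain ⟨c', h1, h2⟩ := exists_window_eq hf hn t
    obtain ⟨rfl, rfl⟩ := List.cons.inj (hc.trans h1)
    obtain ⟨p, hp, rfl, hdec⟩ := ih h2.symm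
    refine ⟨p, .skip (fun hd => not_avoids_of_dvd hd ?_) hp, rfl, fun k hk htk => ?_⟩
    · rwa [← h.artinProd_eq, avoids_artinProd]
    · rcases htk.eq_or_lt with rfl | htk
      · exact absurd (List.mem_map.2 ⟨_, hk, hf t⟩) hs
      · exact hdec k hk htk

theorem mem_of_forall_add_mem (hinj : ∀ j k, f j = f k → j ≡ k [MOD n])
    (hdec : ∀ k, k + n ∈ p → t ≤ k → k ∈ p) {k : ℕ} (hk : k ∈ p) (htk : t ≤ k) (h : f k = f t) :
    t ∈ p := by
  obtain ⟨m, rfl⟩ : ∃ m, k = t + m * n := by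
    obtain ⟨m, hm⟩ := (Nat.modEq_iff_dvd' htk).1 (hinj t k h.symm)
    exact ⟨m, by rw [mul_comm, ← hm]; omega⟩
  clear h htk
  induction m with
  | zero => simpa using hk
  | succ m ih => exact ih (hdec _ (by rwa [add_assoc, ← Nat.succ_mul]) (Nat.le_add_right _ _))

theorem IsGreedy.isCyclicSorting (hf : f.Periodic n) (hn : 0 < n)
    (hinj : ∀ j k, f j = f k → j ≡ k [MOD n]) (h : IsGreedy M f t w p)
    (hdec : ∀ k, k + n ∈ p → t ≤ k → k ∈ p) :
    IsCyclicSorting M (window f n t) w (p.map f) := by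
  induction h with
  | nil => exact .nil
  | @take t w p _ ih =>
    obtain ⟨c, h1, h2⟩ := exists_window_eq hf hn t
    rw [h2] at ih
    rw [h1]
    refine .take (ih fun k hk htk => ?_)
    have := hdec k (List.mem_cons_of_mem _ hk) (by omega)
    exact (List.mem_cons.1 this).resolve_left (by omega)
  | @skip t w p _ h ih =>
    obtain ⟨c, h1, h2⟩ := exists_window_eq hf hn t
    rw [h2] at ih
    rw [h1]
    refine .skip (fun hm => ?_) (ih fun k hk htk => hdec k hk (by omega))
    obtain ⟨k, hk, e⟩ := List.mem_map.1 hm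
    have hle := h.isSubwordAt.le
    have := hle t (mem_of_forall_add_mem hinj hdec hk (Nat.le_of_succ_le (hle k hk)) e)
    omega

end Greedy
/-! ### Positions in the periodic word -/

section Position

variable {B : Type*} {c : List B}

/-- The place of a position of `c c c ⋯` when the letters are numbered consecutively from `0`. -/
def positionIndex (x : Position c) : ℕ := (ofLex x).1 * c.length + (ofLex x).2

theorem strictMono_positionIndex : StrictMono (positionIndex (c := c)) := by
  intro x y h
  have hx := (ofLex x).2.2
  rw [Prod.Lex.lt_iff] at h
  unfold positionIndex
  rcases h with h | ⟨h1, h2⟩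
  · have := Nat.mul_le_mul_right c.length (Nat.succ_le_of_lt h)
    rw [Nat.succ_mul] at this
    omega
  · rw [h1]
    exact Nat.add_lt_add_left h2 _

theorem exists_positionIndex_eq (hc : 0 < c.length) (t : ℕ) :
    ∃ x : Position c, positionIndex x = t :=
  ⟨toLex (t / c.length, ⟨t % c.length, Nat.mod_lt _ hc⟩), Nat.div_add_mod' t c.length⟩

theorem exists_map_positionIndex_eq (hc : 0 < c.length) (q : List ℕ) :
    ∃ p : List (Position c), p.map positionIndex = q :=
  List.map_surjective_iff.2 (exists_positionIndex_eq hc) q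

theorem positionIndex_succ (k : ℕ) (j : Fin c.length) :
    positionIndex (toLex (k + 1, j)) = positionIndex (toLex (k, j)) + c.length := by
  simp only [positionIndex, ofLex_toLex, Nat.succ_mul]
  omega

theorem map_lt_map_iff {α β : Type*} [LinearOrder α] [LinearOrder β] {e : α → β}
    (he : StrictMono e) {p q : List α} : p.map e < q.map e ↔ p < q := by
  induction p generalizing q with
  | nil => cases q <;> simp
  | cons a p ih =>
    cases q with
    | nil => simp
    | cons b q =>
      rw [List.map_cons, List.map_cons, List.cons_lt_cons_iff, List.cons_lt_cons_iff, he.lt_iff_lt,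
        he.injective.eq_iff, ih]

theorem map_le_map_iff {α β : Type*} [LinearOrder α] [LinearOrder β] {e : α → β}
    (he : StrictMono e) {p q : List α} : p.map e ≤ q.map e ↔ p ≤ q := by
  rw [← not_lt, map_lt_map_iff he, not_lt]

/-- The letter of `c c c ⋯` at a given place, counted from `0`. -/
def letterAt (hc : 0 < c.length) (t : ℕ) : B := c.get ⟨t % c.length, Nat.mod_lt _ hc⟩

theorem letterAt_positionIndex (hc : 0 < c.length) (x : Position c) :
    letterAt hc (positionIndex x) = c.get (ofLex x).2 := by
  simp [letterAt, positionIndex, Nat.mod_eq_of_lt]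

theorem periodic_letterAt (hc : 0 < c.length) : (letterAt hc).Periodic c.length := fun t => by
  simp [letterAt]

theorem modEq_of_letterAt_eq (hc : 0 < c.length) (hnd : c.Nodup) (j k : ℕ)
    (h : letterAt hc j = letterAt hc k) : j ≡ k [MOD c.length] :=
  hnd.getElem_inj_iff.1 h

theorem window_letterAt (hc : 0 < c.length) : window (letterAt hc) c.length 0 = c :=
  List.ext_getElem (by simp [window]) fun k _ hk => by simp [window, letterAt, Nat.mod_eq_of_lt hk]

theorem map_letterAt_map_positionIndex (hc : 0 < c.length) (p : List (Position c)) :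
    (p.map positionIndex).map (letterAt hc) = subword c p := by
  rw [List.map_map]
  exact List.map_congr_left fun x _ => letterAt_positionIndex hc x

theorem isDecreasing_iff (hc : 0 < c.length) {p : List (Position c)} : IsDecreasing c p ↔
    ∀ k, k + c.length ∈ p.map positionIndex → 0 ≤ k → k ∈ p.map positionIndex := by
  have mem_iff (x : Position c) : positionIndex x ∈ p.map positionIndex ↔ x ∈ p :=
    List.mem_map_of_injective strictMono_positionIndex.injective
  constructor
  · intro h k hk _
    obtain ⟨x, rfl⟩ := exists_positionIndex_eq hc k
    obtain ⟨k, j⟩ := x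
    exact (mem_iff _).2 (h k j ((mem_iff _).1 (by rwa [positionIndex_succ])))
  · intro h k j hk
    rw [← mem_iff, positionIndex_succ] at hk
    exact (mem_iff _).1 (h _ hk (Nat.zero_le _))

theorem eq_of_isFirstSubword {E : Set (List B)} {p q : List (Position c)}
    (hp : IsFirstSubword c E p) (hq : IsFirstSubword c E q) : p = q :=
  le_antisymm (hp.2.2 q hq.1 hq.2.1) (hq.2.2 p hp.1 hp.2.1)

end Position

section SortingWord

variable {B : Type*} {M : CoxeterMatrix B} {W : Type*} [Group W] {c ω : List B}
  {w : M.ArtinMonoid} {p : List (Position c)}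

theorem isSubwordAt_map_positionIndex (hc : 0 < c.length) :
    IsSubwordAt M (letterAt hc) 0 w (p.map positionIndex) ↔
      p.Pairwise (· < ·) ∧ subword c p ∈ artinWords M w := by
  have hp : (p.map positionIndex).Pairwise (· < ·) ↔ p.Pairwise (· < ·) := by
    simp only [List.pairwise_map, strictMono_positionIndex.lt_iff_lt]
  rw [← map_letterAt_map_positionIndex hc, ← hp]
  exact ⟨fun h => ⟨h.lt, h.prod⟩, fun h => ⟨h.1, fun _ _ => Nat.zero_le _, h.2⟩⟩

theorem isFirstSubword_iff_isGreedy (cs : CoxeterSystem M W) (hc : 0 < c.length) :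
    IsFirstSubword c (artinWords M w) p ↔
      IsGreedy M (letterAt hc) 0 w (p.map positionIndex) := by
  constructor
  · rintro ⟨h1, h2, h3⟩
    refine IsSubwordAt.isGreedy cs (periodic_letterAt hc) hc
      ((isSubwordAt_map_positionIndex hc).2 ⟨h1, h2⟩) fun q hq => ?_
    obtain ⟨q, rfl⟩ := exists_map_positionIndex_eq hc q
    obtain ⟨h4, h5⟩ := (isSubwordAt_map_positionIndex hc).1 hq
    exact (map_le_map_iff strictMono_positionIndex).2 (h3 q h4 h5)
  · intro h
    obtain ⟨h1, h2⟩ := (isSubwordAt_map_positionIndex hc).1 h.isSubwordAt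
    refine ⟨h1, h2, fun q h3 h4 => ?_⟩
    exact (map_le_map_iff strictMono_positionIndex).1
      (h.le cs ((isSubwordAt_map_positionIndex hc).2 ⟨h3, h4⟩))

theorem isArtinSorting_of_isFirstSubword (cs : CoxeterSystem M W) (hnd : c.Nodup)
    (hp : IsFirstSubword c (artinWords M w) p) (hdec : IsDecreasing c p) :
    IsArtinSorting M c w (subword c p) := by
  rcases Nat.eq_zero_or_pos c.length with h0 | hc
  · obtain rfl : p = [] := List.eq_nil_iff_forall_not_mem.2 fun x _ =>
      absurd (ofLex x).2.2 (by omega)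
    obtain rfl : M.artinProd [] = w := hp.2.1
    exact isArtinSorting_one c
  · have := ((isFirstSubword_iff_isGreedy cs hc).1 hp).isCyclicSorting (periodic_letterAt hc) hc
      (modEq_of_letterAt_eq hc hnd) ((isDecreasing_iff hc).1 hdec)
    rwa [window_letterAt, map_letterAt_map_positionIndex, isCyclicSorting_iff hnd] at this

theorem exists_isFirstSubword (cs : CoxeterSystem M W) (hnd : c.Nodup)
    (h : IsArtinSorting M c w ω) :
    ∃ p, IsFirstSubword c (artinWords M w) p ∧ IsDecreasing c p ∧ subword c p = ω := by
  rcases Nat.eq_zero_or_pos c.length with h0 | hc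
  · obtain rfl := List.eq_nil_of_length_eq_zero h0
    cases h
    exact ⟨[], ⟨.nil, artinProd_nil M, fun q _ _ => not_lt.1 (List.not_lt_nil q)⟩,
      fun k j => j.elim0, rfl⟩
  · obtain ⟨q, h1, h2, h3⟩ := ((isCyclicSorting_iff hnd).2 h).exists_isGreedy
      (periodic_letterAt hc) hc (window_letterAt hc).symm
    obtain ⟨p, rfl⟩ := exists_map_positionIndex_eq hc q
    exact ⟨p, (isFirstSubword_iff_isGreedy cs hc).2 h1, (isDecreasing_iff hc).2 h3,
      (map_letterAt_map_positionIndex hc p).symm.trans h2⟩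

theorem isSortable_iff (cs : CoxeterSystem M W) (hnd : c.Nodup) :
    IsSortable c w ↔ IsArtinSortable M c w := by
  constructor
  · rintro ⟨p, h1, h2⟩
    exact ⟨_, isArtinSorting_of_isFirstSubword cs hnd h1 h2⟩
  · rintro ⟨ω, h⟩
    obtain ⟨p, h1, h2, -⟩ := exists_isFirstSubword cs hnd h
    exact ⟨p, h1, h2⟩

theorem isParabolicSortable_iff (cs : CoxeterSystem M W) (hnd : c.Nodup) {v : W} :
    cs.IsParabolicSortable c v ↔ IsArtinSortable M c (cs.toArtin v) := by
  rw [IsParabolicSortable, ← isSortable_iff cs hnd, IsSortable, artinWords_toArtin]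
  refine and_iff_right_of_imp fun ⟨p, h1, _⟩ => ?_
  rw [← h1.2.1.2]
  refine wordProd_mem_parabolic cs fun i hi => ?_
  obtain ⟨x, -, rfl⟩ := List.mem_map.1 hi
  exact List.get_mem _ _

theorem exists_isFirstSubword_reducedWords (cs : CoxeterSystem M W) (hnd : c.Nodup) {v : W}
    (h : IsSorting cs c v ω) :
    ∃ p, IsFirstSubword c (cs.reducedWords v) p ∧ subword c p = ω := by
  obtain ⟨p, h1, -, h2⟩ := exists_isFirstSubword cs hnd h.isArtinSorting
  exact ⟨p, artinWords_toArtin cs v ▸ h1, h2⟩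

theorem isRestrictionWord_of_isRestriction [Finite W] (cs : CoxeterSystem M W) (hnd : c.Nodup)
    {v : W} {d : List B} (h : cs.IsRestriction c v d) : IsRestrictionWord cs c v d := by
  obtain ⟨h1, h2, p, h3, h4⟩ := h
  obtain ⟨ω, hω⟩ := exists_isSorting_longest cs hnd
  obtain ⟨q, h5, rfl⟩ := exists_isFirstSubword_reducedWords cs hnd hω
  rw [eq_of_isFirstSubword h3 h5] at h4
  exact isRestrictionWord_of_sublist cs hnd hω h1 h2 h4

theorem exists_isRestriction [Finite W] (cs : CoxeterSystem M W) (hnd : c.Nodup)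
    {v : W} (hv : v ∈ cs.parabolic {i | i ∈ c}) : ∃ d, cs.IsRestriction c v d := by
  obtain ⟨ω, hω⟩ := exists_isSorting_longest cs hnd
  obtain ⟨d, h1, h2, h3⟩ := exists_sublist_leftInvSeq cs hω hv
  obtain ⟨p, h5, rfl⟩ := exists_isFirstSubword_reducedWords cs hnd hω
  exact ⟨d, h1, h2, p, h5, h3⟩

end SortingWord
/-! ### Factorwise sortable elements -/

section Factorwise

variable {B : Type*} {M : CoxeterMatrix B} {W : Type*} [Group W] [Finite W]
  (cs : CoxeterSystem M W) {c : List B} {w : M.ArtinMonoid} {m : ℕ}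

theorem isFactorwiseSortable_iff : cs.IsFactorwiseSortable m c w ↔ ∃ C : ℕ → List B, C 0 = c ∧
    (∀ i, i + 1 < m → cs.IsRestriction (C i) (head cs ((rest cs)^[i] w)) (C (i + 1))) ∧
    ∀ i, i < m → cs.IsParabolicSortable (C i) (head cs ((rest cs)^[i] w)) := by
  constructor
  · rintro ⟨v, C, hv, hC⟩
    obtain rfl : v = fun i => head cs ((rest cs)^[i] w) :=
      funext (eq_head_of_isGarsideFactorization cs hv)
    exact ⟨C, hC⟩
  · rintro ⟨C, hC⟩
    exact ⟨_, C, isGarsideFactorization_head cs w, hC⟩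

theorem isFactorwiseSortable_zero : cs.IsFactorwiseSortable 0 c w :=
  (isFactorwiseSortable_iff cs).2 ⟨fun _ => c, rfl, by simp, by simp⟩

theorem isFactorwiseSortable_succ_iff (hc : c.Nodup) : cs.IsFactorwiseSortable (m + 1) c w ↔
    cs.IsParabolicSortable c (head cs w) ∧
      ∃ d, cs.IsRestriction c (head cs w) d ∧ cs.IsFactorwiseSortable m d (rest cs w) := by
  constructor
  · intro h
    obtain ⟨C, rfl, hres, hsort⟩ := (isFactorwiseSortable_iff cs).1 h
    have hhead := hsort 0 (Nat.succ_pos m)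
    obtain _ | m := m
    · obtain ⟨d, hd⟩ := exists_isRestriction cs hc hhead.1
      exact ⟨hhead, d, hd, isFactorwiseSortable_zero cs⟩
    · exact ⟨hhead, C 1, hres 0 (by omega), (isFactorwiseSortable_iff cs).2
        ⟨fun i => C (i + 1), rfl, fun i hi => hres (i + 1) (by omega),
          fun i hi => hsort (i + 1) (by omega)⟩⟩
  · rintro ⟨hhead, d, hd, h⟩
    obtain ⟨C, rfl, hres, hsort⟩ := (isFactorwiseSortable_iff cs).1 h
    refine (isFactorwiseSortable_iff cs).2 ⟨fun i => Nat.casesOn i c C, rfl,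
      fun i hi => ?_, fun i hi => ?_⟩
    · obtain _ | i := i
      · exact hd
      · exact hres i (by omega)
    · obtain _ | i := i
      · exact hhead
      · exact hsort i (by omega)

theorem isArtinSortable_iff_isFactorwiseSortable (hc : c.Nodup) (hw : IsSimpleProd cs m w) :
    IsArtinSortable M c w ↔ cs.IsFactorwiseSortable m c w := by
  induction m generalizing c w with
  | zero =>
    obtain rfl := (isSimpleProd_zero cs).1 hw
    exact iff_of_true ⟨[], isArtinSorting_one c⟩ (isFactorwiseSortable_zero cs)
  | succ m ih =>
    have split {d : List B} (hd : cs.IsRestriction c (head cs w) d) : IsArtinSortable M c w ↔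
        cs.IsParabolicSortable c (head cs w) ∧ cs.IsFactorwiseSortable m d (rest cs w) := by
      rw [sortsByHead cs hc w d (isRestrictionWord_of_isRestriction cs hc hd),
        isParabolicSortable_iff cs hc, ih hd.1 hw.rest]
    rw [isFactorwiseSortable_succ_iff cs hc]
    constructor
    · intro h
      obtain ⟨d, hd⟩ := exists_isRestriction cs hc (head_mem_parabolic cs fun i hi => h.avoids hi)
      obtain ⟨h1, h2⟩ := (split hd).1 h
      exact ⟨h1, d, hd, h2⟩
    · rintro ⟨h1, d, hd, h2⟩
      exact (split hd).2 ⟨h1, h2⟩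

end Factorwise

end CoxeterSortable

end

open CoxeterSortable in
theorem mainTheorem10_general {B : Type*} {M : CoxeterMatrix B} {W : Type*} [Group W] [Finite W]
    (cs : CoxeterSystem M W) (c : List B) (hc : c.Nodup)
    (m : ℕ) (w : M.ArtinMonoid) (hw : w ∈ cs.mWeak m) :
    CoxeterSystem.IsSortable c w ↔ cs.IsFactorwiseSortable m c w := by
  rw [isSortable_iff cs hc]
  exact isArtinSortable_iff_isFactorwiseSortable cs hc (isSimpleProd_of_mem_mWeak cs hw)

theorem mainTheorem10 {B : Type*} {M : CoxeterMatrix B} {W : Type*} [Group W] [Finite W]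
    (cs : CoxeterSystem M W) (c : List B) (hc : CoxeterSystem.IsCoxeterWord c)
    (m : ℕ) (w : M.ArtinMonoid) (hw : w ∈ cs.mWeak m) :
    CoxeterSystem.IsSortable c w ↔ cs.IsFactorwiseSortable m c w :=
  mainTheorem10_general cs c hc.1 m w hw
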